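/- Let $d\ge 1$, let $W^d=\{x\in\mathbb R^d: x_1<\dots<x_d\}$, and let $(X_{ij})_{i\ge 1,\,1\le j\le d}$ be independent exponential random variables with rate $1$. For $x\in W^d$ let $S(n)=(S_1(n),\dots,S_d(n))$ be the random walk $S_j(n)=x_j+\sum_{i=1}^n X_{ij}$ started from $x$, with law $\mathbb P_x$. Write $a\prec b$ if $a_1\le b_1\le a_2\le b_2\le\dots\le a_d\le b_d$, and let $$\rho=\inf\{n\ge 1: S(n-1)\not\prec S(n)\},\qquad \tau=\inf\{n\ge 1: S(n)\notin W^d\}.$$ Let $\widetilde G_n(x,z)$ and $G_n(x,z)$, $x,z\in W^d$, be the transition densities of the killed walks, $$\widetilde G_n(x,z)\,dz=\mathbb P_x(S(n)\in dz,\ \rho>n),\qquad G_n(x,z)\,dz=\mathbb P_x(S(n)\in dz,\ \tau>n);$$ these densities exist for $n\ge1$, and for $n\ge 2$ they have versions that are continuous in $z\in W^d$, which are the ones used. Let $\Delta(x)=\prod_{1\le i<j\le d}(x_j-x_i)$, let $$h(x)=\mathbb E[\Delta(x_1+\eta_1,\dots,x_d+\eta_d)],\qquad \hat h(x)=h(-x_d,\dots,-x_1),$$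 where $\eta_1=0$ and $\eta_j\sim\mathrm{Gamma}(j-1,1)$, $2\le j\le d$, are independent, and let $\chi=(2\pi)^{-d/2}\big(\prod_{j=1}^{d-1}j!\big)^{-1}$. Theorem. Let $(a_n)$ be a sequence of real numbers with $a_n=o(\sqrt n)$. Then, as $n\to\infty$, $$\frac{\widetilde G_n(x,n+z)}{\chi\,\Delta(x)\,\Delta(z)\,n^{-d(d-1)/2-d/2}}\to 1,\qquad \frac{G_n(x,n+z)}{\chi\,h(x)\,\hat h(z)\,n^{-d(d-1)/2-d/2}}\to 1,$$ uniformly over all $x,z\in W^d$ with $x_d-x_1\le a_n$, $z_d-z_1\le a_n$ and $|z_1-x_1|\le a_n$, where $n+z=(n+z_1,\dots,n+z_d)$. -/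

import Mathlib

open MeasureTheory ProbabilityTheory Filter Topology Asymptotics

namespace OrderedWalk

/-- The Weyl chamber `W^d = {x_1 < x_2 < ... < x_d}`. -/
def weylChamber (d : ℕ) : Set (Fin d → ℝ) := {x | StrictMono x}

/-- Interlacing `a ≺ b`: `a_1 ≤ b_1 ≤ a_2 ≤ b_2 ≤ ... ≤ a_d ≤ b_d`. -/
def Interlace {d : ℕ} (a b : Fin d → ℝ) : Prop :=
  (∀ j, a j ≤ b j) ∧ ∀ j k : Fin d, (k : ℕ) = (j : ℕ) + 1 → b j ≤ a k

/-- The random walk `S_j(n) = x_j + ∑_{i ≤ n} X_{ij}` started from `x`; the increments of the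
`(i+1)`-st step are `X i`, for `i = 0, 1, 2, ...`. -/
def walk {Ω : Type*} {d : ℕ} (X : ℕ → Fin d → Ω → ℝ) (x : Fin d → ℝ) (n : ℕ) (ω : Ω) :
    Fin d → ℝ :=
  fun j => x j + ∑ i ∈ Finset.range n, X i j ω

/-- `ρ = inf {n ≥ 1 : S(n-1) ⊀ S(n)}` for the walk started from `x`, with `inf ∅ = ⊤`. -/
noncomputable def rho {Ω : Type*} {d : ℕ} (X : ℕ → Fin d → Ω → ℝ) (x : Fin d → ℝ) (ω : Ω) : ℕ∞ :=
  ⨅ n ∈ {n : ℕ | 1 ≤ n ∧ ¬ Interlace (walk X x (n - 1) ω) (walk X x n ω)}, (n : ℕ∞)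

/-- `τ = inf {n ≥ 1 : S(n) ∉ W^d}` for the walk started from `x`, with `inf ∅ = ⊤`. -/
noncomputable def tau {Ω : Type*} {d : ℕ} (X : ℕ → Fin d → Ω → ℝ) (x : Fin d → ℝ) (ω : Ω) : ℕ∞ :=
  ⨅ n ∈ {n : ℕ | 1 ≤ n ∧ walk X x n ω ∉ weylChamber d}, (n : ℕ∞)

/-- `G n x z` is the transition density on `W^d` of the walk killed at the random time `T`:
`P_x(S(n) ∈ dz, T > n) = G n x z dz` for `n ≥ 1` and `x, z ∈ W^d`. For `n ≥ 2` the density is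
required to be continuous in `z ∈ W^d`, which determines its value at every point of `W^d`. -/
structure IsKilledDensity {Ω : Type*} [MeasurableSpace Ω] {d : ℕ} (P : Measure Ω)
    (X : ℕ → Fin d → Ω → ℝ) (T : (Fin d → ℝ) → Ω → ℕ∞)
    (G : ℕ → (Fin d → ℝ) → (Fin d → ℝ) → ℝ) : Prop where
  nonneg : ∀ n, 1 ≤ n → ∀ x ∈ weylChamber d, ∀ z ∈ weylChamber d, 0 ≤ G n x z
  continuousOn : ∀ n, 2 ≤ n → ∀ x ∈ weylChamber d, ContinuousOn (G n x) (weylChamber d)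
  law : ∀ n, 1 ≤ n → ∀ x ∈ weylChamber d, ∀ A : Set (Fin d → ℝ), MeasurableSet A →
    A ⊆ weylChamber d →
      P {ω | walk X x n ω ∈ A ∧ (n : ℕ∞) < T x ω} = ∫⁻ z in A, ENNReal.ofReal (G n x z)

/-- The Vandermonde product `Δ(x) = ∏_{i < j} (x_j - x_i)`. -/
def vandermonde {d : ℕ} (x : Fin d → ℝ) : ℝ :=
  ∏ i : Fin d, ∏ j ∈ Finset.Ioi i, (x j - x i)

/-- The law of `η_j` (with `j` counted from `0`): `η_0 = 0` and `η_j ~ Gamma(j, 1)` for `j ≥ 1`. -/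
noncomputable def etaLaw (j : ℕ) : Measure ℝ :=
  if j = 0 then Measure.dirac 0 else gammaMeasure j 1

instance isProbabilityMeasure_etaLaw (j : ℕ) : IsProbabilityMeasure (etaLaw j) := by
  unfold etaLaw
  split_ifs with h
  · infer_instance
  · exact isProbabilityMeasure_gammaMeasure (by exact_mod_cast Nat.pos_of_ne_zero h) one_pos

/-- `h(x) = E[Δ(x_1 + η_1, ..., x_d + η_d)]` with independent `η_j`. -/
noncomputable def h {d : ℕ} (x : Fin d → ℝ) : ℝ :=
  ∫ η, vandermonde (x + η) ∂(Measure.pi fun j : Fin d => etaLaw j)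

/-- `ĥ(x_1, ..., x_d) = h(-x_d, ..., -x_1)`. -/
noncomputable def hHat {d : ℕ} (x : Fin d → ℝ) : ℝ :=
  h fun j => -x (Fin.rev j)

/-- `χ = (2π)^{-d/2} (∏_{j=1}^{d-1} j!)^{-1}`. -/
noncomputable def chi (d : ℕ) : ℝ :=
  (2 * Real.pi) ^ (-(d : ℝ) / 2) * (∏ j ∈ Finset.Icc 1 (d - 1), (Nat.factorial j : ℝ))⁻¹

end OrderedWalk

/-!
Write `p_k` for the Gamma density of shape `k` (`gammaDens`), with `p_k = 0` for `k ≤ 0`. Both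
killed walks are solvable by determinants:
`densRho n x z = det (p_n (z_j - x_i))` and `densTau n x z = det (p_{n + i - j} (z_j - x_i))`.
Since a step has density `exp (-∑ (z_j - w_j))` on `w ≤ z`, each formula amounts, after removal of
the exponential factor, to one integral identity for determinants of truncated powers. Under
interlacing the coordinates range independently over intervals, and the integrals of the columns
telescope (`detRho_succ_eq_integral`). In the chamber the coordinates are integrated out one at a
time from the largest down; the boundary term of each integration equals a neighbouring column
(`det_updateCol_integral_chainInterval`, `lintegral_detTau`). The Markov property then identifies
the densities (`isKilledDensity_densRho`, `isKilledDensity_densTau`), and continuity makes them the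
only ones from the second step on (`IsKilledDensity.eqOn`).

The local limit of `det (p_n (n + z_j - x_i))` rests on the factorization
`1 + (z - x) / n = (1 - x / n) (1 + z / n) (1 + α γ / n)` with `α = √n x / (n - x)` and
`γ = √n z / (n + z)`. The first two factors leave the determinant as row and column factors. In
`det ((1 + α_i γ_j / n) ^ (n - 1))` the powers of `α_i` and `γ_j` are expanded in the Newton bases
at the nodes themselves, which extracts `vandermonde α * vandermonde γ` exactly and leaves a matrix
tending to `diag (1 / l!)` (`det_one_add_mul_pow`, `tendsto_binomialCore_det`). The resulting
relative error is uniform over all nodes of smaller order than `√n`, however close to one another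
they are (`exists_tendsto_det_gammaDens`). This settles the interlacing walk.

For the walk in the chamber, `p_{m + k}` is the convolution of `p_m` with the law of a Gamma variable
of shape `k`. Taking `m = n - (d - 1)` and convolving row `i` with `η_i` and column `j` with an
independent `η'_j` of shape `d - 1 - j` yields
`densTau n x z = E det (p_m (z_j - η'_j - x_i - η_i))` (`densTau_eq_integral`). The integrand is
close to `χ Δ(x + η) Δ(z - η')`, whose mean is `χ h(x) ĥ(z)`. The error is small relative to
`∏ (1 + x_j - x_i) ∏ (1 + z_j - z_i)` (`eventually_abs_shifted_det_sub_le`), so it remains to bound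
`h` from below by a multiple of `∏ (1 + x_j - x_i)` (`exists_gapProd_le_h`). For this, `h` is built
from `vandermonde` by a succession of averages over one exponential displacement at a time. Averaging
over a displacement of `x_j` beyond `x_{j+1}` contributes nothing, by the lack of memory, so that
all the averages are of nonnegative quantities and may be restricted to displacements which open
every gap by a definite amount.
-/

namespace OrderedWalk

/-! ### Truncated powers -/

/-- The truncated power `u₊^{k-1} / (k-1)!`; it vanishes identically for `k = 0`. For `k ≥ 1`,
`exp (-u) * truncPow k u` is the density of the Gamma distribution of shape `k` and rate `1`. -/
noncomputable def truncPow : ℕ → ℝ → ℝ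
  | 0, _ => 0
  | k + 1, u => if 0 ≤ u then u ^ k / (k.factorial : ℝ) else 0

@[simp] lemma truncPow_zero (u : ℝ) : truncPow 0 u = 0 := rfl

lemma truncPow_succ (k : ℕ) (u : ℝ) :
    truncPow (k + 1) u = if 0 ≤ u then u ^ k / (k.factorial : ℝ) else 0 := rfl

lemma truncPow_of_neg (k : ℕ) {u : ℝ} (hu : u < 0) : truncPow k u = 0 := by
  cases k with
  | zero => rfl
  | succ k => rw [truncPow_succ, if_neg (not_le.2 hu)]

lemma truncPow_succ_of_nonneg (k : ℕ) {u : ℝ} (hu : 0 ≤ u) :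
    truncPow (k + 1) u = u ^ k / (k.factorial : ℝ) := by
  rw [truncPow_succ, if_pos hu]

lemma truncPow_nonneg (k : ℕ) (u : ℝ) : 0 ≤ truncPow k u := by
  cases k with
  | zero => exact le_rfl
  | succ k => rw [truncPow_succ]; split_ifs <;> positivity

@[fun_prop] lemma measurable_truncPow (k : ℕ) : Measurable (truncPow k) := by
  cases k with
  | zero => exact measurable_const
  | succ k => exact Measurable.ite measurableSet_Ici (by fun_prop) measurable_const

lemma truncPow_add_two (k : ℕ) (u : ℝ) :
    truncPow (k + 2) u = max u 0 ^ (k + 1) / ((k + 1).factorial : ℝ) := by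
  rw [truncPow_succ]
  split_ifs with hu
  · rw [max_eq_left hu]
  · rw [max_eq_right (not_le.1 hu).le]; simp

lemma continuous_truncPow {k : ℕ} (hk : 2 ≤ k) : Continuous (truncPow k) := by
  obtain ⟨k, rfl⟩ := Nat.exists_eq_add_of_le' hk
  simp only [funext (truncPow_add_two k)]
  fun_prop

lemma abs_truncPow_le (k : ℕ) {u b : ℝ} (hu : u ≤ b) :
    |truncPow k u| ≤ max b 1 ^ k := by
  cases k with
  | zero => simp
  | succ k =>
    rw [abs_of_nonneg (truncPow_nonneg _ _), truncPow_succ]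
    split_ifs with h0
    · calc u ^ k / (k.factorial : ℝ) ≤ u ^ k :=
            div_le_self (by positivity) (by exact_mod_cast Nat.factorial_pos k)
        _ ≤ max b 1 ^ k := pow_le_pow_left₀ h0 (hu.trans (le_max_left _ _)) _
        _ ≤ max b 1 ^ (k + 1) := pow_le_pow_right₀ (le_max_right _ _) (Nat.le_succ k)
    · positivity

lemma integrableOn_Ioc_truncPow (k : ℕ) (c a b : ℝ) :
    IntegrableOn (fun t => truncPow k (t - c)) (Set.Ioc a b) := by
  refine Measure.integrableOn_of_bounded (M := max (b - c) 1 ^ k) (by simp)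
    (by fun_prop : Measurable _).aestronglyMeasurable ?_
  filter_upwards [ae_restrict_mem measurableSet_Ioc] with t ht
  exact abs_truncPow_le k (by linarith [ht.2])

lemma intervalIntegrable_truncPow (k : ℕ) (a b : ℝ) :
    IntervalIntegrable (truncPow k) volume a b :=
  ⟨by simpa using integrableOn_Ioc_truncPow k 0 a b,
    by simpa using integrableOn_Ioc_truncPow k 0 b a⟩

lemma integral_truncPow_zero_left (k : ℕ) (b : ℝ) :
    ∫ t in (0 : ℝ)..b, truncPow (k + 1) t = truncPow (k + 2) b := by
  rcases le_or_gt 0 b with hb | hb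
  · have : ∫ t in (0 : ℝ)..b, truncPow (k + 1) t = ∫ t in (0 : ℝ)..b, t ^ k / (k.factorial : ℝ) := by
      refine intervalIntegral.integral_congr fun t ht => ?_
      rw [Set.uIcc_of_le hb] at ht
      exact truncPow_succ_of_nonneg k ht.1
    rw [this, intervalIntegral.integral_div, integral_pow, truncPow_succ_of_nonneg _ hb,
      Nat.factorial_succ]
    push_cast
    field_simp
    simp
  · rw [truncPow_of_neg _ hb, intervalIntegral.integral_symm, neg_eq_zero,
      intervalIntegral.integral_of_le hb.le, integral_Ioc_eq_integral_Ioo]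
    exact setIntegral_eq_zero_of_forall_eq_zero fun t ht => truncPow_of_neg _ ht.2

lemma integral_Ioc_truncPow {k : ℕ} (hk : 1 ≤ k) (c : ℝ) {a b : ℝ} (hab : a ≤ b) :
    ∫ t in Set.Ioc a b, truncPow k (t - c) = truncPow (k + 1) (b - c) - truncPow (k + 1) (a - c) := by
  obtain ⟨k, rfl⟩ := Nat.exists_eq_add_of_le' hk
  rw [← intervalIntegral.integral_of_le hab,
    intervalIntegral.integral_comp_sub_right (fun t => truncPow (k + 1) t),
    ← integral_truncPow_zero_left, ← integral_truncPow_zero_left,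
    intervalIntegral.integral_interval_sub_left (intervalIntegrable_truncPow _ _ _)
      (intervalIntegrable_truncPow _ _ _)]

lemma integrableOn_Iic_truncPow (k : ℕ) (c b : ℝ) :
    IntegrableOn (fun t => truncPow k (t - c)) (Set.Iic b) := by
  refine (integrableOn_Ioc_truncPow k c (c - 1) b).of_forall_sdiff_eq_zero measurableSet_Iic ?_
  intro t ht
  refine truncPow_of_neg _ ?_
  by_contra hlt
  exact ht.2 ⟨by linarith, ht.1⟩

lemma integral_Iic_truncPow {k : ℕ} (hk : 1 ≤ k) (c b : ℝ) :
    ∫ t in Set.Iic b, truncPow k (t - c) = truncPow (k + 1) (b - c) := by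
  have h1 : ∫ t in Set.Iic b, truncPow k (t - c)
      = ∫ t in Set.Ioc (min (c - 1) b) b, truncPow k (t - c) := by
    refine setIntegral_eq_of_subset_of_forall_sdiff_eq_zero measurableSet_Iic
      (fun t ht => ht.2) fun t ht => truncPow_of_neg _ ?_
    by_contra hlt
    exact ht.2 ⟨(min_le_left _ _).trans_lt (by linarith), ht.1⟩
  rw [h1, integral_Ioc_truncPow hk c (min_le_right _ _),
    truncPow_of_neg (u := min (c - 1) b - c) _ (by linarith [min_le_left (c - 1) b]), sub_zero]

/-! ### Determinants with one integrated column -/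

/-- A determinant vanishes when its first `j + 1` columns are supported on the first `j` rows. -/
lemma det_eq_zero_of_block {d : ℕ} (M : Matrix (Fin d) (Fin d) ℝ) (j : Fin d)
    (hM : ∀ c, c ≤ j → ∀ r, j ≤ r → M r c = 0) : M.det = 0 := by
  rw [Matrix.det_apply]
  refine Finset.sum_eq_zero fun σ _ => ?_
  have : ∃ c ≤ j, j ≤ σ c := by
    by_contra! hcon
    have hsub : (Finset.Iic j).image σ ⊆ Finset.Iio j := by
      intro r hr
      obtain ⟨c, hc, rfl⟩ := Finset.mem_image.1 hr
      exact Finset.mem_Iio.2 (hcon c (Finset.mem_Iic.1 hc))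
    have := Finset.card_le_card hsub
    rw [Finset.card_image_of_injective _ σ.injective, Fin.card_Iic, Fin.card_Iio] at this
    omega
  obtain ⟨c, hc, hj⟩ := this
  rw [Finset.prod_eq_zero (f := fun i => M (σ i) i) (Finset.mem_univ c) (hM c hc _ hj), smul_zero]

lemma det_updateCol_eq_sum {d : ℕ} (B : Matrix (Fin d) (Fin d) ℝ) (j : Fin d) (v : Fin d → ℝ) :
    (B.updateCol j v).det = ∑ i, B.adjugate j i * v i := by
  rw [← Matrix.cramer_apply, Matrix.cramer_eq_adjugate_mulVec]
  rfl

lemma integral_det_updateCol {d : ℕ} (B : Matrix (Fin d) (Fin d) ℝ) (j : Fin d) (S : Set ℝ)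
    (v : Fin d → ℝ → ℝ) (hv : ∀ i, IntegrableOn (v i) S) :
    IntegrableOn (fun t => (B.updateCol j fun i => v i t).det) S ∧
    ∫ t in S, (B.updateCol j fun i => v i t).det =
      (B.updateCol j fun i => ∫ t in S, v i t).det := by
  simp only [det_updateCol_eq_sum]
  constructor
  · exact integrable_finsetSum _ fun i _ => (hv i).const_mul _
  · rw [integral_finsetSum _ fun i _ => (hv i).const_mul _]
    simp only [integral_const_mul]

lemma lintegral_det_updateCol {d : ℕ} (B : Matrix (Fin d) (Fin d) ℝ) (j : Fin d) {S : Set ℝ}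
    (hS : MeasurableSet S) (v : Fin d → ℝ → ℝ) (hv : ∀ i, IntegrableOn (v i) S)
    (hpos : ∀ t ∈ S, 0 ≤ (B.updateCol j fun i => v i t).det) :
    ∫⁻ t in S, ENNReal.ofReal (B.updateCol j fun i => v i t).det =
      ENNReal.ofReal (B.updateCol j fun i => ∫ t in S, v i t).det := by
  have := integral_det_updateCol B j S v hv
  rw [← this.2, ofReal_integral_eq_lintegral_ofReal this.1]
  filter_upwards [ae_restrict_mem hS] with t ht using hpos t ht

/-- Integration of a determinant whose `i`-th row depends on the `i`-th variable only. -/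
lemma integral_det_pi {d : ℕ} (μ : Fin d → Measure ℝ) [∀ i, SigmaFinite (μ i)]
    (A : Fin d → ℝ → Fin d → ℝ) (hA : ∀ i j, Integrable (fun y => A i y j) (μ i)) :
    Integrable (fun y : Fin d → ℝ => (Matrix.of fun i j => A i (y i) j).det) (Measure.pi μ) ∧
    ∫ y, (Matrix.of fun i j => A i (y i) j).det ∂(Measure.pi μ) =
      (Matrix.of fun i j => ∫ y, A i y j ∂(μ i)).det := by
  have h1 : ∀ B : Fin d → Fin d → ℝ, (Matrix.of B).det =
      ∑ σ : Equiv.Perm (Fin d), ((Equiv.Perm.sign σ : ℤ) : ℝ) * ∏ i, B i (σ i) := by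
    intro B
    rw [← Matrix.det_transpose, Matrix.det_apply']
    rfl
  simp only [h1]
  have h2 : ∀ σ : Equiv.Perm (Fin d),
      Integrable (fun y : Fin d → ℝ => ∏ i, A i (y i) (σ i)) (Measure.pi μ) := fun σ =>
    Integrable.fintype_prod (f := fun i y => A i y (σ i)) fun i => hA i (σ i)
  constructor
  · exact integrable_finsetSum _ fun σ _ => (h2 σ).const_mul _
  · rw [integral_finsetSum _ fun σ _ => (h2 σ).const_mul _]
    refine Finset.sum_congr rfl fun σ _ => ?_
    rw [integral_const_mul, integral_fintype_prod_eq_prod (fun i y => A i y (σ i))]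

/-! ### The determinant of the interlacing walk -/

/-- The determinant `det (q_n (z_j - x_i))` with `q_n = truncPow n`. -/
noncomputable def detRho {d : ℕ} (n : ℕ) (x z : Fin d → ℝ) : ℝ :=
  (Matrix.of fun i j : Fin d => truncPow n (z j - x i)).det

@[fun_prop] lemma measurable_det {α : Type*} [MeasurableSpace α] {d : ℕ}
    {A : α → Fin d → Fin d → ℝ} (hA : ∀ i j, Measurable fun a => A a i j) :
    Measurable fun a => (Matrix.of (A a)).det := by
  simp only [Matrix.det_apply', Matrix.of_apply]
  fun_prop

lemma measurable_detRho {d : ℕ} (n : ℕ) (x : Fin d → ℝ) : Measurable (detRho n x) :=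
  measurable_det fun i j => by fun_prop

/-- For order `1` the entries are indicators of `x_i ≤ z_j`, and the determinant is the indicator of
interlacing, up to the boundary cases `z_j = x_{j+1}`, which form a null set. -/
lemma detRho_one {d : ℕ} {x z : Fin d → ℝ} (hx : StrictMono x) (hz : Monotone z) :
    detRho 1 x z =
      if (∀ j, x j ≤ z j) ∧ ∀ j k : Fin d, (k : ℕ) = (j : ℕ) + 1 → z j < x k then 1 else 0 := by
  have hq : ∀ i j, truncPow 1 (z j - x i) = if x i ≤ z j then 1 else 0 := by
    intro i j
    rw [truncPow_succ]; simp
  unfold detRho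
  simp only [hq]
  split_ifs with hc
  · rw [Matrix.det_of_isUpperTriangular]
    · exact Finset.prod_eq_one fun j _ => by simp [hc.1 j]
    · intro i j hij
      have hij : j < i := hij
      have hj : (j : ℕ) + 1 < d := lt_of_le_of_lt (Nat.succ_le_of_lt hij) i.2
      have h1 := hc.2 j ⟨j + 1, hj⟩ rfl
      have h2 : x ⟨j + 1, hj⟩ ≤ x i := hx.monotone (Nat.succ_le_of_lt hij)
      simp [not_le.2 (h1.trans_le h2)]
  · by_cases h1 : ∀ j, x j ≤ z j
    · have h2 : ∃ m : ℕ, ∃ j k : Fin d, (j : ℕ) = m ∧ (k : ℕ) = m + 1 ∧ x k ≤ z j := by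
        by_contra! hcon
        exact hc ⟨h1, fun j k hk => hcon j j k rfl hk⟩
      -- The first failure of `z j < x (j + 1)` produces two equal rows.
      obtain ⟨j, k, hj, hk, hjk⟩ := Nat.find_spec h2
      have hmin := fun m (hm : m < Nat.find h2) => Nat.find_min h2 hm
      refine Matrix.det_zero_of_row_eq (i := j) (j := k) (by intro h; omega) ?_
      funext c
      simp only [Matrix.of_apply]
      have hjk' : j < k := by rw [Fin.lt_def]; omega
      rcases lt_or_ge c j with hcj | hcj
      · have hlt : z c < x j := by
          by_contra! hge
          have hcd : (c : ℕ) + 1 < d := lt_of_le_of_lt (Nat.succ_le_of_lt hcj) j.2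
          have : x ⟨c + 1, hcd⟩ ≤ x j := hx.monotone (Nat.succ_le_of_lt hcj)
          exact hmin c (by rw [← hj]; exact hcj) ⟨c, ⟨c + 1, hcd⟩, rfl, rfl, this.trans hge⟩
        simp [not_le.2 hlt, not_le.2 (hlt.trans (hx hjk'))]
      · have := hjk.trans (hz hcj)
        simp [this, (hx hjk').le.trans this]
    · push Not at h1
      obtain ⟨j, hj⟩ := h1
      refine det_eq_zero_of_block _ j fun c hcj r hjr => ?_
      simp [not_le.2 ((hz hcj).trans_lt (hj.trans_le (hx.monotone hjr)))]

/-- The set of `w j` allowed by `Interlace w z`, for `z` in the chamber. -/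
def interlaceBox {D : ℕ} (z : Fin (D + 1) → ℝ) : Fin (D + 1) → Set ℝ :=
  Fin.cases (Set.Iic (z 0)) fun j => Set.Icc (z j.castSucc) (z j.succ)

lemma interlace_iff_mem_pi {D : ℕ} (w z : Fin (D + 1) → ℝ) :
    Interlace w z ↔ w ∈ Set.univ.pi (interlaceBox z) := by
  simp only [Interlace, Set.mem_univ_pi, interlaceBox]
  constructor
  · rintro ⟨h1, h2⟩ j
    refine Fin.cases ?_ (fun j => ?_) j
    · exact h1 0
    · exact ⟨h2 _ _ (by simp), h1 _⟩
  · intro h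
    refine ⟨fun j => ?_, fun j k hjk => ?_⟩
    · have := h j
      revert this
      refine Fin.cases ?_ (fun j => ?_) j
      · exact fun h => h
      · exact fun h => h.2
    · obtain ⟨k', rfl⟩ := Fin.exists_succ_eq.2 (show k ≠ 0 by rintro rfl; simp at hjk)
      have : j = k'.castSucc := by ext; simp at hjk ⊢; omega
      subst this
      exact (h k'.succ).1

/-- One step of the interlacing walk, without the exponential factor: integrating each row of the
transposed determinant over its interval raises the order, up to column operations. -/
lemma detRho_succ_eq_integral {D : ℕ} {n : ℕ} (hn : 1 ≤ n) (x : Fin (D + 1) → ℝ)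
    {z : Fin (D + 1) → ℝ} (hz : Monotone z) :
    IntegrableOn (detRho n x) {w | Interlace w z} ∧
    ∫ w in {w | Interlace w z}, detRho n x w = detRho (n + 1) x z := by
  have hset : {w | Interlace w z} = Set.univ.pi (interlaceBox z) :=
    Set.ext fun w => interlace_iff_mem_pi w z
  have hint : ∀ j i : Fin (D + 1), Integrable (fun t => truncPow n (t - x i))
      ((volume : Measure ℝ).restrict (interlaceBox z j)) := by
    intro j i
    refine Fin.cases ?_ (fun j => ?_) j
    · exact integrableOn_Iic_truncPow n (x i) (z 0)
    · change IntegrableOn (fun t => truncPow n (t - x i)) (Set.Icc _ _)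
      rw [integrableOn_Icc_iff_integrableOn_Ioc]
      exact integrableOn_Ioc_truncPow n (x i) _ _
  have key := integral_det_pi (fun j => (volume : Measure ℝ).restrict (interlaceBox z j))
    (fun j t i => truncPow n (t - x i)) hint
  rw [← Measure.restrict_pi_pi, ← volume_pi] at key
  have hT : ∀ w, detRho n x w = (Matrix.of fun j i => truncPow n (w j - x i)).det := by
    intro w
    rw [detRho, ← Matrix.det_transpose]; rfl
  simp only [hset, IntegrableOn, funext hT]
  refine ⟨key.1, key.2.trans ?_⟩
  -- The differences of consecutive columns are undone by column operations.
  symm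
  rw [detRho, ← Matrix.det_transpose (Matrix.of fun i j => ∫ _ in _, _)]
  refine Matrix.det_eq_of_forall_col_eq_smul_add_pred (fun _ => 1) (fun i => ?_) fun i j => ?_
  · exact (integral_Iic_truncPow hn (x i) (z 0)).symm
  · simp only [Matrix.transpose_apply, Matrix.of_apply, one_mul]
    have : ∫ t in Set.Icc (z j.castSucc) (z j.succ), truncPow n (t - x i) =
        truncPow (n + 1) (z j.succ - x i) - truncPow (n + 1) (z j.castSucc - x i) := by
      rw [integral_Icc_eq_integral_Ioc,
        integral_Ioc_truncPow hn _ (hz (Fin.castSucc_lt_succ).le)]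
    simp only [interlaceBox, Fin.cases_succ]
    rw [this]; ring

lemma Interlace.monotone_left {D : ℕ} {w z : Fin (D + 1) → ℝ} (hw : Interlace w z) :
    Monotone w :=
  Fin.monotone_iff_le_succ.2 fun j => (hw.1 _).trans (hw.2 _ _ (by simp))

lemma Interlace.monotone_right {D : ℕ} {w z : Fin (D + 1) → ℝ} (hw : Interlace w z) :
    Monotone z :=
  Fin.monotone_iff_le_succ.2 fun j => (hw.2 _ _ (by simp)).trans (hw.1 _)

lemma measurableSet_interlace_left {d : ℕ} (z : Fin d → ℝ) :
    MeasurableSet {w | Interlace w z} := by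
  simp only [Interlace, Set.ofPred_and, Set.ofPred_forall]
  refine MeasurableSet.inter (MeasurableSet.iInter fun j => ?_)
    (MeasurableSet.iInter fun j => MeasurableSet.iInter fun k => MeasurableSet.iInter fun _ => ?_)
  · exact measurableSet_le (by fun_prop) (by fun_prop)
  · exact measurableSet_le (by fun_prop) (by fun_prop)

lemma detRho_nonneg {D : ℕ} {n : ℕ} (hn : 1 ≤ n) {x : Fin (D + 1) → ℝ} (hx : StrictMono x)
    {z : Fin (D + 1) → ℝ} (hz : Monotone z) : 0 ≤ detRho n x z := by
  induction n, hn using Nat.le_induction generalizing z with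
  | base => rw [detRho_one hx hz]; split_ifs <;> norm_num
  | succ n hn ih =>
    rw [← (detRho_succ_eq_integral hn x hz).2]
    exact setIntegral_nonneg (measurableSet_interlace_left z) fun w hw => ih hw.monotone_left

lemma lintegral_detRho {D : ℕ} {n : ℕ} (hn : 1 ≤ n) {x : Fin (D + 1) → ℝ} (hx : StrictMono x)
    {z : Fin (D + 1) → ℝ} (hz : Monotone z) :
    ∫⁻ w in {w | Interlace w z}, ENNReal.ofReal (detRho n x w) =
      ENNReal.ofReal (detRho (n + 1) x z) := by
  have h1 := detRho_succ_eq_integral hn x hz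
  rw [← h1.2, ofReal_integral_eq_lintegral_ofReal h1.1]
  filter_upwards [ae_restrict_mem (measurableSet_interlace_left z)] with w hw
  exact detRho_nonneg hn hx hw.monotone_left

/-! ### The determinant of the walk in the chamber -/

/-- The determinant `det (q_{n+i-j} (z_j - x_i))` with `q_k = truncPow k`. The natural-number
subtraction is harmless, since `truncPow 0 = 0` and the entries of negative order vanish too. -/
noncomputable def detTau {d : ℕ} (n : ℕ) (x z : Fin d → ℝ) : ℝ :=
  (Matrix.of fun i j : Fin d => truncPow (n + i - j) (z j - x i)).det

lemma measurable_detTau {d : ℕ} (n : ℕ) (x : Fin d → ℝ) : Measurable (detTau n x) :=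
  measurable_det fun i j => by fun_prop

lemma detTau_one {d : ℕ} (x z : Fin d → ℝ) :
    detTau 1 x z = if ∀ j, x j ≤ z j then 1 else 0 := by
  unfold detTau
  rw [Matrix.det_of_isLowerTriangular]
  · split_ifs with hc
    · refine Finset.prod_eq_one fun j _ => ?_
      simp [truncPow_succ, hc j]
    · push Not at hc
      obtain ⟨j, hj⟩ := hc
      exact Finset.prod_eq_zero (Finset.mem_univ j) (truncPow_of_neg _ (by linarith))
  · intro i j hij
    have hij : i < j := hij
    have : 1 + (i : ℕ) - j = 0 := by have := Fin.lt_def.1 hij; omega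
    simp [this]

/-- The matrix interpolating between `detTau n x w` and `detTau (n + 1) x z`: its first `m`
columns belong to the former, the others to the latter. -/
noncomputable def mixMatrix {d : ℕ} (n : ℕ) (x z : Fin d → ℝ) (m : ℕ) (w : Fin d → ℝ) :
    Matrix (Fin d) (Fin d) ℝ :=
  Matrix.of fun i c : Fin d =>
    if (c : ℕ) < m then truncPow (n + i - c) (w c - x i) else truncPow (n + 1 + i - c) (z c - x i)

/-- The range of `w j`, given the coordinates of `w` below `j`. -/
def chainInterval {d : ℕ} (z w : Fin d → ℝ) (j : Fin d) : Set ℝ :=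
  {t | t ≤ z j ∧ ∀ c : Fin d, c < j → w c < t}

/-- The first `m` coordinates of `w` are strictly increasing and bounded by those of `z`. -/
def chainSet {d : ℕ} (z : Fin d → ℝ) (m : ℕ) : Set (Fin d → ℝ) :=
  {w | ∀ c : Fin d, (c : ℕ) < m → w c ≤ z c ∧ ∀ c' : Fin d, c' < c → w c' < w c}

lemma chainSet_succ_update {d : ℕ} (z w : Fin d → ℝ) (j : Fin d) (t : ℝ) :
    Function.update w j t ∈ chainSet z (j + 1) ↔ w ∈ chainSet z j ∧ t ∈ chainInterval z w j := by
  simp only [chainSet, chainInterval, Set.mem_ofPred_eq]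
  constructor
  · intro h
    refine ⟨fun c hc => ?_, ?_⟩
    · have h1 := h c (by omega)
      have hcj : c ≠ j := by rintro rfl; omega
      rw [Function.update_of_ne hcj] at h1
      refine ⟨h1.1, fun c' hc' => ?_⟩
      have := h1.2 c' hc'
      rwa [Function.update_of_ne (by rintro rfl; have := Fin.lt_def.1 hc'; omega)] at this
    · have h1 := h j (by omega)
      rw [Function.update_self] at h1
      refine ⟨h1.1, fun c hc => ?_⟩
      have := h1.2 c hc
      rwa [Function.update_of_ne hc.ne] at this
  · rintro ⟨h1, h2⟩ c hc
    rcases eq_or_ne c j with rfl | hcj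
    · rw [Function.update_self]
      refine ⟨h2.1, fun c' hc' => ?_⟩
      rw [Function.update_of_ne hc'.ne]
      exact h2.2 c' hc'
    · have hcj' : (c : ℕ) < j := by
        have : (c : ℕ) ≠ j := fun h => hcj (Fin.ext h)
        omega
      rw [Function.update_of_ne hcj]
      refine ⟨(h1 c hcj').1, fun c' hc' => ?_⟩
      rw [Function.update_of_ne (by rintro rfl; have := Fin.lt_def.1 hc'; omega)]
      exact (h1 c hcj').2 c' hc'

lemma chainInterval_eq_Iic {d : ℕ} (z w : Fin d → ℝ) {j : Fin d} (hj : (j : ℕ) = 0) :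
    chainInterval z w j = Set.Iic (z j) := by
  ext t
  simp only [chainInterval, Set.mem_ofPred_eq, Set.mem_Iic, and_iff_left_iff_imp]
  intro _ c hc
  have := Fin.lt_def.1 hc
  omega

lemma chainInterval_eq_Ioc {d : ℕ} {z w : Fin d → ℝ} {j k : Fin d} (hk : (j : ℕ) = k + 1)
    (hw : w ∈ chainSet z j) : chainInterval z w j = Set.Ioc (w k) (z j) := by
  ext t
  simp only [chainInterval, Set.mem_ofPred_eq, Set.mem_Ioc]
  constructor
  · rintro ⟨h1, h2⟩
    exact ⟨h2 k (by rw [Fin.lt_def]; omega), h1⟩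
  · rintro ⟨h1, h2⟩
    refine ⟨h2, fun c hc => lt_of_le_of_lt ?_ h1⟩
    have hc := Fin.lt_def.1 hc
    rcases lt_or_ge c k with hck | hck
    · exact ((hw k (by omega)).2 c hck).le
    · have : c = k := le_antisymm (by rw [Fin.le_def]; omega) hck
      rw [this]

lemma measurableSet_chainInterval {d : ℕ} (z w : Fin d → ℝ) (j : Fin d) :
    MeasurableSet (chainInterval z w j) := by
  simp only [chainInterval, Set.ofPred_and, Set.ofPred_forall]
  exact measurableSet_Iic.inter
    (MeasurableSet.iInter fun c => MeasurableSet.iInter fun _ => measurableSet_Ioi)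

lemma mixMatrix_succ_update {d : ℕ} (n : ℕ) (x z w : Fin d → ℝ) (j : Fin d) (t : ℝ) :
    mixMatrix n x z (j + 1) (Function.update w j t) =
      (mixMatrix n x z j w).updateCol j fun i => truncPow (n + i - j) (t - x i) := by
  ext i c
  simp only [mixMatrix, Matrix.of_apply, Matrix.updateCol_apply]
  rcases eq_or_ne c j with rfl | hcj
  · simp
  · rw [if_neg hcj, Function.update_of_ne hcj]
    have : (c : ℕ) ≠ j := fun h => hcj (Fin.ext h)
    simp only [show (c : ℕ) < j + 1 ↔ (c : ℕ) < j by omega]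

lemma integrableOn_chainInterval {d : ℕ} (k : ℕ) (a : ℝ) (z w : Fin d → ℝ) (j : Fin d) :
    IntegrableOn (fun t => truncPow k (t - a)) (chainInterval z w j) :=
  (integrableOn_Iic_truncPow k a (z j)).mono_set fun _ ht => ht.1

/-- Integrating out the `j`-th coordinate raises the order of the `j`-th column. The boundary term
at the lower end `w_{j-1}` equals the preceding column, and where the `j`-th column has order `0`
the missing jump of `truncPow 1` only concerns rows in which all earlier columns vanish. -/
lemma det_updateCol_integral_chainInterval {d n : ℕ} (hn : 1 ≤ n) {x z w : Fin d → ℝ}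
    (hx : StrictMono x) (hz : StrictMono z) (j : Fin d) (hw : w ∈ chainSet z j) :
    ((mixMatrix n x z j w).updateCol j fun i =>
      ∫ t in chainInterval z w j, truncPow (n + i - j) (t - x i)).det =
      (mixMatrix n x z j w).det := by
  set B := mixMatrix n x z j w with hB
  rcases Nat.eq_zero_or_pos (j : ℕ) with hj | hj
  · congr 1
    rw [chainInterval_eq_Iic z w hj]
    ext i c
    rw [Matrix.updateCol_apply]
    split_ifs with hc
    · subst hc
      rw [integral_Iic_truncPow (by omega)]
      simp only [hB, mixMatrix, Matrix.of_apply, lt_irrefl, if_false]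
      congr 1; omega
    · rfl
  · obtain ⟨k, hk⟩ : ∃ k : Fin d, (j : ℕ) = k + 1 := ⟨⟨j - 1, by omega⟩, by simp; omega⟩
    have hkj : k < j := by rw [Fin.lt_def]; omega
    have hab : w k < z j := ((hw k (by omega)).1).trans_lt (hz hkj)
    rw [chainInterval_eq_Ioc hk hw]
    set jump : Fin d → ℝ := fun i =>
      if n + i = j then truncPow 1 (z j - x i) - truncPow 1 (w k - x i) else 0 with hjump
    have hcol : ∀ i : Fin d, ∫ t in Set.Ioc (w k) (z j), truncPow (n + i - j) (t - x i) =
        B i j - B i k - jump i := by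
      intro i
      have h1 : B i j = truncPow (n + 1 + i - j) (z j - x i) := by simp [hB, mixMatrix]
      have h2 : B i k = truncPow (n + 1 + i - j) (w k - x i) := by
        simp only [hB, mixMatrix, Matrix.of_apply, if_pos (Fin.lt_def.1 hkj)]
        congr 1; omega
      rw [h1, h2]
      simp only [hjump]
      rcases lt_trichotomy (n + i : ℕ) j with h | h | h
      · rw [if_neg (by omega), show n + (i : ℕ) - j = 0 by omega,
          show n + 1 + (i : ℕ) - j = 0 by omega]
        simp
      · rw [if_pos h, show n + (i : ℕ) - j = 0 by omega, show n + 1 + (i : ℕ) - j = 1 by omega]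
        simp
      · rw [if_neg (by omega), integral_Ioc_truncPow (by omega) _ hab.le,
          show n + (i : ℕ) - j + 1 = n + 1 + i - j by omega]
        simp
    simp only [hcol]
    have hlin : (B.updateCol j fun i => B i j - B i k - jump i).det =
        (B.updateCol j fun i => B i j).det - (B.updateCol j fun i => B i k).det -
          (B.updateCol j jump).det := by
      simp only [det_updateCol_eq_sum, mul_sub, Finset.sum_sub_distrib]
    have hself : (B.updateCol j fun i => B i j) = B := Matrix.updateCol_eq_self B j
    have hnbr : (B.updateCol j fun i => B i k).det = 0 := by
      refine Matrix.det_zero_of_column_eq hkj.ne fun i => ?_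
      rw [Matrix.updateCol_self, Matrix.updateCol_ne hkj.ne]
    have hjmp : (B.updateCol j jump).det = 0 := by
      by_cases hex : ∃ i, jump i ≠ 0
      · obtain ⟨i, hi⟩ := hex
        have hij : n + (i : ℕ) = j := by
          by_contra h
          exact hi (by simp [hjump, h])
        have hwi : w k < x i := by
          by_contra! hge
          refine hi ?_
          have hge' : x i ≤ z j := hge.trans hab.le
          simp [hjump, hij, truncPow_succ, hge, hge']
        refine det_eq_zero_of_block _ j fun c hc r hr => ?_
        have hc' := Fin.le_def.1 hc
        have hr' := Fin.le_def.1 hr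
        rw [Matrix.updateCol_apply]
        split_ifs with hcj
        · simp only [hjump]
          rw [if_neg (by omega)]
        · have hcj' : (c : ℕ) < j := by
            have : (c : ℕ) ≠ j := fun h => hcj (Fin.ext h)
            omega
          have hwc : w c ≤ w k := by
            rcases eq_or_ne c k with rfl | hck
            · exact le_rfl
            · have : (c : ℕ) ≠ k := fun h => hck (Fin.ext h)
              exact ((hw k (by omega)).2 c (by rw [Fin.lt_def]; omega)).le
          have hxr : x i < x r := hx (by rw [Fin.lt_def]; omega)
          simp only [hB, mixMatrix, Matrix.of_apply, if_pos hcj']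
          exact truncPow_of_neg _ (by linarith)
      · push Not at hex
        refine Matrix.det_eq_zero_of_column_eq_zero j fun i => ?_
        rw [Matrix.updateCol_self, hex]
    rw [hlin, hself, hnbr, hjmp]
    ring

lemma mixMatrix_top {d : ℕ} (n : ℕ) (x z w : Fin d → ℝ) :
    (mixMatrix n x z d w).det = detTau n x w := by
  simp [mixMatrix, detTau]

lemma mixMatrix_zero {d : ℕ} (n : ℕ) (x z w : Fin d → ℝ) :
    (mixMatrix n x z 0 w).det = detTau (n + 1) x z := by
  simp [mixMatrix, detTau]

lemma mixMatrix_det_nonneg {d n : ℕ} (hn : 1 ≤ n) {x z : Fin d → ℝ}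
    (hx : StrictMono x) (hz : StrictMono z) (hpos : ∀ w, StrictMono w → 0 ≤ detTau n x w)
    {m : ℕ} (hm : m ≤ d) {w : Fin d → ℝ} (hw : w ∈ chainSet z m) :
    0 ≤ (mixMatrix n x z m w).det := by
  induction hm using Nat.decreasingInduction generalizing w with
  | self =>
    rw [mixMatrix_top]
    exact hpos w fun c c' hc => (hw c' c'.2).2 c hc
  | of_succ m hm ih =>
    have h1 := det_updateCol_integral_chainInterval hn hx hz ⟨m, hm⟩ hw
    have h2 := integral_det_updateCol (mixMatrix n x z m w) ⟨m, hm⟩ (chainInterval z w ⟨m, hm⟩)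
      (fun i t => truncPow (n + i - m) (t - x i)) fun i => integrableOn_chainInterval _ _ _ _ _
    rw [← h1, ← h2.2]
    refine setIntegral_nonneg (measurableSet_chainInterval _ _ _) fun t ht => ?_
    have h3 := mixMatrix_succ_update n x z w ⟨m, hm⟩ t
    simp only at h3
    rw [← h3]
    exact ih ((chainSet_succ_update z w ⟨m, hm⟩ t).2 ⟨hw, ht⟩)

lemma detTau_nonneg {d n : ℕ} (hn : 1 ≤ n) {x : Fin d → ℝ} (hx : StrictMono x)
    {z : Fin d → ℝ} (hz : StrictMono z) : 0 ≤ detTau n x z := by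
  induction n, hn using Nat.le_induction generalizing z with
  | base => rw [detTau_one]; split_ifs <;> norm_num
  | succ n hn ih =>
    rw [← mixMatrix_zero n x z z]
    exact mixMatrix_det_nonneg hn hx hz (fun w hw => ih hw) (Nat.zero_le _)
      fun c hc => absurd hc (Nat.not_lt_zero _)

lemma measurableSet_chainSet {d : ℕ} (z : Fin d → ℝ) (m : ℕ) : MeasurableSet (chainSet z m) := by
  simp only [chainSet, Set.ofPred_and, Set.ofPred_forall]
  refine MeasurableSet.iInter fun c => MeasurableSet.iInter fun _ => MeasurableSet.inter
    (measurableSet_le (by fun_prop) (by fun_prop))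
    (MeasurableSet.iInter fun c' => MeasurableSet.iInter fun _ =>
      measurableSet_lt (by fun_prop) (by fun_prop))

/-- Integrating out all coordinates from the top one down turns `detTau n` into
`detTau (n + 1)`. -/
lemma lintegral_detTau {d n : ℕ} (hn : 1 ≤ n) {x z : Fin d → ℝ} (hx : StrictMono x)
    (hz : StrictMono z) :
    ∫⁻ w in {w | StrictMono w ∧ ∀ j, w j ≤ z j}, ENNReal.ofReal (detTau n x w) =
      ENNReal.ofReal (detTau (n + 1) x z) := by
  set F : ℕ → (Fin d → ℝ) → ENNReal := fun m =>
    (chainSet z m).indicator fun w => ENNReal.ofReal (mixMatrix n x z m w).det with hF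
  have hFmeas : ∀ m, Measurable (F m) := fun m =>
    (ENNReal.measurable_ofReal.comp (measurable_det fun i c => by
      split_ifs <;> fun_prop)).indicator (measurableSet_chainSet z m)
  have hpos : ∀ w, StrictMono w → 0 ≤ detTau n x w := fun w hw => detTau_nonneg hn hx hw
  have hstep : ∀ (j : Fin d) (w : Fin d → ℝ),
      ∫⁻ t, F (j + 1) (Function.update w j t) = F j w := by
    intro j w
    by_cases hw : w ∈ chainSet z j
    · have h1 : ∀ t, F (j + 1) (Function.update w j t) = (chainInterval z w j).indicator (fun t =>
          ENNReal.ofReal ((mixMatrix n x z j w).updateCol j fun i =>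
            truncPow (n + i - j) (t - x i)).det) t := by
        intro t
        by_cases ht : t ∈ chainInterval z w j
        · rw [Set.indicator_of_mem ht, ← mixMatrix_succ_update]
          exact Set.indicator_of_mem ((chainSet_succ_update z w j t).2 ⟨hw, ht⟩) _
        · rw [Set.indicator_of_notMem ht]
          exact Set.indicator_of_notMem (fun h => ht ((chainSet_succ_update z w j t).1 h).2) _
      simp only [h1]
      rw [lintegral_indicator (measurableSet_chainInterval _ _ _),
        lintegral_det_updateCol (mixMatrix n x z j w) j (measurableSet_chainInterval _ _ _)
          (fun i t => truncPow (n + i - j) (t - x i))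
          (fun i => integrableOn_chainInterval _ _ _ _ _),
        det_updateCol_integral_chainInterval hn hx hz j hw]
      · simp only [hF, Set.indicator_of_mem hw]
      · intro t ht
        rw [← mixMatrix_succ_update]
        exact mixMatrix_det_nonneg hn hx hz hpos j.2 ((chainSet_succ_update z w j t).2 ⟨hw, ht⟩)
    · have h1 : ∀ t, F (j + 1) (Function.update w j t) = 0 := fun t =>
        Set.indicator_of_notMem (fun h => hw ((chainSet_succ_update z w j t).1 h).1) _
      simp only [h1, lintegral_zero]
      exact (Set.indicator_of_notMem hw _).symm
  have hmarg : ∀ m, m ≤ d →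
      (∫⋯∫⁻_(Finset.univ.filter fun c : Fin d => m ≤ (c : ℕ)), F d ∂fun _ => volume) = F m := by
    intro m hm
    induction hm using Nat.decreasingInduction with
    | self =>
      rw [Finset.filter_false_of_mem fun c _ => by omega, lmarginal_empty]
    | of_succ m hm ih =>
      have hins : (Finset.univ.filter fun c : Fin d => m ≤ (c : ℕ)) =
          insert ⟨m, hm⟩ (Finset.univ.filter fun c : Fin d => m + 1 ≤ (c : ℕ)) := by
        ext c
        simp only [Finset.mem_filter, Finset.mem_univ, true_and, Finset.mem_insert, Fin.ext_iff]
        omega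
      funext w
      rw [hins, lmarginal_insert _ (hFmeas d) (by simp), ih]
      exact hstep ⟨m, hm⟩ w
  have htop : {w : Fin d → ℝ | StrictMono w ∧ ∀ j, w j ≤ z j} = chainSet z d := by
    ext w
    simp only [chainSet, Set.mem_ofPred_eq]
    exact ⟨fun h c _ => ⟨h.2 c, fun c' hc => h.1 hc⟩,
      fun h => ⟨fun c c' hc => (h c' c'.2).2 c hc, fun c => (h c c.2).1⟩⟩
  have hbot : z ∈ chainSet z 0 := fun c hc => absurd hc (Nat.not_lt_zero _)
  have h0 := congrFun (hmarg 0 (Nat.zero_le _)) z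
  rw [Finset.filter_true_of_mem fun c _ => Nat.zero_le _, lmarginal_univ, ← volume_pi] at h0
  simp only [hF, lintegral_indicator (measurableSet_chainSet z d), Set.indicator_of_mem hbot,
    mixMatrix_top, mixMatrix_zero] at h0
  rw [htop, h0]

/-! ### Gamma densities and the law of one step -/

/-- The density of the Gamma distribution of shape `k` and rate `1`, and zero for `k = 0`. -/
noncomputable def gammaDens (k : ℕ) (u : ℝ) : ℝ := Real.exp (-u) * truncPow k u

@[fun_prop] lemma measurable_gammaDens (k : ℕ) : Measurable (gammaDens k) := by
  unfold gammaDens; fun_prop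

lemma gammaDens_nonneg (k : ℕ) (u : ℝ) : 0 ≤ gammaDens k u :=
  mul_nonneg (Real.exp_pos _).le (truncPow_nonneg _ _)

lemma gammaDens_le_one (k : ℕ) (u : ℝ) : gammaDens k u ≤ 1 := by
  unfold gammaDens
  cases k with
  | zero => simp
  | succ k =>
    rw [truncPow_succ]
    split_ifs with hu
    · rw [Real.exp_neg, inv_mul_le_iff₀ (Real.exp_pos _), mul_one]
      exact Real.pow_div_factorial_le_exp u hu k
    · simp

lemma gammaPDFReal_eq_gammaDens {k : ℕ} (hk : 1 ≤ k) (u : ℝ) :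
    gammaPDFReal k 1 u = gammaDens k u := by
  obtain ⟨k, rfl⟩ := Nat.exists_eq_add_of_le' hk
  rw [gammaPDFReal, gammaDens, truncPow_succ]
  split_ifs with hu
  · rw [Nat.cast_succ, Real.Gamma_nat_eq_factorial, add_sub_cancel_right, Real.rpow_natCast,
      Real.one_rpow, one_mul]
    ring
  · simp

lemma gammaMeasure_eq_withDensity {k : ℕ} (hk : 1 ≤ k) :
    gammaMeasure k 1 = volume.withDensity fun u => ENNReal.ofReal (gammaDens k u) := by
  rw [gammaMeasure]
  congr 1
  funext u
  rw [gammaPDF, gammaPDFReal_eq_gammaDens hk]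

lemma expMeasure_eq_withDensity :
    expMeasure 1 = volume.withDensity fun u => ENNReal.ofReal (gammaDens 1 u) := by
  have := gammaMeasure_eq_withDensity le_rfl
  rwa [Nat.cast_one] at this

instance isProbabilityMeasure_expMeasure_one : IsProbabilityMeasure (expMeasure 1) :=
  isProbabilityMeasure_expMeasure one_pos

lemma lintegral_gammaDens {k : ℕ} (hk : 1 ≤ k) : ∫⁻ u, ENNReal.ofReal (gammaDens k u) = 1 := by
  have := lintegral_gammaPDF_eq_one (a := k) (r := 1) (by exact_mod_cast hk) one_pos
  rw [← this]
  refine lintegral_congr fun u => ?_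
  rw [gammaPDF, gammaPDFReal_eq_gammaDens hk]

lemma integrable_gammaDens (k : ℕ) : Integrable (gammaDens k) := by
  rcases Nat.eq_zero_or_pos k with rfl | hk
  · have : gammaDens 0 = fun _ => 0 := by funext u; simp [gammaDens]
    rw [this]; exact integrable_zero _ _ _
  · refine ⟨by fun_prop, ?_⟩
    rw [hasFiniteIntegral_iff_ofReal (ae_of_all _ (gammaDens_nonneg k)), lintegral_gammaDens hk]
    exact ENNReal.one_lt_top

lemma pi_withDensity_ofReal {d : ℕ} {g : ℝ → ℝ} (hg0 : ∀ u, 0 ≤ g u) (hg : Integrable g)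
    [SigmaFinite (volume.withDensity fun u => ENNReal.ofReal (g u))] :
    (Measure.pi fun _ : Fin d => volume.withDensity fun u => ENNReal.ofReal (g u)) =
      volume.withDensity fun x : Fin d → ℝ => ENNReal.ofReal (∏ j, g (x j)) := by
  refine Measure.pi_eq fun s hs => ?_
  rw [withDensity_apply _ (MeasurableSet.univ_pi hs), volume_pi, Measure.restrict_pi_pi,
    ← ofReal_integral_eq_lintegral_ofReal
      (Integrable.fintype_prod (f := fun _ => g) fun i => hg.integrableOn)
      (ae_of_all _ fun x => Finset.prod_nonneg fun j _ => hg0 _),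
    integral_fintype_prod_eq_prod (fun _ => g),
    ENNReal.ofReal_prod_of_nonneg fun i _ => integral_nonneg hg0]
  refine Finset.prod_congr rfl fun i _ => ?_
  rw [withDensity_apply _ (hs i), ofReal_integral_eq_lintegral_ofReal hg.integrableOn
    (ae_of_all _ hg0)]

/-- The law of one step. -/
lemma pi_expMeasure_eq_withDensity (d : ℕ) :
    (Measure.pi fun _ : Fin d => expMeasure 1) =
      volume.withDensity fun e : Fin d → ℝ => ENNReal.ofReal (∏ j, gammaDens 1 (e j)) := by
  have : SigmaFinite (volume.withDensity fun u => ENNReal.ofReal (gammaDens 1 u)) := by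
    rw [← expMeasure_eq_withDensity]; infer_instance
  rw [← pi_withDensity_ofReal (gammaDens_nonneg 1) (integrable_gammaDens 1)]
  simp only [expMeasure_eq_withDensity]

/-! ### Walks killed by a condition on their steps -/

/-- The event that each of the first `n` steps satisfies `C`. -/
def stepEvent {Ω : Type*} {d : ℕ} (C : (Fin d → ℝ) → (Fin d → ℝ) → Prop)
    (X : ℕ → Fin d → Ω → ℝ) (x : Fin d → ℝ) (n : ℕ) : Set Ω :=
  {ω | ∀ m < n, C (walk X x m ω) (walk X x (m + 1) ω)}

/-- The density of a step from `w` to `z`, restricted to the steps satisfying `C`. -/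
noncomputable def stepDens {d : ℕ} (C : (Fin d → ℝ) → (Fin d → ℝ) → Prop) (w z : Fin d → ℝ) :
    ENNReal :=
  {p : (Fin d → ℝ) × (Fin d → ℝ) | C p.1 p.2}.indicator
    (fun p => ENNReal.ofReal (∏ j, gammaDens 1 (p.2 j - p.1 j))) (w, z)

section Markov

variable {d : ℕ} {C : (Fin d → ℝ) → (Fin d → ℝ) → Prop}

lemma measurable_stepDens (hC : MeasurableSet {p : (Fin d → ℝ) × (Fin d → ℝ) | C p.1 p.2}) :
    Measurable fun p : (Fin d → ℝ) × (Fin d → ℝ) => stepDens C p.1 p.2 :=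
  (ENNReal.measurable_ofReal.comp (by fun_prop)).indicator hC

lemma pi_expMeasure_step (hC : MeasurableSet {p : (Fin d → ℝ) × (Fin d → ℝ) | C p.1 p.2})
    (w : Fin d → ℝ) {A : Set (Fin d → ℝ)} (hA : MeasurableSet A) :
    (Measure.pi fun _ : Fin d => expMeasure 1) {e | w + e ∈ A ∧ C w (w + e)} =
      ∫⁻ z in A, stepDens C w z := by
  have hCw : MeasurableSet {z | C w z} := measurable_prodMk_left hC
  have hm : MeasurableSet {e | w + e ∈ A ∧ C w (w + e)} :=
    (measurable_const_add w) (hA.inter hCw)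
  rw [pi_expMeasure_eq_withDensity, withDensity_apply _ hm, ← lintegral_indicator hm,
    ← lintegral_indicator hA, ← lintegral_add_left_eq_self (A.indicator fun z => stepDens C w z) w]
  refine lintegral_congr fun e => ?_
  simp only [stepDens, Set.indicator, Set.mem_ofPred_eq, Pi.add_apply, add_sub_cancel_left]
  by_cases h1 : w + e ∈ A <;> by_cases h2 : C w (w + e) <;> simp [h1, h2]

variable {Ω : Type*} [MeasurableSpace Ω] {P : Measure Ω} [IsProbabilityMeasure P]
  {X : ℕ → Fin d → Ω → ℝ}

lemma measurable_walk (hmeas : ∀ i j, Measurable (X i j)) (x : Fin d → ℝ) (n : ℕ) :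
    Measurable (walk X x n) := by
  unfold walk; fun_prop

lemma measurableSet_stepEvent
    (hC : MeasurableSet {p : (Fin d → ℝ) × (Fin d → ℝ) | C p.1 p.2})
    (hmeas : ∀ i j, Measurable (X i j)) (x : Fin d → ℝ) (n : ℕ) :
    MeasurableSet (stepEvent C X x n) := by
  simp only [stepEvent, Set.ofPred_forall]
  exact MeasurableSet.iInter fun m => MeasurableSet.iInter fun _ =>
    ((measurable_walk hmeas x m).prodMk (measurable_walk hmeas x (m + 1))) hC

/-- The Markov property at time `n`. -/
lemma measure_walk_succ (hC : MeasurableSet {p : (Fin d → ℝ) × (Fin d → ℝ) | C p.1 p.2})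
    (hmeas : ∀ i j, Measurable (X i j)) (hexp : ∀ i j, P.map (X i j) = expMeasure 1)
    (hindep : iIndepFun (fun p : ℕ × Fin d => X p.1 p.2) P) (x : Fin d → ℝ) (n : ℕ)
    {A : Set (Fin d → ℝ)} (hA : MeasurableSet A) :
    (P.restrict (stepEvent C X x (n + 1))).map (walk X x (n + 1)) A =
      ∫⁻ w, (∫⁻ z in A, stepDens C w z) ∂((P.restrict (stepEvent C X x n)).map (walk X x n)) := by
  set ν := Measure.pi fun _ : Fin d => expMeasure 1 with hν
  set Z : Ω → Fin d → ℝ := fun ω j => X n j ω with hZ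
  -- The increments before time `n`, as a family indexed by all times.
  set Y : Ω → ℕ × Fin d → ℝ := fun ω p => if p.1 < n then X p.1 p.2 ω else 0 with hY
  set coord : ℕ → Fin d → (ℕ × Fin d → ℝ) → ℝ := fun i j y => y (i, j) with hcoord
  have hcm : ∀ i j, Measurable (coord i j) := fun i j => measurable_pi_apply _
  have hwalk : ∀ m ≤ n, ∀ ω, walk coord x m (Y ω) = walk X x m ω := by
    intro m hm ω
    funext j
    simp only [walk, hcoord, hY]
    congr 1
    refine Finset.sum_congr rfl fun i hi => if_pos ?_
    have := Finset.mem_range.1 hi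
    omega
  have hsucc : ∀ ω, walk X x (n + 1) ω = walk X x n ω + Z ω := by
    intro ω
    funext j
    simp [walk, hZ, Finset.sum_range_succ, add_assoc]
  have hYm : Measurable Y := by
    refine measurable_pi_lambda _ fun p => ?_
    by_cases h : p.1 < n
    · simp only [hY, h, if_true]; exact hmeas _ _
    · simp only [hY, h, if_false]; exact measurable_const
  have hZm : Measurable Z := measurable_pi_lambda _ fun j => hmeas n j
  have hYZ : IndepFun Y Z P := by
    have h1 := hindep.indepFun_finset (Finset.range n ×ˢ Finset.univ) ({n} ×ˢ Finset.univ)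
      (by
        rw [Finset.disjoint_left]
        rintro ⟨i, j⟩ h1 h2
        simp at h1 h2
        omega) fun p => hmeas p.1 p.2
    have hφ : Measurable fun (y : (Finset.range n ×ˢ (Finset.univ : Finset (Fin d)) :) → ℝ)
        (p : ℕ × Fin d) => if h : p ∈ Finset.range n ×ˢ (Finset.univ : Finset (Fin d)) then
          y ⟨p, h⟩ else 0 := by
      refine measurable_pi_lambda _ fun p => ?_
      by_cases h : p ∈ Finset.range n ×ˢ (Finset.univ : Finset (Fin d))
      · simp only [h, dif_pos]; exact measurable_pi_apply _
      · simp only [h, dif_neg, not_false_eq_true]; exact measurable_const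
    have hψ : Measurable fun (y : (({n} : Finset ℕ) ×ˢ (Finset.univ : Finset (Fin d)) :) → ℝ)
        (j : Fin d) => y ⟨(n, j), by simp⟩ :=
      measurable_pi_lambda _ fun j => measurable_pi_apply _
    have h2 := h1.comp hφ hψ
    convert h2 using 1
    · funext ω p
      by_cases h : p.1 < n <;> simp [hY, h]
    · rfl
  have hZlaw : P.map Z = ν := by
    have h1 : iIndepFun (fun j : Fin d => X n j) P :=
      hindep.precomp (g := fun j : Fin d => (n, j)) fun a b h => (Prod.mk.inj h).2
    rw [hZ, h1.map_fun_eq_pi_map fun j => (hmeas n j).aemeasurable]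
    simp only [hexp, hν]
  set B : Set ((ℕ × Fin d → ℝ) × (Fin d → ℝ)) :=
    {p | p.1 ∈ stepEvent C coord x n ∧
      (walk coord x n p.1, walk coord x n p.1 + p.2) ∈
        {q : (Fin d → ℝ) × (Fin d → ℝ) | q.2 ∈ A ∧ C q.1 q.2}} with hB
  have hAC : MeasurableSet {q : (Fin d → ℝ) × (Fin d → ℝ) | q.2 ∈ A ∧ C q.1 q.2} :=
    (measurable_snd hA).inter hC
  have hwm := measurable_walk hcm x n
  have hBm : MeasurableSet B := by
    refine MeasurableSet.inter (measurable_fst (measurableSet_stepEvent hC hcm x n)) ?_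
    exact ((hwm.comp measurable_fst).prodMk
      ((hwm.comp measurable_fst).add measurable_snd)) hAC
  have hev : ∀ ω, Y ω ∈ stepEvent C coord x n ↔ ω ∈ stepEvent C X x n := by
    intro ω
    simp only [stepEvent, Set.mem_ofPred_eq]
    refine forall_congr' fun m => forall_congr' fun hm => ?_
    rw [hwalk m hm.le, hwalk (m + 1) hm]
  have hpre : walk X x (n + 1) ⁻¹' A ∩ stepEvent C X x (n + 1) = (fun ω => (Y ω, Z ω)) ⁻¹' B := by
    ext ω
    simp only [hB, Set.mem_inter_iff, Set.mem_preimage, Set.mem_ofPred_eq, hev,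
      hwalk n le_rfl, ← hsucc]
    simp only [stepEvent, Set.mem_ofPred_eq, Nat.lt_succ_iff_lt_or_eq, or_imp, forall_and,
      forall_eq]
    tauto
  have hK : Measurable fun w => ν {e | w + e ∈ A ∧ C w (w + e)} :=
    measurable_measure_prodMk_left (ν := ν)
      ((measurable_fst.prodMk (measurable_fst.add measurable_snd)) hAC)
  rw [Measure.map_apply (measurable_walk hmeas x _) hA,
    Measure.restrict_apply ((measurable_walk hmeas x _) hA), hpre,
    ← Measure.map_apply (hYm.prodMk hZm) hBm,
    (indepFun_iff_map_prod_eq_prod_map_map hYm.aemeasurable hZm.aemeasurable).1 hYZ, hZlaw,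
    Measure.prod_apply hBm, lintegral_map (measurable_measure_prodMk_left hBm) hYm]
  simp only [← pi_expMeasure_step hC _ hA, ← hν]
  rw [lintegral_map hK (measurable_walk hmeas x n),
    ← lintegral_indicator (measurableSet_stepEvent hC hmeas x n)]
  refine lintegral_congr fun ω => ?_
  by_cases hω : ω ∈ stepEvent C X x n
  · rw [Set.indicator_of_mem hω]
    congr 1
    ext e
    simp [hB, hev, hω, hwalk n le_rfl]
  · rw [Set.indicator_of_notMem hω]
    convert measure_empty (μ := ν)
    ext e
    simp [hB, hev, hω]

/-- The killed walk has a density after one step. -/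
lemma map_walk_one (hC : MeasurableSet {p : (Fin d → ℝ) × (Fin d → ℝ) | C p.1 p.2})
    (hmeas : ∀ i j, Measurable (X i j)) (hexp : ∀ i j, P.map (X i j) = expMeasure 1)
    (hindep : iIndepFun (fun p : ℕ × Fin d => X p.1 p.2) P) (x : Fin d → ℝ) :
    (P.restrict (stepEvent C X x 1)).map (walk X x 1) = volume.withDensity (stepDens C x) := by
  ext A hA
  rw [measure_walk_succ hC hmeas hexp hindep x 0 hA, withDensity_apply _ hA]
  have h0 : stepEvent C X x 0 = Set.univ := by simp [stepEvent]
  have h1 : walk X x 0 = fun _ => x := by funext ω j; simp [walk]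
  rw [h0, Measure.restrict_univ, h1, Measure.map_const, measure_univ, one_smul,
    lintegral_dirac' _ ?_]
  exact (measurable_stepDens hC).lintegral_prod_right'

/-- The density of the killed walk is propagated by integration against the step density. -/
lemma map_walk_succ (hC : MeasurableSet {p : (Fin d → ℝ) × (Fin d → ℝ) | C p.1 p.2})
    (hmeas : ∀ i j, Measurable (X i j)) (hexp : ∀ i j, P.map (X i j) = expMeasure 1)
    (hindep : iIndepFun (fun p : ℕ × Fin d => X p.1 p.2) P) (x : Fin d → ℝ) (n : ℕ)
    {D : (Fin d → ℝ) → ENNReal} (hD : Measurable D)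
    (hn : (P.restrict (stepEvent C X x n)).map (walk X x n) = volume.withDensity D) :
    (P.restrict (stepEvent C X x (n + 1))).map (walk X x (n + 1)) =
      volume.withDensity fun z => ∫⁻ w, D w * stepDens C w z := by
  ext A hA
  have hm := measurable_stepDens hC
  have hm2 : Measurable fun w => ∫⁻ z in A, stepDens C w z := hm.lintegral_prod_right'
  rw [measure_walk_succ hC hmeas hexp hindep x n hA, hn, withDensity_apply _ hA,
    lintegral_withDensity_eq_lintegral_mul _ hD hm2]
  have h1 : ∀ w, (D * fun w => ∫⁻ z in A, stepDens C w z) w =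
      ∫⁻ z in A, D w * stepDens C w z := by
    intro w
    have hmw : Measurable fun z => stepDens C w z := hm.comp measurable_prodMk_left
    rw [Pi.mul_apply, lintegral_const_mul _ hmw]
  simp only [h1]
  rw [lintegral_lintegral_swap]
  exact ((hD.comp measurable_fst).mul hm).aemeasurable

end Markov

/-! ### Transition densities of the two killed walks -/

lemma natCast_lt_iInf_iff (n : ℕ) (S : Set ℕ) :
    (n : ℕ∞) < ⨅ m ∈ S, (m : ℕ∞) ↔ ∀ m ∈ S, n < m := by
  constructor
  · intro h m hm
    exact_mod_cast h.trans_le (iInf₂_le m hm)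
  · intro h
    have h1 : ((n + 1 : ℕ) : ℕ∞) ≤ ⨅ m ∈ S, (m : ℕ∞) :=
      le_iInf₂ fun m hm => by exact_mod_cast h m hm
    exact lt_of_lt_of_le (by exact_mod_cast Nat.lt_succ_self n) h1

section

variable {Ω : Type*} {d : ℕ} (X : ℕ → Fin d → Ω → ℝ) (x : Fin d → ℝ) (n : ℕ) (ω : Ω)

lemma natCast_lt_rho_iff : (n : ℕ∞) < rho X x ω ↔ ω ∈ stepEvent Interlace X x n := by
  rw [rho, natCast_lt_iInf_iff]
  simp only [stepEvent, Set.mem_ofPred_eq]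
  constructor
  · intro h m hm
    by_contra hc
    exact absurd (h (m + 1) ⟨by omega, hc⟩) (by omega)
  · rintro h m ⟨hm1, hm2⟩
    by_contra! hmn
    refine hm2 ?_
    have := h (m - 1) (by omega)
    rwa [Nat.sub_add_cancel hm1] at this

lemma natCast_lt_tau_iff :
    (n : ℕ∞) < tau X x ω ↔ ω ∈ stepEvent (fun _ z => z ∈ weylChamber d) X x n := by
  rw [tau, natCast_lt_iInf_iff]
  simp only [stepEvent, Set.mem_ofPred_eq]
  constructor
  · intro h m hm
    by_contra hc
    exact absurd (h (m + 1) ⟨by omega, hc⟩) (by omega)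
  · rintro h m ⟨hm1, hm2⟩
    by_contra! hmn
    refine hm2 ?_
    have := h (m - 1) (by omega)
    rwa [Nat.sub_add_cancel hm1] at this

end

lemma isOpen_weylChamber (d : ℕ) : IsOpen (weylChamber d) := by
  simp only [weylChamber, StrictMono, Set.ofPred_forall]
  exact isOpen_iInter_of_finite fun i => isOpen_iInter_of_finite fun j =>
    isOpen_iInter_of_finite fun _ => isOpen_lt (by fun_prop) (by fun_prop)

lemma measurableSet_weylChamber (d : ℕ) : MeasurableSet (weylChamber d) :=
  (isOpen_weylChamber d).measurableSet

lemma measurableSet_monotone (d : ℕ) : MeasurableSet {z : Fin d → ℝ | Monotone z} := by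
  simp only [Monotone, Set.ofPred_forall]
  exact MeasurableSet.iInter fun i => MeasurableSet.iInter fun j =>
    MeasurableSet.iInter fun _ => measurableSet_le (by fun_prop) (by fun_prop)

lemma gammaDens_one_of_nonneg {u : ℝ} (hu : 0 ≤ u) : gammaDens 1 u = Real.exp (-u) := by
  simp [gammaDens, truncPow_succ, hu]

lemma gammaDens_of_neg (k : ℕ) {u : ℝ} (hu : u < 0) : gammaDens k u = 0 := by
  simp [gammaDens, truncPow_of_neg k hu]

lemma prod_gammaDens_one_of_le {d : ℕ} {w z : Fin d → ℝ} (h : ∀ j, w j ≤ z j) :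
    ∏ j, gammaDens 1 (z j - w j) = Real.exp (-∑ j, (z j - w j)) := by
  rw [← Finset.sum_neg_distrib, Real.exp_sum]
  exact Finset.prod_congr rfl fun j _ => gammaDens_one_of_nonneg (sub_nonneg.2 (h j))

lemma prod_gammaDens_one_of_not_le {d : ℕ} {w z : Fin d → ℝ} (h : ¬ ∀ j, w j ≤ z j) :
    ∏ j, gammaDens 1 (z j - w j) = 0 := by
  push Not at h
  obtain ⟨j, hj⟩ := h
  exact Finset.prod_eq_zero (Finset.mem_univ j) (gammaDens_of_neg 1 (by linarith))

lemma exp_mul_exp_increments {d : ℕ} (x w z : Fin d → ℝ) :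
    Real.exp (-∑ j, (w j - x j)) * Real.exp (-∑ j, (z j - w j)) =
      Real.exp (-∑ j, (z j - x j)) := by
  rw [← Real.exp_add]
  congr 1
  simp only [Finset.sum_sub_distrib]
  ring

/-- The transition density `det (p_n (z_j - x_i))` of the walk killed when interlacing fails, with
the exponential factors of the Gamma densities `p_n` taken out of the determinant. -/
noncomputable def densRho {d : ℕ} (n : ℕ) (x z : Fin d → ℝ) : ℝ :=
  Real.exp (-∑ j, (z j - x j)) * detRho n x z

/-- The transition density `det (p_{n+i-j} (z_j - x_i))` of the walk killed when it leaves the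
chamber, with the exponential factors of the Gamma densities taken out of the determinant. -/
noncomputable def densTau {d : ℕ} (n : ℕ) (x z : Fin d → ℝ) : ℝ :=
  Real.exp (-∑ j, (z j - x j)) * detTau n x z

lemma measurable_densRho {d : ℕ} (n : ℕ) (x : Fin d → ℝ) : Measurable (densRho n x) := by
  have := measurable_detRho n x
  unfold densRho; fun_prop

lemma measurable_densTau {d : ℕ} (n : ℕ) (x : Fin d → ℝ) : Measurable (densTau n x) := by
  have := measurable_detTau n x
  unfold densTau; fun_prop

lemma measurableSet_interlace (d : ℕ) :
    MeasurableSet {p : (Fin d → ℝ) × (Fin d → ℝ) | Interlace p.1 p.2} := by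
  simp only [Interlace, Set.ofPred_and, Set.ofPred_forall]
  refine MeasurableSet.inter (MeasurableSet.iInter fun j => ?_)
    (MeasurableSet.iInter fun j => MeasurableSet.iInter fun k => MeasurableSet.iInter fun _ => ?_)
  · exact measurableSet_le (by fun_prop) (by fun_prop)
  · exact measurableSet_le (by fun_prop) (by fun_prop)

/-- The first step. The two sides may differ where some `z_j = x_{j+1}`. -/
lemma stepDens_rho_ae {D : ℕ} {x : Fin (D + 1) → ℝ} (hx : StrictMono x) :
    stepDens Interlace x =ᵐ[volume]
      {z | Monotone z}.indicator fun z => ENNReal.ofReal (densRho 1 x z) := by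
  have hne : ∀ᵐ z : Fin (D + 1) → ℝ, ∀ j k, z j ≠ x k := by
    rw [ae_all_iff]; intro j
    rw [ae_all_iff]; intro k
    have := Measure.pi_hyperplane (fun _ : Fin (D + 1) => (volume : Measure ℝ)) j (x k)
    rw [← volume_pi] at this
    exact measure_eq_zero_iff_ae_notMem.1 this
  filter_upwards [hne] with z hz
  have hiff : Interlace x z ↔
      (∀ j, x j ≤ z j) ∧ ∀ j k : Fin (D + 1), (k : ℕ) = (j : ℕ) + 1 → z j < x k := by
    refine and_congr_right fun _ => forall_congr' fun j => forall_congr' fun k =>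
      forall_congr' fun _ => ⟨fun h => lt_of_le_of_ne h (hz j k), le_of_lt⟩
  simp only [stepDens, Set.indicator, Set.mem_ofPred_eq]
  by_cases hm : Monotone z
  · rw [if_pos hm, densRho, detRho_one hx hm]
    by_cases hi : Interlace x z
    · rw [if_pos hi, if_pos (hiff.1 hi), mul_one, prod_gammaDens_one_of_le hi.1]
    · rw [if_neg hi, if_neg fun h => hi (hiff.2 h)]; simp
  · rw [if_neg hm, if_neg fun hi : Interlace x z => hm hi.monotone_right]

/-- The Chapman-Kolmogorov equation of the interlacing walk. -/
lemma lintegral_stepDens_rho {D n : ℕ} (hn : 1 ≤ n) {x : Fin (D + 1) → ℝ} (hx : StrictMono x)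
    (z : Fin (D + 1) → ℝ) :
    ∫⁻ w, {w | Monotone w}.indicator (fun w => ENNReal.ofReal (densRho n x w)) w *
        stepDens Interlace w z =
      {z | Monotone z}.indicator (fun z => ENNReal.ofReal (densRho (n + 1) x z)) z := by
  have h1 : ∀ w, {w | Monotone w}.indicator (fun w => ENNReal.ofReal (densRho n x w)) w *
        stepDens Interlace w z = {w | Interlace w z}.indicator (fun w =>
          ENNReal.ofReal (Real.exp (-∑ j, (z j - x j))) * ENNReal.ofReal (detRho n x w)) w := by
    intro w
    simp only [stepDens, Set.indicator, Set.mem_ofPred_eq]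
    by_cases hi : Interlace w z
    · rw [if_pos hi, if_pos hi.monotone_left, if_pos hi, prod_gammaDens_one_of_le hi.1, densRho,
        ← ENNReal.ofReal_mul (mul_nonneg (Real.exp_pos _).le (detRho_nonneg hn hx hi.monotone_left)),
        ← ENNReal.ofReal_mul (Real.exp_pos _).le, ← exp_mul_exp_increments x w z]
      congr 1; ring
    · rw [if_neg hi, if_neg hi, mul_zero]
  simp only [h1]
  rw [lintegral_indicator (measurableSet_interlace_left z)]
  by_cases hm : Monotone z
  · rw [lintegral_const_mul _ (measurable_detRho n x).ennreal_ofReal, lintegral_detRho hn hx hm,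
      Set.indicator_of_mem (show z ∈ {z | Monotone z} from hm),
      ← ENNReal.ofReal_mul (Real.exp_pos _).le, densRho]
  · have : {w | Interlace w z} = ∅ :=
      Set.eq_empty_of_forall_notMem fun w (hw : Interlace w z) => hm hw.monotone_right
    rw [this, Set.indicator_of_notMem (show z ∉ {z | Monotone z} from hm)]
    simp

lemma measurableSet_step_weylChamber (d : ℕ) :
    MeasurableSet {p : (Fin d → ℝ) × (Fin d → ℝ) | p.2 ∈ weylChamber d} :=
  measurable_snd (measurableSet_weylChamber d)

lemma stepDens_tau {d : ℕ} (x : Fin d → ℝ) :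
    stepDens (fun _ z => z ∈ weylChamber d) x =
      (weylChamber d).indicator fun z => ENNReal.ofReal (densTau 1 x z) := by
  funext z
  simp only [stepDens, Set.indicator, Set.mem_ofPred_eq, densTau, detTau_one]
  by_cases hz : z ∈ weylChamber d
  · rw [if_pos hz, if_pos hz]
    by_cases h : ∀ j, x j ≤ z j
    · rw [if_pos h, mul_one, prod_gammaDens_one_of_le h]
    · rw [if_neg h, mul_zero, prod_gammaDens_one_of_not_le h]
  · rw [if_neg hz, if_neg hz]

lemma densTau_nonneg {d n : ℕ} (hn : 1 ≤ n) {x z : Fin d → ℝ} (hx : StrictMono x)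
    (hz : StrictMono z) : 0 ≤ densTau n x z :=
  mul_nonneg (Real.exp_pos _).le (detTau_nonneg hn hx hz)

lemma lintegral_densTau_mul {d n : ℕ} (hn : 1 ≤ n) {x z : Fin d → ℝ} (hx : StrictMono x)
    (hz : StrictMono z) :
    ∫⁻ w, (weylChamber d).indicator (fun w => ENNReal.ofReal (densTau n x w)) w *
        ENNReal.ofReal (∏ j, gammaDens 1 (z j - w j)) =
      ENNReal.ofReal (densTau (n + 1) x z) := by
  have hms : MeasurableSet {w : Fin d → ℝ | StrictMono w ∧ ∀ j, w j ≤ z j} := by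
    simp only [Set.ofPred_and, Set.ofPred_forall]
    refine (measurableSet_weylChamber d).inter ?_
    exact MeasurableSet.iInter fun j => measurableSet_le (by fun_prop) (by fun_prop)
  have h1 : ∀ w, (weylChamber d).indicator (fun w => ENNReal.ofReal (densTau n x w)) w *
        ENNReal.ofReal (∏ j, gammaDens 1 (z j - w j)) =
        {w : Fin d → ℝ | StrictMono w ∧ ∀ j, w j ≤ z j}.indicator (fun w =>
          ENNReal.ofReal (Real.exp (-∑ j, (z j - x j))) * ENNReal.ofReal (detTau n x w)) w := by
    intro w
    simp only [Set.indicator, Set.mem_ofPred_eq]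
    by_cases hw : w ∈ weylChamber d
    · by_cases hwz : ∀ j, w j ≤ z j
      · rw [if_pos hw, if_pos ⟨hw, hwz⟩, prod_gammaDens_one_of_le hwz, densTau,
          ← ENNReal.ofReal_mul (mul_nonneg (Real.exp_pos _).le (detTau_nonneg hn hx hw)),
          ← ENNReal.ofReal_mul (Real.exp_pos _).le, ← exp_mul_exp_increments x w z]
        congr 1; ring
      · rw [if_neg fun h : _ ∧ _ => hwz h.2, prod_gammaDens_one_of_not_le hwz]; simp
    · rw [if_neg hw, if_neg (show ¬(StrictMono w ∧ ∀ j, w j ≤ z j) from fun h => hw h.1), zero_mul]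
  simp only [h1]
  rw [lintegral_indicator hms, lintegral_const_mul _ (measurable_detTau n x).ennreal_ofReal,
    lintegral_detTau hn hx hz, ← ENNReal.ofReal_mul (Real.exp_pos _).le, densTau]

/-- The Chapman-Kolmogorov equation of the walk killed on leaving the chamber. -/
lemma lintegral_stepDens_tau {d n : ℕ} (hn : 1 ≤ n) {x : Fin d → ℝ} (hx : StrictMono x)
    (z : Fin d → ℝ) :
    ∫⁻ w, (weylChamber d).indicator (fun w => ENNReal.ofReal (densTau n x w)) w *
        stepDens (fun _ z => z ∈ weylChamber d) w z =
      (weylChamber d).indicator (fun z => ENNReal.ofReal (densTau (n + 1) x z)) z := by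
  by_cases hz : z ∈ weylChamber d
  · rw [Set.indicator_of_mem hz, ← lintegral_densTau_mul hn hx hz]
    refine lintegral_congr fun w => ?_
    congr 1
    exact Set.indicator_of_mem (show (w, z) ∈ {p : (Fin d → ℝ) × (Fin d → ℝ) |
      p.2 ∈ weylChamber d} from hz) _
  · rw [Set.indicator_of_notMem hz]
    have : ∀ w, stepDens (fun _ z => z ∈ weylChamber d) w z = 0 := fun w =>
      Set.indicator_of_notMem (show (w, z) ∉ {p : (Fin d → ℝ) × (Fin d → ℝ) |
        p.2 ∈ weylChamber d} from hz) _
    simp [this]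

section Law

variable {Ω : Type*} [MeasurableSpace Ω] {P : Measure Ω} [IsProbabilityMeasure P]

lemma map_walk_rho {D : ℕ} {X : ℕ → Fin (D + 1) → Ω → ℝ} (hmeas : ∀ i j, Measurable (X i j))
    (hexp : ∀ i j, P.map (X i j) = expMeasure 1)
    (hindep : iIndepFun (fun p : ℕ × Fin (D + 1) => X p.1 p.2) P) {n : ℕ} (hn : 1 ≤ n)
    {x : Fin (D + 1) → ℝ} (hx : StrictMono x) :
    (P.restrict (stepEvent Interlace X x n)).map (walk X x n) =
      volume.withDensity ({z | Monotone z}.indicator fun z => ENNReal.ofReal (densRho n x z)) := by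
  have hC := measurableSet_interlace (D + 1)
  induction n, hn using Nat.le_induction with
  | base =>
    rw [map_walk_one hC hmeas hexp hindep]
    exact withDensity_congr_ae (stepDens_rho_ae hx)
  | succ n hn ih =>
    rw [map_walk_succ hC hmeas hexp hindep x n ((measurable_densRho n x).ennreal_ofReal.indicator
      (measurableSet_monotone _)) ih]
    congr 1
    exact funext (lintegral_stepDens_rho hn hx)

lemma map_walk_tau {d : ℕ} {X : ℕ → Fin d → Ω → ℝ} (hmeas : ∀ i j, Measurable (X i j))
    (hexp : ∀ i j, P.map (X i j) = expMeasure 1)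
    (hindep : iIndepFun (fun p : ℕ × Fin d => X p.1 p.2) P) {n : ℕ} (hn : 1 ≤ n)
    {x : Fin d → ℝ} (hx : StrictMono x) :
    (P.restrict (stepEvent (fun _ z => z ∈ weylChamber d) X x n)).map (walk X x n) =
      volume.withDensity ((weylChamber d).indicator fun z => ENNReal.ofReal (densTau n x z)) := by
  have hC := measurableSet_step_weylChamber d
  induction n, hn using Nat.le_induction with
  | base => rw [map_walk_one hC hmeas hexp hindep, stepDens_tau]
  | succ n hn ih =>
    rw [map_walk_succ hC hmeas hexp hindep x n ((measurable_densTau n x).ennreal_ofReal.indicator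
      (measurableSet_weylChamber _)) ih]
    congr 1
    exact funext (lintegral_stepDens_tau hn hx)

lemma continuous_detRho {d n : ℕ} (hn : 2 ≤ n) (x : Fin d → ℝ) : Continuous (detRho n x) := by
  have := continuous_truncPow hn
  unfold detRho
  exact Continuous.matrix_det (continuous_matrix fun i j => by fun_prop)

theorem isKilledDensity_densRho {D : ℕ} {X : ℕ → Fin (D + 1) → Ω → ℝ}
    (hmeas : ∀ i j, Measurable (X i j)) (hexp : ∀ i j, P.map (X i j) = expMeasure 1)
    (hindep : iIndepFun (fun p : ℕ × Fin (D + 1) => X p.1 p.2) P) :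
    IsKilledDensity P X (rho X) densRho where
  nonneg n hn x hx z hz := mul_nonneg (Real.exp_pos _).le (detRho_nonneg hn hx hz.monotone)
  continuousOn n hn x _ := by
    have := continuous_detRho hn x
    refine Continuous.continuousOn ?_
    unfold densRho
    fun_prop
  law n hn x hx A hA hAW := by
    have h1 := congrArg (fun μ => μ A) (map_walk_rho hmeas hexp hindep hn hx)
    rw [Measure.map_apply (measurable_walk hmeas x n) hA,
      Measure.restrict_apply ((measurable_walk hmeas x n) hA), withDensity_apply _ hA] at h1
    simp only [natCast_lt_rho_iff]
    refine h1.trans (setLIntegral_congr_fun hA fun z hz => ?_)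
    exact Set.indicator_of_mem (show z ∈ {z | Monotone z} from (hAW hz).monotone) _

/-- The density of the walk killed on leaving the chamber is continuous from the second step on,
even though entries of its determinant jump: it is the previous density smoothed by one step. -/
lemma continuousOn_densTau_succ {d : ℕ} {X : ℕ → Fin d → Ω → ℝ}
    (hmeas : ∀ i j, Measurable (X i j)) (hexp : ∀ i j, P.map (X i j) = expMeasure 1)
    (hindep : iIndepFun (fun p : ℕ × Fin d => X p.1 p.2) P) {n : ℕ} (hn : 1 ≤ n)
    {x : Fin d → ℝ} (hx : StrictMono x) : ContinuousOn (densTau (n + 1) x) (weylChamber d) := by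
  set Φ : (Fin d → ℝ) → ℝ := (weylChamber d).indicator (densTau n x) with hΦ
  have hΦ0 : ∀ w, 0 ≤ Φ w := Set.indicator_nonneg fun w hw => densTau_nonneg hn hx hw
  have hΦm : Measurable Φ := (measurable_densTau n x).indicator (measurableSet_weylChamber d)
  have hofReal : ∀ w, (weylChamber d).indicator (fun w => ENNReal.ofReal (densTau n x w)) w =
      ENNReal.ofReal (Φ w) := by
    intro w
    by_cases hw : w ∈ weylChamber d <;> simp [hΦ, hw]
  have hΦi : Integrable Φ := by
    refine ⟨hΦm.aestronglyMeasurable, ?_⟩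
    rw [hasFiniteIntegral_iff_ofReal (ae_of_all _ hΦ0)]
    have h1 := congrArg (fun μ => μ Set.univ) (map_walk_tau hmeas hexp hindep hn hx)
    rw [withDensity_apply _ MeasurableSet.univ, Measure.restrict_univ] at h1
    simp only [hofReal] at h1
    rw [← h1]
    exact measure_lt_top _ _
  set H : (Fin d → ℝ) → ℝ := fun z => ∫ w, Φ w * ∏ j, gammaDens 1 (z j - w j) with hH
  have hprod0 : ∀ z w : Fin d → ℝ, 0 ≤ ∏ j, gammaDens 1 (z j - w j) := fun z w =>
    Finset.prod_nonneg fun j _ => gammaDens_nonneg _ _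
  have hprod1 : ∀ z w : Fin d → ℝ, ∏ j, gammaDens 1 (z j - w j) ≤ 1 := fun z w =>
    Finset.prod_le_one (fun j _ => gammaDens_nonneg _ _) fun j _ => gammaDens_le_one _ _
  have hcont : Continuous H := by
    refine continuous_iff_continuousAt.2 fun z => ?_
    refine continuousAt_of_dominated (bound := Φ) (Eventually.of_forall fun z' => ?_)
      (Eventually.of_forall fun z' => ae_of_all _ fun w => ?_) hΦi ?_
    · exact (hΦm.mul (by fun_prop)).aestronglyMeasurable
    · rw [Real.norm_of_nonneg (mul_nonneg (hΦ0 w) (hprod0 _ _))]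
      exact mul_le_of_le_one_right (hΦ0 w) (hprod1 _ _)
    · have hne : ∀ᵐ w : Fin d → ℝ, ∀ j, w j ≠ z j := by
        rw [ae_all_iff]; intro j
        have := Measure.pi_hyperplane (fun _ : Fin d => (volume : Measure ℝ)) j (z j)
        rw [← volume_pi] at this
        exact measure_eq_zero_iff_ae_notMem.1 this
      filter_upwards [hne] with w hw
      refine continuousAt_const.mul (tendsto_finsetProd _ fun j _ => ?_)
      have hc : ContinuousAt (gammaDens 1) (z j - w j) := by
        rcases lt_or_gt_of_ne (sub_ne_zero.2 (hw j).symm) with h | h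
        · refine (continuousAt_const (y := (0 : ℝ))).congr ?_
          filter_upwards [gt_mem_nhds h] with u hu using (gammaDens_of_neg 1 hu).symm
        · have : ContinuousAt (fun u : ℝ => Real.exp (-u)) (z j - w j) := by fun_prop
          refine this.congr ?_
          filter_upwards [lt_mem_nhds h] with u hu using (gammaDens_one_of_nonneg hu.le).symm
      exact ContinuousAt.comp (f := fun z' : Fin d → ℝ => z' j - w j) hc
        ((continuous_apply j).sub continuous_const).continuousAt
  refine hcont.continuousOn.congr fun z hz => ?_
  have h1 := lintegral_densTau_mul hn hx hz
  simp only [hofReal] at h1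
  have h2 : ∀ w, ENNReal.ofReal (Φ w) * ENNReal.ofReal (∏ j, gammaDens 1 (z j - w j)) =
      ENNReal.ofReal (Φ w * ∏ j, gammaDens 1 (z j - w j)) := fun w =>
    (ENNReal.ofReal_mul (hΦ0 w)).symm
  simp only [h2] at h1
  rw [hH]
  simp only
  rw [integral_eq_lintegral_of_nonneg_ae
    (ae_of_all _ fun w => mul_nonneg (hΦ0 w) (hprod0 z w))
    (hΦm.mul (by fun_prop)).aestronglyMeasurable, h1,
    ENNReal.toReal_ofReal (densTau_nonneg (by omega) hx hz)]

theorem isKilledDensity_densTau {d : ℕ} {X : ℕ → Fin d → Ω → ℝ}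
    (hmeas : ∀ i j, Measurable (X i j)) (hexp : ∀ i j, P.map (X i j) = expMeasure 1)
    (hindep : iIndepFun (fun p : ℕ × Fin d => X p.1 p.2) P) :
    IsKilledDensity P X (tau X) densTau where
  nonneg n hn x hx z hz := densTau_nonneg hn hx hz
  continuousOn n hn x hx := by
    obtain ⟨n, rfl⟩ := Nat.exists_eq_add_of_le' (show 1 ≤ n by omega)
    exact continuousOn_densTau_succ hmeas hexp hindep (by omega) hx
  law n hn x hx A hA hAW := by
    have h1 := congrArg (fun μ => μ A) (map_walk_tau hmeas hexp hindep hn hx)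
    rw [Measure.map_apply (measurable_walk hmeas x n) hA,
      Measure.restrict_apply ((measurable_walk hmeas x n) hA), withDensity_apply _ hA] at h1
    simp only [natCast_lt_tau_iff]
    refine h1.trans (setLIntegral_congr_fun hA fun z hz => ?_)
    exact Set.indicator_of_mem (hAW hz) _

end Law

/-- From the second step on, the transition density is determined on the chamber. -/
theorem IsKilledDensity.eqOn {Ω : Type*} [MeasurableSpace Ω] {P : Measure Ω}
    [IsFiniteMeasure P] {d : ℕ} {X : ℕ → Fin d → Ω → ℝ} {T : (Fin d → ℝ) → Ω → ℕ∞}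
    {G G' : ℕ → (Fin d → ℝ) → (Fin d → ℝ) → ℝ}
    (hG : IsKilledDensity P X T G) (hG' : IsKilledDensity P X T G') {n : ℕ} (hn : 2 ≤ n)
    {x : Fin d → ℝ} (hx : x ∈ weylChamber d) : Set.EqOn (G n x) (G' n x) (weylChamber d) := by
  have hW := measurableSet_weylChamber d
  have hc := hG.continuousOn n hn x hx
  have hc' := hG'.continuousOn n hn x hx
  have hm : AEMeasurable (fun z => ENNReal.ofReal (G n x z)) (volume.restrict (weylChamber d)) :=
    (hc.aemeasurable hW).ennreal_ofReal
  have hm' : AEMeasurable (fun z => ENNReal.ofReal (G' n x z)) (volume.restrict (weylChamber d)) :=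
    (hc'.aemeasurable hW).ennreal_ofReal
  have hae : (fun z => ENNReal.ofReal (G n x z)) =ᵐ[volume.restrict (weylChamber d)]
      fun z => ENNReal.ofReal (G' n x z) := by
    refine AEMeasurable.ae_eq_of_forall_setLIntegral_eq hm hm' ?_ ?_ ?_
    · rw [← hG.law n (by omega) x hx _ hW le_rfl]; exact measure_ne_top _ _
    · rw [← hG'.law n (by omega) x hx _ hW le_rfl]; exact measure_ne_top _ _
    · intro s hs _
      rw [Measure.restrict_restrict hs,
        ← hG.law n (by omega) x hx _ (hs.inter hW) Set.inter_subset_right,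
        ← hG'.law n (by omega) x hx _ (hs.inter hW) Set.inter_subset_right]
  refine Measure.eqOn_open_of_ae_eq (μ := volume) ?_ (isOpen_weylChamber d) hc hc'
  filter_upwards [hae, ae_restrict_mem hW] with z hz hzW
  rwa [ENNReal.ofReal_eq_ofReal_iff (hG.nonneg n (by omega) x hx z hzW)
    (hG'.nonneg n (by omega) x hx z hzW)] at hz

/-! ### Newton interpolation and the determinant of a binomial kernel -/

/-- The coefficients of `t ^ k` in the Newton basis `∏_{m < l} (t - a m)`; `newtonCoeff a k l` is
the complete homogeneous symmetric polynomial of degree `k - l` in `a 0, ..., a l`. -/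
noncomputable def newtonCoeff (a : ℕ → ℝ) : ℕ → ℕ → ℝ
  | 0, 0 => 1
  | 0, _ + 1 => 0
  | k + 1, 0 => a 0 * newtonCoeff a k 0
  | k + 1, l + 1 => newtonCoeff a k l + a (l + 1) * newtonCoeff a k (l + 1)

/-- Newton interpolation of `t ^ k`. The truncated expansion is exact at the nodes `a 0, ..., a D`,
which is what the hypothesis says of `t`. -/
lemma pow_eq_sum_newtonCoeff (a : ℕ → ℝ) {D : ℕ} {t : ℝ}
    (ht : ∏ m ∈ Finset.range (D + 1), (t - a m) = 0) (k : ℕ) :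
    t ^ k = ∑ l ∈ Finset.range (D + 1), (∏ m ∈ Finset.range l, (t - a m)) * newtonCoeff a k l := by
  induction k with
  | zero =>
    rw [Finset.sum_range_succ']
    simp [newtonCoeff]
  | succ k ih =>
    have h1 : ∀ l, t * ((∏ m ∈ Finset.range l, (t - a m)) * newtonCoeff a k l) =
        (∏ m ∈ Finset.range (l + 1), (t - a m)) * newtonCoeff a k l +
          (∏ m ∈ Finset.range l, (t - a m)) * (a l * newtonCoeff a k l) := by
      intro l; rw [Finset.prod_range_succ]; ring
    rw [pow_succ', ih, Finset.mul_sum, Finset.sum_congr rfl fun l _ => h1 l,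
      Finset.sum_add_distrib, Finset.sum_range_succ, ht, zero_mul, add_zero,
      Finset.sum_range_succ' (n := D), Finset.sum_range_succ' (n := D), ← add_assoc,
      ← Finset.sum_add_distrib]
    simp only [newtonCoeff]
    congr 1
    refine Finset.sum_congr rfl fun l _ => ?_
    ring

lemma newtonCoeff_eq_zero (a : ℕ → ℝ) {k l : ℕ} (h : k < l) : newtonCoeff a k l = 0 := by
  induction k generalizing l with
  | zero => obtain ⟨l, rfl⟩ := Nat.exists_eq_add_of_le' h; rfl
  | succ k ih =>
    obtain ⟨l, rfl⟩ := Nat.exists_eq_add_of_le' (show 1 ≤ l by omega)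
    simp [newtonCoeff, ih (show k < l by omega), ih (show k < l + 1 by omega)]

lemma newtonCoeff_self (a : ℕ → ℝ) (k : ℕ) : newtonCoeff a k k = 1 := by
  induction k with
  | zero => rfl
  | succ k ih => simp [newtonCoeff, ih, newtonCoeff_eq_zero a (Nat.lt_succ_self k)]

lemma abs_newtonCoeff_le {a : ℕ → ℝ} {B : ℝ} (ha : ∀ m, |a m| ≤ B) {k l : ℕ} (h : l ≤ k) :
    |newtonCoeff a k l| ≤ 2 ^ k * B ^ (k - l) := by
  have hB : 0 ≤ B := (abs_nonneg _).trans (ha 0)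
  induction k generalizing l with
  | zero => obtain rfl : l = 0 := by omega
            simp [newtonCoeff]
  | succ k ih =>
    cases l with
    | zero =>
      simp only [newtonCoeff, abs_mul, Nat.sub_zero]
      have := mul_le_mul (ha 0) (ih (Nat.zero_le k)) (abs_nonneg _) hB
      simp only [Nat.sub_zero] at this
      have h2 : 0 ≤ 2 ^ k * B ^ (k + 1) := by positivity
      calc |a 0| * |newtonCoeff a k 0| ≤ B * (2 ^ k * B ^ k) := this
        _ = 2 ^ k * B ^ (k + 1) := by ring
        _ ≤ 2 ^ (k + 1) * B ^ (k + 1) := by rw [pow_succ (2 : ℝ) k]; linarith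
    | succ l =>
      have h1 := ih (show l ≤ k by omega)
      have h2 : |a (l + 1) * newtonCoeff a k (l + 1)| ≤ 2 ^ k * B ^ (k - l) := by
        rcases Nat.lt_or_ge k (l + 1) with hk | hk
        · rw [newtonCoeff_eq_zero a hk, mul_zero, abs_zero]; positivity
        · rw [abs_mul]
          calc |a (l + 1)| * |newtonCoeff a k (l + 1)| ≤ B * (2 ^ k * B ^ (k - (l + 1))) :=
                mul_le_mul (ha _) (ih hk) (abs_nonneg _) hB
            _ = 2 ^ k * B ^ (k - (l + 1) + 1) := by ring
            _ = 2 ^ k * B ^ (k - l) := by congr 2; omega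
      rw [Nat.succ_sub_succ]
      calc |newtonCoeff a (k + 1) (l + 1)| ≤ _ := abs_add_le _ _
        _ ≤ 2 ^ k * B ^ (k - l) + 2 ^ k * B ^ (k - l) := add_le_add h1 h2
        _ = 2 ^ (k + 1) * B ^ (k - l) := by ring

/-- The extension of a vector by zero. -/
noncomputable def extendZero {d : ℕ} (v : Fin d → ℝ) (m : ℕ) : ℝ :=
  if h : m < d then v ⟨m, h⟩ else 0

lemma extendZero_coe {d : ℕ} (v : Fin d → ℝ) (i : Fin d) : extendZero v i = v i := by
  simp [extendZero]

/-- The matrix of the Newton basis at the nodes. -/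
noncomputable def newtonMatrix {d : ℕ} (v : Fin d → ℝ) : Matrix (Fin d) (Fin d) ℝ :=
  Matrix.of fun i l => ∏ m ∈ Finset.range l, (v i - extendZero v m)

lemma det_newtonMatrix {d : ℕ} (v : Fin d → ℝ) : (newtonMatrix v).det = vandermonde v := by
  rw [newtonMatrix, Matrix.det_of_isLowerTriangular]
  · have h1 : ∀ i : Fin d, ∏ m ∈ Finset.range i, (v i - extendZero v m) =
        ∏ m ∈ Finset.Iio i, (v i - v m) := by
      intro i
      have : Finset.range (i : ℕ) = (Finset.Iio i).map Fin.valEmbedding := by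
        rw [Fin.map_valEmbedding_Iio, Nat.Iio_eq_range]
      rw [this, Finset.prod_map]
      exact Finset.prod_congr rfl fun m _ => by simp [extendZero_coe]
    simp only [Matrix.of_apply, h1, vandermonde]
    exact Finset.prod_comm' (by simp)
  · intro i l hil
    have hil : i < l := hil
    exact Finset.prod_eq_zero (Finset.mem_range.2 (Fin.lt_def.1 hil))
      (by rw [extendZero_coe, sub_self])

lemma pow_eq_sum_newtonMatrix {d : ℕ} (v : Fin d → ℝ) (i : Fin d) (k : ℕ) :
    v i ^ k = ∑ l : Fin d, newtonMatrix v i l * newtonCoeff (extendZero v) k l := by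
  obtain ⟨D, rfl⟩ := Nat.exists_eq_add_of_le' (Nat.one_le_of_lt i.2)
  rw [pow_eq_sum_newtonCoeff (extendZero v) (D := D)
    (Finset.prod_eq_zero (Finset.mem_range.2 i.2) (by rw [extendZero_coe, sub_self])) k,
    Finset.sum_range]
  rfl

/-- The middle factor in the factorization of the matrix `((1 + s α_i γ_j) ^ N)`. -/
noncomputable def binomialCore {d : ℕ} (N : ℕ) (s : ℝ) (α γ : Fin d → ℝ) :
    Matrix (Fin d) (Fin d) ℝ :=
  Matrix.of fun l l' => ∑ k ∈ Finset.range (N + 1), (N.choose k : ℝ) * s ^ k *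
    (newtonCoeff (extendZero α) k l * newtonCoeff (extendZero γ) k l')

/-- Expanding the powers of `α_i` and of `γ_j` in the Newton bases extracts both Vandermonde products
without any error term, even when nodes are close to one another or coincide. -/
lemma det_one_add_mul_pow {d : ℕ} (N : ℕ) (s : ℝ) (α γ : Fin d → ℝ) :
    (Matrix.of fun i j : Fin d => (1 + s * (α i * γ j)) ^ N).det =
      vandermonde α * vandermonde γ * (binomialCore N s α γ).det := by
  have h : (Matrix.of fun i j : Fin d => (1 + s * (α i * γ j)) ^ N) =
      newtonMatrix α * binomialCore N s α γ * (newtonMatrix γ).transpose := by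
    ext i j
    simp only [Matrix.mul_apply, Matrix.of_apply, Matrix.transpose_apply, binomialCore]
    rw [add_comm, add_pow]
    simp only [one_pow, mul_one, mul_pow, pow_eq_sum_newtonMatrix α, pow_eq_sum_newtonMatrix γ]
    simp only [Finset.sum_mul, Finset.mul_sum]
    rw [Finset.sum_comm]
    refine (Finset.sum_congr rfl fun l' _ => Finset.sum_comm).trans ?_
    refine Finset.sum_congr rfl fun l' _ => Finset.sum_congr rfl fun l _ =>
      Finset.sum_congr rfl fun k _ => ?_
    ring
  rw [h, Matrix.det_mul, Matrix.det_mul, Matrix.det_transpose, det_newtonMatrix, det_newtonMatrix]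
  ring

lemma choose_mul_inv_pow_le {N n : ℕ} (hN : N ≤ n) (hn : 0 < n) (k : ℕ) :
    (N.choose k : ℝ) * (n : ℝ)⁻¹ ^ k ≤ 1 / (k.factorial : ℝ) := by
  have h1 : (N.choose k : ℝ) ≤ (N : ℝ) ^ k / k.factorial := Nat.choose_le_pow_div k N
  have h2 : (N : ℝ) ^ k ≤ (n : ℝ) ^ k := by gcongr
  have hn' : (0 : ℝ) < n := by exact_mod_cast hn
  calc (N.choose k : ℝ) * (n : ℝ)⁻¹ ^ k ≤ (n : ℝ) ^ k / k.factorial * (n : ℝ)⁻¹ ^ k := by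
        gcongr; exact h1.trans (by gcongr)
    _ = 1 / (k.factorial : ℝ) := by
        rw [inv_pow]; field_simp

/-- Apart from the diagonal term `k = l = l'`, every term in an entry of `binomialCore` carries a
factor of the size `B` of the nodes. -/
lemma abs_binomialCore_sub_le {d : ℕ} {N n : ℕ} (hN : N ≤ n) (hn : 0 < n) {α γ : Fin d → ℝ}
    {B : ℝ} (hB1 : B ≤ 1) (hB0 : 0 ≤ B) (hα : ∀ i, |α i| ≤ B) (hγ : ∀ i, |γ i| ≤ B)
    (l l' : Fin d) :
    |binomialCore N (n : ℝ)⁻¹ α γ l l' -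
        if l = l' then (N.choose l : ℝ) * (n : ℝ)⁻¹ ^ (l : ℕ) else 0| ≤ B * Real.exp 4 := by
  have hext : ∀ {v : Fin d → ℝ}, (∀ i, |v i| ≤ B) → ∀ m, |extendZero v m| ≤ B := by
    intro v hv m
    unfold extendZero
    split_ifs
    · exact hv _
    · simpa using hB0
  set T : ℕ → ℝ := fun k => (N.choose k : ℝ) * (n : ℝ)⁻¹ ^ k *
    (newtonCoeff (extendZero α) k l * newtonCoeff (extendZero γ) k l') with hT
  have hmain : (if l = l' then (N.choose l : ℝ) * (n : ℝ)⁻¹ ^ (l : ℕ) else 0) =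
      ∑ k ∈ Finset.range (N + 1), if k = (l : ℕ) ∧ l = l' then T k else 0 := by
    by_cases hll : l = l'
    · subst hll
      simp only [and_true, if_true, Finset.sum_ite_eq', Finset.mem_range]
      split_ifs with h
      · simp [hT, newtonCoeff_self]
      · rw [Nat.choose_eq_zero_of_lt (by omega)]; simp
    · simp [hll]
  rw [hmain]
  change |∑ k ∈ Finset.range (N + 1), T k - _| ≤ _
  rw [← Finset.sum_sub_distrib]
  have hterm : ∀ k, |T k - if k = (l : ℕ) ∧ l = l' then T k else 0| ≤
      B * (4 ^ k / (k.factorial : ℝ)) := by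
    intro k
    have hpos : 0 ≤ B * (4 ^ k / (k.factorial : ℝ)) := by positivity
    split_ifs with h
    · simpa using hpos
    · rw [sub_zero]
      by_cases hk : (l : ℕ) ≤ k ∧ (l' : ℕ) ≤ k
      · have h1 := abs_newtonCoeff_le (hext hα) hk.1
        have h2 := abs_newtonCoeff_le (hext hγ) hk.2
        have hexp : 1 ≤ (k - (l : ℕ)) + (k - (l' : ℕ)) := by
          by_contra hcon
          exact h ⟨by omega, Fin.ext (by omega)⟩
        have h3 : B ^ (k - (l : ℕ)) * B ^ (k - (l' : ℕ)) ≤ B := by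
          rw [← pow_add]
          calc B ^ (k - (l : ℕ) + (k - (l' : ℕ))) ≤ B ^ 1 :=
                pow_le_pow_of_le_one hB0 hB1 hexp
            _ = B := pow_one B
        have h4 := choose_mul_inv_pow_le hN hn k
        simp only [hT, abs_mul]
        rw [abs_of_nonneg (by positivity : (0 : ℝ) ≤ (N.choose k : ℝ)),
          abs_of_nonneg (by positivity : (0 : ℝ) ≤ (n : ℝ)⁻¹ ^ k)]
        calc (N.choose k : ℝ) * (n : ℝ)⁻¹ ^ k *
              (|newtonCoeff (extendZero α) k l| * |newtonCoeff (extendZero γ) k l'|)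
            ≤ 1 / (k.factorial : ℝ) *
              ((2 ^ k * B ^ (k - (l : ℕ))) * (2 ^ k * B ^ (k - (l' : ℕ)))) := by
              gcongr
          _ = (4 ^ k / (k.factorial : ℝ)) * (B ^ (k - (l : ℕ)) * B ^ (k - (l' : ℕ))) := by
              rw [show (4 : ℝ) = 2 * 2 by norm_num, mul_pow]; ring
          _ ≤ (4 ^ k / (k.factorial : ℝ)) * B := by gcongr
          _ = _ := mul_comm _ _
      · have : T k = 0 := by
          rcases not_and_or.1 hk with hk | hk
          · simp [hT, newtonCoeff_eq_zero (extendZero α) (not_le.1 hk)]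
          · simp [hT, newtonCoeff_eq_zero (extendZero γ) (not_le.1 hk)]
        rw [this, abs_zero]; exact hpos
  calc _ ≤ ∑ k ∈ Finset.range (N + 1), |T k - if k = (l : ℕ) ∧ l = l' then T k else 0| :=
        Finset.abs_sum_le_sum_abs _ _
    _ ≤ ∑ k ∈ Finset.range (N + 1), B * (4 ^ k / (k.factorial : ℝ)) :=
        Finset.sum_le_sum fun k _ => hterm k
    _ = B * ∑ k ∈ Finset.range (N + 1), 4 ^ k / (k.factorial : ℝ) := by rw [Finset.mul_sum]
    _ ≤ B * Real.exp 4 := by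
        gcongr
        exact Real.sum_le_exp_of_nonneg (by norm_num) _

/-! ### The local limit of the Gamma determinant -/

section LocalLimit

variable {ι : Type*} {l : Filter ι} {n : ι → ℕ}

lemma tendsto_sqrt_natCast (hn : Tendsto n l atTop) :
    Tendsto (fun p => √(n p : ℝ)) l atTop :=
  Real.tendsto_sqrt_atTop.comp (tendsto_natCast_atTop_atTop.comp hn)

lemma tendsto_div_natCast (hn : Tendsto n l atTop) {u : ι → ℝ}
    (hu : Tendsto (fun p => u p / √(n p : ℝ)) l (𝓝 0)) :
    Tendsto (fun p => u p / (n p : ℝ)) l (𝓝 0) := by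
  have h := hu.mul (tendsto_inv_atTop_zero.comp (tendsto_sqrt_natCast hn))
  rw [mul_zero] at h
  refine h.congr fun p => ?_
  simp only [Function.comp]
  rw [← div_eq_mul_inv, div_div, Real.mul_self_sqrt (Nat.cast_nonneg _)]

/-- The factor left over from one variable; it tends to `1` since
`log (1 + w) - w = O(w ^ 2)` and `n w ^ 2 = (u / √n) ^ 2` for `w = u / n`. -/
lemma tendsto_exp_neg_mul_one_add_div_pow (hn : Tendsto n l atTop) {u : ι → ℝ}
    (hu : Tendsto (fun p => u p / √(n p : ℝ)) l (𝓝 0)) :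
    Tendsto (fun p => Real.exp (-u p) * (1 + u p / n p) ^ (n p - 1)) l (𝓝 1) := by
  have hw := tendsto_div_natCast hn hu
  have hE : Tendsto (fun p => ((n p - 1 : ℕ) : ℝ) * (Real.log (1 + u p / n p) - u p / n p) -
      u p / n p) l (𝓝 0) := by
    have hb : Tendsto (fun p => 2 * (u p / √(n p : ℝ)) ^ 2 + |u p / n p|) l (𝓝 0) := by
      simpa using ((hu.pow 2).const_mul 2).add hw.abs
    refine squeeze_zero_norm' ?_ hb
    have hw2 : ∀ᶠ p in l, |u p / n p| < 1 / 2 := by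
      have := hw.abs
      rw [abs_zero] at this
      exact this.eventually_lt_const (by norm_num)
    filter_upwards [hw2, hn.eventually_ge_atTop 1] with p hp hn1
    set w := u p / n p with hwdef
    have h1 := Real.abs_log_sub_add_sum_range_le (x := -w) (by rw [abs_neg]; linarith) 1
    simp only [Finset.range_one, Finset.sum_singleton, zero_add, pow_one, Nat.cast_zero, div_one,
      sub_neg_eq_add, abs_neg] at h1
    have h2 : |Real.log (1 + w) - w| ≤ 2 * w ^ 2 := by
      have h3 : |w| ^ (1 + 1) / (1 - |w|) ≤ 2 * w ^ 2 := by
        rw [div_le_iff₀ (by linarith), ← sq_abs w]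
        change |w| ^ 2 ≤ _
        nlinarith [mul_nonneg (sq_nonneg |w|) (show 0 ≤ 1 - 2 * |w| by linarith)]
      rw [show Real.log (1 + w) - w = -w + Real.log (1 + w) by ring]
      exact h1.trans h3
    have hnpos : (0 : ℝ) < n p := by exact_mod_cast hn1
    have h4 : (n p : ℝ) * w ^ 2 = (u p / √(n p : ℝ)) ^ 2 := by
      rw [hwdef, div_pow, div_pow, Real.sq_sqrt hnpos.le]
      field_simp
    have h5 : ((n p - 1 : ℕ) : ℝ) ≤ n p := by exact_mod_cast Nat.sub_le _ _
    rw [Real.norm_eq_abs]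
    calc |((n p - 1 : ℕ) : ℝ) * (Real.log (1 + w) - w) - w|
        ≤ |((n p - 1 : ℕ) : ℝ) * (Real.log (1 + w) - w)| + |w| := abs_sub _ _
      _ = ((n p - 1 : ℕ) : ℝ) * |Real.log (1 + w) - w| + |w| := by
          rw [abs_mul, abs_of_nonneg (Nat.cast_nonneg _)]
      _ ≤ (n p : ℝ) * (2 * w ^ 2) + |w| := by gcongr
      _ = 2 * (u p / √(n p : ℝ)) ^ 2 + |w| := by rw [← h4]; ring
  have hexp := (Real.continuous_exp.tendsto 0).comp hE
  rw [Real.exp_zero] at hexp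
  refine hexp.congr' ?_
  have hw2 : ∀ᶠ p in l, |u p / n p| < 1 / 2 := by
    have := hw.abs
    rw [abs_zero] at this
    exact this.eventually_lt_const (by norm_num)
  filter_upwards [hw2, hn.eventually_ge_atTop 1] with p hp hn1
  have hnpos : (0 : ℝ) < n p := by exact_mod_cast hn1
  have hpos : 0 < 1 + u p / n p := by linarith [(abs_lt.1 hp).1]
  rw [Function.comp, ← Real.exp_log (pow_pos hpos (n p - 1)), ← Real.exp_add, Real.log_pow,
    Nat.cast_sub hn1]
  congr 1
  field_simp
  push_cast
  ring

/-- Stirling's formula for the value of the Gamma density of shape `n` at its mean `n`. -/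
lemma tendsto_stirling (hn : Tendsto n l atTop) :
    Tendsto (fun p => Real.exp (-(n p : ℝ)) * (n p : ℝ) ^ (n p - 1) / ((n p - 1).factorial : ℝ) *
      √(2 * Real.pi * n p)) l (𝓝 1) := by
  have h1 := (isEquivalent_iff_tendsto_one (by
    filter_upwards [eventually_gt_atTop 0] with m hm
    positivity)).1 Stirling.factorial_isEquivalent_stirling
  have h2 := (h1.inv₀ one_ne_zero).comp hn
  rw [inv_one] at h2
  refine h2.congr' ?_
  filter_upwards [hn.eventually_ge_atTop 1] with p hp
  obtain ⟨m, hm⟩ := Nat.exists_eq_add_of_le' hp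
  simp only [Function.comp, Pi.div_apply, hm, Nat.add_sub_cancel, Nat.factorial_succ]
  have : ((m + 1 : ℕ) : ℝ) ≠ 0 := by positivity
  rw [show 2 * ((m + 1 : ℕ) : ℝ) * Real.pi = 2 * Real.pi * ((m + 1 : ℕ) : ℝ) by ring, div_pow,
    ← Real.exp_nat_mul, mul_one, Real.exp_neg, pow_succ]
  push_cast
  field_simp

lemma tendsto_binomialCore_det {d : ℕ} (hn : Tendsto n l atTop) {α γ : ι → Fin d → ℝ}
    (hα : ∀ i, Tendsto (fun p => α p i) l (𝓝 0)) (hγ : ∀ i, Tendsto (fun p => γ p i) l (𝓝 0)) :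
    Tendsto (fun p => (binomialCore (n p - 1) (n p : ℝ)⁻¹ (α p) (γ p)).det) l
      (𝓝 (∏ j : Fin d, 1 / ((j : ℕ).factorial : ℝ))) := by
  set B : ι → ℝ := fun p => ∑ i, |α p i| + ∑ i, |γ p i| with hB
  have hBlim : Tendsto B l (𝓝 0) := by
    have h1 := (tendsto_finsetSum Finset.univ fun i _ => (hα i).abs).add
      (tendsto_finsetSum Finset.univ fun i _ => (hγ i).abs)
    simpa using h1
  have hB0 : ∀ p, 0 ≤ B p := fun p => by positivity
  have hαB : ∀ p i, |α p i| ≤ B p := fun p i =>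
    (Finset.single_le_sum (f := fun i => |α p i|) (fun i _ => abs_nonneg _)
      (Finset.mem_univ i)).trans (le_add_of_nonneg_right (by positivity))
  have hγB : ∀ p i, |γ p i| ≤ B p := fun p i =>
    (Finset.single_le_sum (f := fun i => |γ p i|) (fun i _ => abs_nonneg _)
      (Finset.mem_univ i)).trans (le_add_of_nonneg_left (by positivity))
  have hchoose : ∀ k : ℕ, Tendsto (fun p => ((n p - 1).choose k : ℝ) * (n p : ℝ)⁻¹ ^ k) l
      (𝓝 (1 / (k.factorial : ℝ))) := by
    intro k
    have hn1 : Tendsto (fun p => n p - 1) l atTop := (tendsto_sub_atTop_nat 1).comp hn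
    have h1 := (isEquivalent_iff_tendsto_one (by
      filter_upwards [eventually_gt_atTop 0] with m hm
      positivity)).1 (isEquivalent_choose k)
    have h2 := h1.comp hn1
    have h3 : Tendsto (fun p => (1 - (n p : ℝ)⁻¹) ^ k) l (𝓝 1) := by
      have := ((tendsto_inv_atTop_zero.comp (tendsto_natCast_atTop_atTop (R := ℝ).comp hn)).const_sub
        1).pow k
      simpa using this
    have h4 := (h2.mul h3).mul_const (1 / (k.factorial : ℝ))
    rw [one_mul, one_mul] at h4
    refine h4.congr' ?_
    filter_upwards [hn.eventually_ge_atTop 2] with p hp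
    have hnp : (n p : ℝ) ≠ 0 := by positivity
    have hnp1 : ((n p - 1 : ℕ) : ℝ) ≠ 0 := by
      have : 0 < n p - 1 := by omega
      positivity
    have h5 : 1 - (n p : ℝ)⁻¹ = ((n p - 1 : ℕ) : ℝ) * (n p : ℝ)⁻¹ := by
      rw [Nat.cast_sub (by omega)]; push_cast; field_simp
    simp only [Function.comp, Pi.div_apply]
    rw [h5, mul_pow]
    field_simp
  have hentry : ∀ i j : Fin d, Tendsto (fun p => binomialCore (n p - 1) (n p : ℝ)⁻¹ (α p) (γ p) i j)
      l (𝓝 (Matrix.diagonal (fun j : Fin d => 1 / ((j : ℕ).factorial : ℝ)) i j)) := by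
    intro i j
    have h1 : Tendsto (fun p => if i = j then ((n p - 1).choose i : ℝ) * (n p : ℝ)⁻¹ ^ (i : ℕ)
        else 0) l (𝓝 (Matrix.diagonal (fun j : Fin d => 1 / ((j : ℕ).factorial : ℝ)) i j)) := by
      by_cases hij : i = j
      · subst hij; simpa using hchoose i
      · simpa [hij] using tendsto_const_nhds
    have h2 : Tendsto (fun p => binomialCore (n p - 1) (n p : ℝ)⁻¹ (α p) (γ p) i j -
        if i = j then ((n p - 1).choose i : ℝ) * (n p : ℝ)⁻¹ ^ (i : ℕ) else 0) l (𝓝 0) := by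
      have hb : Tendsto (fun p => B p * Real.exp 4) l (𝓝 0) := by
        simpa using hBlim.mul_const (Real.exp 4)
      refine squeeze_zero_norm' ?_ hb
      filter_upwards [hBlim.eventually_le_const (show (0 : ℝ) < 1 by norm_num),
        hn.eventually_ge_atTop 1] with p hp hn1
      exact abs_binomialCore_sub_le (Nat.sub_le _ _) hn1 hp (hB0 p) (hαB p) (hγB p) i j
    simpa using h2.add h1
  have hmat : Tendsto (fun p => binomialCore (n p - 1) (n p : ℝ)⁻¹ (α p) (γ p)) l
      (𝓝 (Matrix.diagonal fun j : Fin d => 1 / ((j : ℕ).factorial : ℝ))) :=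
    tendsto_pi_nhds.2 fun i => tendsto_pi_nhds.2 fun j => hentry i j
  have := ((Continuous.matrix_det continuous_id).tendsto _).comp hmat
  rw [id, Matrix.det_diagonal] at this
  exact this

lemma chi_eq (d : ℕ) : chi d = (√(2 * Real.pi))⁻¹ ^ d *
    ∏ j : Fin d, 1 / ((j : ℕ).factorial : ℝ) := by
  have h1 : (2 * Real.pi) ^ (-(d : ℝ) / 2) = (√(2 * Real.pi))⁻¹ ^ d := by
    rw [Real.sqrt_eq_rpow, ← Real.rpow_neg (by positivity), ← Real.rpow_natCast,
      ← Real.rpow_mul (by positivity)]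
    congr 1; ring
  have h2 : ∏ j ∈ Finset.Icc 1 (d - 1), (j.factorial : ℝ) = ∏ j : Fin d, ((j : ℕ).factorial : ℝ) := by
    rw [← Finset.prod_range fun j => (j.factorial : ℝ)]
    cases d with
    | zero => simp
    | succ d =>
      have h3 : Finset.Icc 1 d = Finset.Ico (0 + 1) (d + 1) := by ext; simp
      rw [Finset.prod_range_succ', Nat.add_sub_cancel, h3,
        ← Finset.prod_Ico_add' (fun j => (j.factorial : ℝ)) 0 d 1]
      rw [Finset.range_eq_Ico, Nat.factorial_zero, Nat.cast_one, mul_one]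
  rw [chi, h1, h2, ← Finset.prod_inv_distrib]
  simp only [one_div]

/-- The exponents `d (d - 1) / 2 + d (d - 1) / 2 + d` add up to `d * d`. -/
lemma prod_pairs_const (d : ℕ) (s : ℝ) :
    (∏ i : Fin d, ∏ _j ∈ Finset.Ioi i, s) * (∏ i : Fin d, ∏ _j ∈ Finset.Ioi i, s) * s ^ d =
      s ^ (d * d) := by
  have h1 : ∏ i : Fin d, ∏ _j ∈ Finset.Ioi i, s = s ^ ∑ i : Fin d, (d - 1 - (i : ℕ)) := by
    rw [← Finset.prod_pow_eq_pow_sum]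
    exact Finset.prod_congr rfl fun i _ => by rw [Finset.prod_const, Fin.card_Ioi]
  have h2 : ∑ i : Fin d, (d - 1 - (i : ℕ)) = ∑ i ∈ Finset.range d, i := by
    rw [← Finset.sum_range fun i => d - 1 - i, Finset.sum_range_reflect (fun i => i)]
  rw [h1, h2, ← pow_add, ← pow_add]
  congr 1
  have h3 := Finset.sum_range_id_mul_two d
  cases d with
  | zero => rfl
  | succ d => rw [Nat.add_sub_cancel] at h3; linarith

/-- The factorization `1 + (z - x) / n = (1 - x / n) (1 + z / n) (1 + α γ / n)` with
`α = √n x / (n - x)` and `γ = √n z / (n + z)`, raised to the power `n - 1`. -/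
lemma gammaDens_natCast_add {n : ℕ} (hn : 1 ≤ n) {x z : ℝ} (hx : |x / n| < 1 / 2)
    (hz : |z / n| < 1 / 2) :
    gammaDens n (n + z - x) = Real.exp (-(n : ℝ)) * (n : ℝ) ^ (n - 1) / ((n - 1).factorial : ℝ) *
      (Real.exp (-(-x)) * (1 + -x / n) ^ (n - 1)) *
      ((Real.exp (-z) * (1 + z / n) ^ (n - 1)) *
      (1 + (n : ℝ)⁻¹ * (√(n : ℝ) * x / (n - x) * (√(n : ℝ) * z / (n + z)))) ^ (n - 1)) := by
  have hn0 : (0 : ℝ) < n := by exact_mod_cast hn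
  rw [abs_div, abs_of_pos hn0, div_lt_iff₀ hn0, abs_lt] at hx hz
  have hx1 : 0 < n - x := by linarith [hx.2]
  have hz1 : 0 < n + z := by linarith [hz.1]
  have hbase : (n : ℝ) + z - x = n * (1 + -x / n) * (1 + z / n) *
      (1 + (n : ℝ)⁻¹ * (√(n : ℝ) * x / (n - x) * (√(n : ℝ) * z / (n + z)))) := by
    have hs : √(n : ℝ) * x / (n - x) * (√(n : ℝ) * z / (n + z)) =
        n * (x * z) / ((n - x) * (n + z)) := by
      rw [div_mul_div_comm]
      congr 1
      calc _ = (√(n : ℝ) * √(n : ℝ)) * (x * z) := by ring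
        _ = _ := by rw [Real.mul_self_sqrt hn0.le]
    rw [hs]
    field_simp
    ring
  obtain ⟨m, rfl⟩ := Nat.exists_eq_add_of_le' hn
  rw [gammaDens, truncPow_succ_of_nonneg m (by linarith [hx.2, hz.1])]
  rw [Nat.add_sub_cancel]
  have hexp : Real.exp (-(((m + 1 : ℕ) : ℝ) + z - x)) =
      Real.exp (-((m + 1 : ℕ) : ℝ)) * Real.exp (-(-x)) * Real.exp (-z) := by
    rw [← Real.exp_add, ← Real.exp_add]; congr 1; ring
  rw [hexp, hbase, mul_pow, mul_pow, mul_pow]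
  ring

/-- Uniform local asymptotics, expressed along a filter: the nodes may depend on `p` as long as
they are of smaller order than `√n`, and they need not be ordered or distinct. -/
theorem exists_tendsto_det_gammaDens {d : ℕ} (hn : Tendsto n l atTop) {x z : ι → Fin d → ℝ}
    (hx : ∀ i, Tendsto (fun p => x p i / √(n p : ℝ)) l (𝓝 0))
    (hz : ∀ i, Tendsto (fun p => z p i / √(n p : ℝ)) l (𝓝 0)) :
    ∃ R : ι → ℝ, Tendsto R l (𝓝 1) ∧ ∀ᶠ p in l,
      (Matrix.of fun i j : Fin d => gammaDens (n p) (n p + z p j - x p i)).det =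
        chi d * vandermonde (x p) * vandermonde (z p) * (√(n p : ℝ))⁻¹ ^ (d * d) * R p := by
  have hxn : ∀ i, Tendsto (fun p => x p i / (n p : ℝ)) l (𝓝 0) := fun i =>
    tendsto_div_natCast hn (hx i)
  have hzn : ∀ i, Tendsto (fun p => z p i / (n p : ℝ)) l (𝓝 0) := fun i =>
    tendsto_div_natCast hn (hz i)
  set S : ι → ℝ := fun p =>
    Real.exp (-(n p : ℝ)) * (n p : ℝ) ^ (n p - 1) / ((n p - 1).factorial : ℝ) with hS
  set a : ι → Fin d → ℝ := fun p i => Real.exp (-(-x p i)) * (1 + -x p i / n p) ^ (n p - 1) with ha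
  set b : ι → Fin d → ℝ := fun p j => Real.exp (-z p j) * (1 + z p j / n p) ^ (n p - 1) with hb
  set α : ι → Fin d → ℝ := fun p i => √(n p : ℝ) * x p i / (n p - x p i) with hα
  set γ : ι → Fin d → ℝ := fun p j => √(n p : ℝ) * z p j / (n p + z p j) with hγ
  set rx : ι → ℝ := fun p => ∏ i : Fin d, ∏ j ∈ Finset.Ioi i,
    ((1 - x p j / n p) * (1 - x p i / n p))⁻¹ with hrx
  set rz : ι → ℝ := fun p => ∏ i : Fin d, ∏ j ∈ Finset.Ioi i,
    ((1 + z p j / n p) * (1 + z p i / n p))⁻¹ with hrz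
  set F : ℝ := ∏ j : Fin d, 1 / ((j : ℕ).factorial : ℝ) with hF
  have hF0 : F ≠ 0 := Finset.prod_ne_zero_iff.2 fun j _ => by positivity
  have hpos : ∀ᶠ p in l, 1 ≤ n p ∧ (∀ i, |x p i / n p| < 1 / 2) ∧ ∀ i, |z p i / n p| < 1 / 2 := by
    refine (hn.eventually_ge_atTop 1).and (.and ?_ ?_)
    · refine eventually_all.2 fun i => ?_
      have := (hxn i).abs
      rw [abs_zero] at this
      exact this.eventually_lt_const (by norm_num)
    · refine eventually_all.2 fun i => ?_
      have := (hzn i).abs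
      rw [abs_zero] at this
      exact this.eventually_lt_const (by norm_num)
  have hαlim : ∀ i, Tendsto (fun p => α p i) l (𝓝 0) := by
    intro i
    have h1 := (hx i).div ((hxn i).const_sub 1) (by norm_num)
    rw [zero_div] at h1
    refine h1.congr' ?_
    filter_upwards [hpos] with p hp
    have hn0 : (0 : ℝ) < n p := by exact_mod_cast hp.1
    have h2 := hp.2.1 i
    rw [abs_div, abs_of_pos hn0, div_lt_iff₀ hn0, abs_lt] at h2
    have h3 : 0 < n p - x p i := by linarith [h2.2]
    have h4 : 1 - x p i / n p = (n p - x p i) / n p := by field_simp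
    have h5 : (n p : ℝ) = √(n p : ℝ) * √(n p : ℝ) := (Real.mul_self_sqrt hn0.le).symm
    have h6 : 0 < √(n p : ℝ) := Real.sqrt_pos.2 hn0
    simp only [Pi.div_apply, h4, hα]
    rw [div_div_div_eq, div_eq_div_iff (by positivity) h3.ne']
    nth_rewrite 1 [h5]
    ring
  have hγlim : ∀ i, Tendsto (fun p => γ p i) l (𝓝 0) := by
    intro i
    have h1 := (hz i).div ((hzn i).const_add 1) (by norm_num)
    rw [zero_div] at h1
    refine h1.congr' ?_
    filter_upwards [hpos] with p hp
    have hn0 : (0 : ℝ) < n p := by exact_mod_cast hp.1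
    have h2 := hp.2.2 i
    rw [abs_div, abs_of_pos hn0, div_lt_iff₀ hn0, abs_lt] at h2
    have h3 : 0 < n p + z p i := by linarith [h2.1]
    have h4 : 1 + z p i / n p = (n p + z p i) / n p := by field_simp
    have h5 : (n p : ℝ) = √(n p : ℝ) * √(n p : ℝ) := (Real.mul_self_sqrt hn0.le).symm
    have h6 : 0 < √(n p : ℝ) := Real.sqrt_pos.2 hn0
    simp only [Pi.div_apply, h4, hγ]
    rw [div_div_div_eq, div_eq_div_iff (by positivity) h3.ne']
    nth_rewrite 1 [h5]
    ring
  refine ⟨fun p => (S p * √(2 * Real.pi * n p)) ^ d * (∏ i, a p i) * (∏ j, b p j) * rx p * rz p *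
    ((binomialCore (n p - 1) (n p : ℝ)⁻¹ (α p) (γ p)).det * F⁻¹), ?_, ?_⟩
  · have h1 := (tendsto_stirling hn).pow d
    have h2 : Tendsto (fun p => ∏ i, a p i) l (𝓝 (∏ _i : Fin d, 1)) :=
      tendsto_finsetProd _ fun i _ => tendsto_exp_neg_mul_one_add_div_pow (u := fun p => -x p i) hn
        (by simpa [neg_div] using (hx i).neg)
    have h3 : Tendsto (fun p => ∏ i, b p i) l (𝓝 (∏ _i : Fin d, 1)) :=
      tendsto_finsetProd _ fun i _ => tendsto_exp_neg_mul_one_add_div_pow hn (hz i)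
    have h4 : Tendsto rx l (𝓝 (∏ i : Fin d, ∏ _j ∈ Finset.Ioi i, ((1 - 0) * (1 - 0) : ℝ)⁻¹)) :=
      tendsto_finsetProd _ fun i _ => tendsto_finsetProd _ fun j _ =>
        (((hxn j).const_sub 1).mul ((hxn i).const_sub 1)).inv₀ (by norm_num)
    have h5 : Tendsto rz l (𝓝 (∏ i : Fin d, ∏ _j ∈ Finset.Ioi i, ((1 + 0) * (1 + 0) : ℝ)⁻¹)) :=
      tendsto_finsetProd _ fun i _ => tendsto_finsetProd _ fun j _ =>
        (((hzn j).const_add 1).mul ((hzn i).const_add 1)).inv₀ (by norm_num)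
    have h6 := (tendsto_binomialCore_det hn hαlim hγlim).mul_const F⁻¹
    have h7 := ((((h1.mul h2).mul h3).mul h4).mul h5).mul h6
    convert h7 using 2
    rw [← hF, mul_inv_cancel₀ hF0]
    simp
  · filter_upwards [hpos] with p hp
    have hn0 : (0 : ℝ) < n p := by exact_mod_cast hp.1
    set s := (√(n p : ℝ))⁻¹ with hs
    have hs0 : 0 < √(n p : ℝ) := Real.sqrt_pos.2 hn0
    have hss : √(n p : ℝ) * √(n p : ℝ) = n p := Real.mul_self_sqrt hn0.le
    have hxpos : ∀ i, 0 < n p - x p i := fun i => by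
      have h2 := hp.2.1 i
      rw [abs_div, abs_of_pos hn0, div_lt_iff₀ hn0, abs_lt] at h2
      linarith [h2.2]
    have hzpos : ∀ i, 0 < n p + z p i := fun i => by
      have h2 := hp.2.2 i
      rw [abs_div, abs_of_pos hn0, div_lt_iff₀ hn0, abs_lt] at h2
      linarith [h2.1]
    have hVx : vandermonde (α p) = vandermonde (x p) *
        (∏ i : Fin d, ∏ _j ∈ Finset.Ioi i, s) * rx p := by
      simp only [vandermonde, hrx, ← Finset.prod_mul_distrib]
      refine Finset.prod_congr rfl fun i _ => Finset.prod_congr rfl fun j _ => ?_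
      have hi := hxpos i
      have hj := hxpos j
      have hi' : 1 - x p i / n p = (n p - x p i) / n p := by field_simp
      have hj' : 1 - x p j / n p = (n p - x p j) / n p := by field_simp
      rw [hi', hj']
      simp only [hα, hs]
      field_simp
      rw [show √(n p : ℝ) ^ 2 = n p by rw [sq, hss]]
      ring
    have hVz : vandermonde (γ p) = vandermonde (z p) *
        (∏ i : Fin d, ∏ _j ∈ Finset.Ioi i, s) * rz p := by
      simp only [vandermonde, hrz, ← Finset.prod_mul_distrib]
      refine Finset.prod_congr rfl fun i _ => Finset.prod_congr rfl fun j _ => ?_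
      have hi := hzpos i
      have hj := hzpos j
      have hi' : 1 + z p i / n p = (n p + z p i) / n p := by field_simp
      have hj' : 1 + z p j / n p = (n p + z p j) / n p := by field_simp
      rw [hi', hj']
      simp only [hγ, hs]
      field_simp
      rw [show √(n p : ℝ) ^ 2 = n p by rw [sq, hss]]
      ring
    have hdet : (Matrix.of fun i j : Fin d => gammaDens (n p) (n p + z p j - x p i)).det =
        (∏ i, (S p * a p i)) * ((∏ j, b p j) *
          (Matrix.of fun i j : Fin d => (1 + (n p : ℝ)⁻¹ * (α p i * γ p j)) ^ (n p - 1)).det) := by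
      rw [← Matrix.det_mul_row, ← Matrix.det_mul_column]
      congr 1
      ext i j
      exact gammaDens_natCast_add hp.1 (hp.2.1 i) (hp.2.2 j)
    have hsq : √(2 * Real.pi * n p) = √(2 * Real.pi) * √(n p : ℝ) :=
      Real.sqrt_mul (by positivity) _
    have h2pi : 0 < √(2 * Real.pi) := Real.sqrt_pos.2 (by positivity)
    have hSd : S p ^ d = (S p * √(2 * Real.pi * n p)) ^ d * ((√(2 * Real.pi))⁻¹ ^ d * s ^ d) := by
      rw [← mul_pow, ← mul_pow, hsq, hs]
      congr 1
      field_simp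
    rw [hdet, det_one_add_mul_pow, hVx, hVz, Finset.prod_mul_distrib, Finset.prod_const,
      Finset.card_univ, Fintype.card_fin, hSd, chi_eq, ← prod_pairs_const d s, ← hF]
    generalize (∏ i : Fin d, ∏ _j ∈ Finset.Ioi i, s) = q
    generalize (binomialCore (n p - 1) (n p : ℝ)⁻¹ (α p) (γ p)).det = M
    generalize (∏ i, a p i) = A
    generalize (∏ j, b p j) = B
    generalize (S p * √(2 * Real.pi * n p)) ^ d = T
    generalize (√(2 * Real.pi))⁻¹ ^ d = U
    generalize s ^ d = V
    have hF1 : F * F⁻¹ = 1 := mul_inv_cancel₀ hF0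
    generalize F⁻¹ = F' at hF1 ⊢
    generalize rx p = r
    generalize rz p = r'
    linear_combination (-(T * U * V * A * B * q ^ 2 * M * r * r' * vandermonde (x p) *
      vandermonde (z p))) * hF1

end LocalLimit

/-! ### Convolution and moments of Gamma laws -/

lemma lintegral_gammaDens_mul {k : ℕ} (hk : 1 ≤ k) (u : ℝ) :
    ∫⁻ y, ENNReal.ofReal (gammaDens k y) * ENNReal.ofReal (gammaDens 1 (u - y)) =
      ENNReal.ofReal (gammaDens (k + 1) u) := by
  have h1 : ∀ y, ENNReal.ofReal (gammaDens k y) * ENNReal.ofReal (gammaDens 1 (u - y)) =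
      (Set.Iic u).indicator (fun y => ENNReal.ofReal (Real.exp (-u) * truncPow k (y - 0))) y := by
    intro y
    by_cases hy : y ≤ u
    · rw [Set.indicator_of_mem (show y ∈ Set.Iic u from hy), gammaDens_one_of_nonneg (by linarith),
        ← ENNReal.ofReal_mul (gammaDens_nonneg k y), gammaDens, sub_zero, mul_right_comm,
        ← Real.exp_add]
      congr 3; ring
    · rw [Set.indicator_of_notMem (show y ∉ Set.Iic u from hy), gammaDens_of_neg 1 (by linarith)]
      simp
  simp only [h1]
  rw [lintegral_indicator measurableSet_Iic, ← ofReal_integral_eq_lintegral_ofReal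
    ((integrableOn_Iic_truncPow k 0 u).const_mul _)
    (ae_of_all _ fun y => mul_nonneg (Real.exp_pos _).le (truncPow_nonneg _ _)),
    integral_const_mul, integral_Iic_truncPow hk, sub_zero, gammaDens]

lemma etaLaw_zero : etaLaw 0 = Measure.dirac 0 := by simp [etaLaw]

lemma etaLaw_of_pos {k : ℕ} (hk : 1 ≤ k) :
    etaLaw k = volume.withDensity fun u => ENNReal.ofReal (gammaDens k u) := by
  rw [etaLaw, if_neg (by omega), gammaMeasure_eq_withDensity hk]

/-- The Gamma law of shape `k + 1` is a convolution; for `k = 0` the other factor is a point mass. -/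
lemma etaLaw_succ (k : ℕ) : etaLaw (k + 1) = (expMeasure 1).conv (etaLaw k) := by
  rw [Measure.conv_comm]
  rcases Nat.eq_zero_or_pos k with rfl | hk
  · rw [etaLaw_zero, Measure.dirac_zero_conv, etaLaw_of_pos le_rfl, expMeasure_eq_withDensity]
  · rw [etaLaw_of_pos (show 1 ≤ k + 1 by omega), etaLaw_of_pos hk, expMeasure_eq_withDensity,
      conv_withDensity_eq_lconvolution (by fun_prop) (by fun_prop)]
    congr 1
    funext u
    rw [lconvolution_def, ← lintegral_gammaDens_mul hk]
    refine lintegral_congr fun y => ?_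
    rw [neg_add_eq_sub]

lemma integral_expMeasure (F : ℝ → ℝ) :
    ∫ t, F t ∂(expMeasure 1) = ∫ t in Set.Ioi 0, Real.exp (-t) * F t := by
  rw [expMeasure_eq_withDensity, integral_withDensity_eq_integral_toReal_smul (by fun_prop)
    (ae_of_all _ fun _ => ENNReal.ofReal_lt_top), ← integral_indicator measurableSet_Ioi]
  refine integral_congr_ae ?_
  have : ∀ᵐ t : ℝ, t ≠ 0 := by simp [ae_iff]
  filter_upwards [this] with t ht
  rw [ENNReal.toReal_ofReal (gammaDens_nonneg _ _), smul_eq_mul]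
  rcases lt_or_gt_of_ne ht with h | h
  · rw [gammaDens_of_neg 1 h, Set.indicator_of_notMem (by simpa using h.le), zero_mul]
  · rw [gammaDens_one_of_nonneg h.le, Set.indicator_of_mem (show t ∈ Set.Ioi 0 from h)]

lemma integrable_expMeasure_iff (F : ℝ → ℝ) :
    Integrable F (expMeasure 1) ↔ IntegrableOn (fun t => Real.exp (-t) * F t) (Set.Ioi 0) := by
  rw [expMeasure_eq_withDensity, integrable_withDensity_iff (by fun_prop)
    (ae_of_all _ fun _ => ENNReal.ofReal_lt_top), ← integrable_indicator_iff measurableSet_Ioi]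
  refine integrable_congr ?_
  have : ∀ᵐ t : ℝ, t ≠ 0 := by simp [ae_iff]
  filter_upwards [this] with t ht
  rw [ENNReal.toReal_ofReal (gammaDens_nonneg _ _)]
  rcases lt_or_gt_of_ne ht with h | h
  · rw [gammaDens_of_neg 1 h, Set.indicator_of_notMem (by simpa using h.le), mul_zero]
  · rw [gammaDens_one_of_nonneg h.le, Set.indicator_of_mem (show t ∈ Set.Ioi 0 from h), mul_comm]

lemma integral_gammaDens_sub_expMeasure {m : ℕ} (hm : 1 ≤ m) (u : ℝ) :
    ∫ t, gammaDens m (u - t) ∂(expMeasure 1) = gammaDens (m + 1) u := by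
  rw [integral_eq_lintegral_of_nonneg_ae (ae_of_all _ fun t => gammaDens_nonneg _ _)
    (by fun_prop : Measurable _).aestronglyMeasurable, expMeasure_eq_withDensity,
    lintegral_withDensity_eq_lintegral_mul _ (by fun_prop) (by fun_prop),
    ← lintegral_sub_left_eq_self _ u]
  simp only [Pi.mul_apply, sub_sub_cancel]
  simp only [mul_comm (ENNReal.ofReal (gammaDens 1 _))]
  rw [lintegral_gammaDens_mul hm, ENNReal.toReal_ofReal (gammaDens_nonneg _ _)]

lemma integrable_gammaDens_sub (m : ℕ) (u : ℝ) (μ : Measure ℝ) [IsFiniteMeasure μ] :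
    Integrable (fun t => gammaDens m (u - t)) μ := by
  refine Integrable.of_bound (by fun_prop : Measurable _).aestronglyMeasurable 1
    (ae_of_all _ fun t => ?_)
  rw [Real.norm_of_nonneg (gammaDens_nonneg _ _)]
  exact gammaDens_le_one _ _

lemma integral_gammaDens_sub_etaLaw {m : ℕ} (hm : 1 ≤ m) (k : ℕ) (u : ℝ) :
    ∫ y, gammaDens m (u - y) ∂(etaLaw k) = gammaDens (m + k) u := by
  induction k generalizing m u with
  | zero => rw [etaLaw_zero, integral_dirac, sub_zero, add_zero]
  | succ k ih =>
    rw [etaLaw_succ, integral_conv (integrable_gammaDens_sub _ _ _)]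
    simp only [← sub_sub]
    simp only [ih hm]
    rw [integral_gammaDens_sub_expMeasure (by omega)]
    rfl

lemma integrable_abs_pow_etaLaw (K k : ℕ) : Integrable (fun y => |y| ^ K) (etaLaw k) := by
  rcases Nat.eq_zero_or_pos k with rfl | hk
  · rw [etaLaw_zero]; exact integrable_dirac (by simp)
  · rw [etaLaw_of_pos hk, integrable_withDensity_iff (by fun_prop)
      (ae_of_all _ fun _ => ENNReal.ofReal_lt_top)]
    obtain ⟨k, rfl⟩ := Nat.exists_eq_add_of_le' hk
    have h := (integrable_gammaDens (k + K + 1)).const_mul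
      (((k + K).factorial : ℝ) / (k.factorial : ℝ))
    refine h.congr (ae_of_all _ fun y => ?_)
    simp only
    rw [ENNReal.toReal_ofReal (gammaDens_nonneg _ _)]
    simp only [gammaDens, truncPow_succ]
    split_ifs with hy
    · rw [abs_of_nonneg hy, pow_add]
      have h1 : ((k + K).factorial : ℝ) ≠ 0 := by positivity
      have h2 : (k.factorial : ℝ) ≠ 0 := by positivity
      field_simp
    · simp

lemma integrable_one_add_abs_pow_etaLaw (K k : ℕ) :
    Integrable (fun y => (1 + |y|) ^ K) (etaLaw k) := by
  simp only [add_pow, one_pow, one_mul]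
  exact integrable_finsetSum _ fun m _ => (integrable_abs_pow_etaLaw _ _).mul_const _

/-- The moment `E (x + η)^i` with `η` distributed according to `etaLaw k`. -/
noncomputable def etaMoment (k i : ℕ) (x : ℝ) : ℝ := ∫ y, (x + y) ^ i ∂(etaLaw k)

lemma integrable_add_pow_etaLaw (k i : ℕ) (x : ℝ) :
    Integrable (fun y => (x + y) ^ i) (etaLaw k) := by
  refine ((integrable_one_add_abs_pow_etaLaw i k).const_mul ((1 + |x|) ^ i)).mono'
    (by fun_prop) (ae_of_all _ fun y => ?_)
  rw [norm_pow, Real.norm_eq_abs, ← mul_pow]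
  have := abs_add_le x y
  gcongr
  nlinarith [abs_nonneg x, abs_nonneg y]

lemma etaMoment_zero (i : ℕ) (x : ℝ) : etaMoment 0 i x = x ^ i := by
  rw [etaMoment, etaLaw_zero, integral_dirac, add_zero]

lemma integrable_etaMoment_expMeasure (k i : ℕ) (x : ℝ) :
    Integrable (fun t => etaMoment k i (x + t)) (expMeasure 1) := by
  have h := integrable_add_pow_etaLaw (k + 1) i x
  rw [etaLaw_succ, Measure.conv, integrable_map_measure (by fun_prop) (by fun_prop)] at h
  refine h.integral_prod_left.congr (ae_of_all _ fun t => ?_)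
  simp [etaMoment, Function.comp, add_assoc]

lemma integrableOn_etaMoment (k i : ℕ) (x : ℝ) :
    IntegrableOn (fun t => Real.exp (-t) * etaMoment k i (x + t)) (Set.Ioi 0) :=
  (integrable_expMeasure_iff _).1 (integrable_etaMoment_expMeasure k i x)

lemma etaMoment_succ (k i : ℕ) (x : ℝ) :
    etaMoment (k + 1) i x = ∫ t in Set.Ioi 0, Real.exp (-t) * etaMoment k i (x + t) := by
  have h := integrable_add_pow_etaLaw (k + 1) i x
  rw [etaMoment, etaLaw_succ] at *
  rw [integral_conv h, ← integral_expMeasure]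
  simp only [etaMoment, add_assoc]

/-- The lack of memory of the exponential law. -/
lemma integral_Ioi_etaMoment (k i : ℕ) (x g : ℝ) :
    ∫ t in Set.Ioi g, Real.exp (-t) * etaMoment k i (x + t) =
      Real.exp (-g) * etaMoment (k + 1) i (x + g) := by
  rw [etaMoment_succ, ← integral_const_mul, ← integral_indicator measurableSet_Ioi,
    ← integral_indicator measurableSet_Ioi,
    ← integral_add_right_eq_self ((Set.Ioi g).indicator _) g]
  refine integral_congr_ae (ae_of_all _ fun t => ?_)
  simp only [Set.indicator, Set.mem_Ioi]
  by_cases ht : 0 < t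
  · rw [if_pos (by linarith), if_pos ht, ← mul_assoc, ← Real.exp_add]
    congr 2 <;> ring
  · rw [if_neg (by linarith), if_neg ht]

/-! ### Lower bound for the harmonic function -/

/-- The determinant `E det ((x_j + η_j) ^ i)` with independent `η_j` of laws `etaLaw (lev j)`. It
interpolates between `vandermonde` (all levels `0`) and `h` (level `j` in column `j`). -/
noncomputable def levelDet {d : ℕ} (lev : Fin d → ℕ) (x : Fin d → ℝ) : ℝ :=
  (Matrix.of fun i j : Fin d => etaMoment (lev j) i (x j)).det

lemma vandermonde_eq_det {d : ℕ} (x : Fin d → ℝ) :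
    vandermonde x = (Matrix.of fun i j : Fin d => x i ^ (j : ℕ)).det :=
  (Matrix.det_vandermonde x).symm

lemma levelDet_zero {d : ℕ} (x : Fin d → ℝ) : levelDet (fun _ => 0) x = vandermonde x := by
  rw [vandermonde_eq_det, levelDet, ← Matrix.det_transpose]
  simp only [etaMoment_zero]
  rfl

lemma h_eq_levelDet {d : ℕ} (x : Fin d → ℝ) : h x = levelDet (fun j => (j : ℕ)) x := by
  have key := integral_det_pi (fun j : Fin d => etaLaw j)
    (fun i y j => (x i + y) ^ (j : ℕ)) fun i j => integrable_add_pow_etaLaw _ _ _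
  rw [h, levelDet, ← Matrix.det_transpose]
  simp only [vandermonde_eq_det]
  exact key.2

lemma levelDet_update {d : ℕ} (lev : Fin d → ℕ) (x : Fin d → ℝ) (J : Fin d) (m : ℕ) (w : ℝ) :
    levelDet (Function.update lev J m) (Function.update x J w) =
      ((Matrix.of fun i j : Fin d => etaMoment (lev j) i (x j)).updateCol J
        fun i => etaMoment m i w).det := by
  unfold levelDet
  congr 1
  ext i j
  rw [Matrix.updateCol_apply]
  by_cases hj : j = J
  · subst hj; simp
  · simp [hj]

/-- The values of `t` for which moving `x_J` by `t` does not overtake `x_{J+1}`. -/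
def raiseSet {d : ℕ} (x : Fin d → ℝ) (J : Fin d) : Set ℝ :=
  {t | 0 < t ∧ ∀ J' : Fin d, (J' : ℕ) = J + 1 → x J + t ≤ x J'}

/-- Raising the level of column `J` is averaging over an exponential displacement of `x_J`. If the
next column is one level higher, displacements beyond `x_{J+1}` contribute nothing: by the lack of
memory they produce two equal columns. -/
lemma levelDet_raise {d : ℕ} (lev : Fin d → ℕ) {x : Fin d → ℝ} (hx : Monotone x) (J : Fin d)
    (hlev : ∀ J' : Fin d, (J' : ℕ) = J + 1 → lev J' = lev J + 1) :
    IntegrableOn (fun t => Real.exp (-t) * levelDet lev (Function.update x J (x J + t)))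
      (raiseSet x J) ∧
    levelDet (Function.update lev J (lev J + 1)) x =
      ∫ t in raiseSet x J, Real.exp (-t) * levelDet lev (Function.update x J (x J + t)) := by
  set B : Matrix (Fin d) (Fin d) ℝ := Matrix.of fun i j : Fin d => etaMoment (lev j) i (x j) with hB
  have hval : ∀ t, Real.exp (-t) * levelDet lev (Function.update x J (x J + t)) =
      (B.updateCol J fun i => Real.exp (-t) * etaMoment (lev J) i (x J + t)).det := by
    intro t
    have := levelDet_update lev x J (lev J) (x J + t)
    rw [Function.update_eq_self] at this
    rw [this, det_updateCol_eq_sum, det_updateCol_eq_sum, Finset.mul_sum]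
    exact Finset.sum_congr rfl fun i _ => by ring
  have hlhs : levelDet (Function.update lev J (lev J + 1)) x =
      (B.updateCol J fun i => etaMoment (lev J + 1) i (x J)).det := by
    have := levelDet_update lev x J (lev J + 1) (x J)
    rwa [Function.update_eq_self] at this
  have h0 := integral_det_updateCol B J (Set.Ioi 0)
    (fun i t => Real.exp (-t) * etaMoment (lev J) i (x J + t))
    fun i => integrableOn_etaMoment _ _ _
  simp only [← etaMoment_succ, ← hval, ← hlhs] at h0
  have hsub : raiseSet x J ⊆ Set.Ioi 0 := fun t ht => ht.1
  refine ⟨h0.1.mono_set hsub, ?_⟩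
  by_cases hJ : (J : ℕ) + 1 < d
  · set J' : Fin d := ⟨J + 1, hJ⟩ with hJ'
    have hJJ' : J < J' := by rw [Fin.lt_def]; simp [hJ']
    set g := x J' - x J with hg
    have hg0 : 0 ≤ g := sub_nonneg.2 (hx hJJ'.le)
    have hset : raiseSet x J = Set.Ioc 0 g := by
      ext t
      simp only [raiseSet, Set.mem_ofPred_eq, Set.mem_Ioc]
      refine and_congr_right fun _ => ⟨fun h => ?_, fun h K hK => ?_⟩
      · have := h J' rfl
        linarith
      · obtain rfl : K = J' := Fin.ext hK
        linarith
    have hIoi : Set.Ioi (0 : ℝ) = Set.Ioc 0 g ∪ Set.Ioi g := (Set.Ioc_union_Ioi_eq_Ioi hg0).symm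
    have hgsub : Set.Ioi g ⊆ Set.Ioi (0 : ℝ) := Set.Ioi_subset_Ioi hg0
    have h1 := integral_det_updateCol B J (Set.Ioi g)
      (fun i t => Real.exp (-t) * etaMoment (lev J) i (x J + t))
      fun i => (integrableOn_etaMoment _ _ _).mono_set hgsub
    have hzero : (B.updateCol J fun i => Real.exp (-g) * etaMoment (lev J + 1) i (x J + g)).det
        = 0 := by
      have h2 : (B.updateCol J fun i => Real.exp (-g) * etaMoment (lev J + 1) i (x J + g)).det =
          Real.exp (-g) * (B.updateCol J fun i => B i J').det := by
        rw [det_updateCol_eq_sum, det_updateCol_eq_sum, Finset.mul_sum]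
        refine Finset.sum_congr rfl fun i _ => ?_
        simp only [hB, Matrix.of_apply]
        rw [hlev J' rfl, hg, add_sub_cancel]
        ring
      rw [h2, Matrix.det_zero_of_column_eq hJJ'.ne fun i => ?_, mul_zero]
      rw [Matrix.updateCol_self, Matrix.updateCol_ne hJJ'.ne']
    simp only [integral_Ioi_etaMoment, hzero, ← hval] at h1
    rw [← h0.2, hset, hIoi, setIntegral_union (Set.Ioc_disjoint_Ioi le_rfl) measurableSet_Ioi
      (h0.1.mono_set (by rw [hIoi]; exact Set.subset_union_left)) h1.1, h1.2, add_zero]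
  · have hset : raiseSet x J = Set.Ioi 0 := by
      ext t
      simp only [raiseSet, Set.mem_ofPred_eq, Set.mem_Ioi, and_iff_left_iff_imp]
      intro _ K hK
      have := K.2
      omega
    rw [hset, h0.2]

lemma measurableSet_raiseSet {d : ℕ} (x : Fin d → ℝ) (J : Fin d) :
    MeasurableSet (raiseSet x J) := by
  simp only [raiseSet, Set.ofPred_and, Set.ofPred_forall]
  exact measurableSet_Ioi.inter (MeasurableSet.iInter fun _ => MeasurableSet.iInter fun _ =>
    measurableSet_le (by fun_prop) (by fun_prop))

lemma monotone_update_of_mem_raiseSet {d : ℕ} {x : Fin d → ℝ} (hx : Monotone x) {J : Fin d} {t : ℝ}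
    (ht : t ∈ raiseSet x J) : Monotone (Function.update x J (x J + t)) := by
  intro i j hij
  rcases eq_or_ne i J with rfl | hi
  · rcases eq_or_ne j i with rfl | hj
    · exact le_rfl
    · have hlt : i < j := lt_of_le_of_ne hij hj.symm
      have hd : (i : ℕ) + 1 < d := lt_of_le_of_lt (Nat.succ_le_of_lt hlt) j.2
      rw [Function.update_self, Function.update_of_ne hj]
      exact (ht.2 ⟨i + 1, hd⟩ rfl).trans (hx (Nat.succ_le_of_lt hlt))
  · rw [Function.update_of_ne hi]
    rcases eq_or_ne j J with rfl | hj
    · rw [Function.update_self]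
      linarith [hx hij, ht.1]
    · rw [Function.update_of_ne hj]
      exact hx hij

/-- The levels in the `k`-th round, when the columns `k, ..., j - 1` have been raised: the round
begins with the levels `i - k` and ends with the levels `i - (k - 1)`. -/
def roundLevel {d : ℕ} (k j : ℕ) (i : Fin d) : ℕ := (i - k) + if k ≤ i ∧ (i : ℕ) < j then 1 else 0

lemma roundLevel_start {d k : ℕ} : (roundLevel k k : Fin d → ℕ) = roundLevel (k + 1) d := by
  funext i
  have := i.2
  simp only [roundLevel]
  split_ifs <;> omega

lemma roundLevel_succ {d k : ℕ} {J : Fin d} (hk : k ≤ J) :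
    (roundLevel k (J + 1) : Fin d → ℕ) =
      Function.update (roundLevel k J) J (roundLevel k J J + 1) := by
  funext i
  by_cases hi : i = J
  · subst hi
    rw [Function.update_self]
    simp only [roundLevel]
    split_ifs <;> omega
  · have : (i : ℕ) ≠ J := fun h => hi (Fin.ext h)
    rw [Function.update_of_ne hi]
    simp only [roundLevel]
    split_ifs <;> omega

lemma roundLevel_next {d k : ℕ} {J : Fin d} (hk : k ≤ J) (J' : Fin d) (hJ' : (J' : ℕ) = J + 1) :
    roundLevel k J J' = roundLevel k J J + 1 := by
  simp only [roundLevel]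
  split_ifs <;> omega

/-- Nonnegativity propagates through a round, and from one round to the next. -/
lemma levelDet_nonneg {d k j : ℕ} (hkj : k ≤ j) (hj : j ≤ d) {x : Fin d → ℝ} (hx : Monotone x) :
    0 ≤ levelDet (roundLevel k j) x := by
  have hkd : k ≤ d := hkj.trans hj
  induction hkd using Nat.decreasingInduction generalizing j x with
  | self =>
    obtain rfl : j = d := le_antisymm hj hkj
    have h1 : (roundLevel j j : Fin j → ℕ) = fun _ => 0 := by
      funext i
      have := i.2
      simp only [roundLevel]
      split_ifs <;> omega
    rw [h1, levelDet_zero]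
    exact Finset.prod_nonneg fun i _ => Finset.prod_nonneg fun j hj =>
      sub_nonneg.2 (hx (Finset.mem_Ioi.1 hj).le)
  | of_succ k hk ih =>
    induction j, hkj using Nat.le_induction generalizing x with
    | base => rw [roundLevel_start]; exact ih hk le_rfl hx
    | succ j hkj ihj =>
      have := roundLevel_succ (J := ⟨j, hj⟩) hkj
      rw [this, (levelDet_raise _ hx _ (roundLevel_next hkj)).2]
      exact setIntegral_nonneg (measurableSet_raiseSet _ _) fun t ht =>
        mul_nonneg (Real.exp_pos _).le
          (ihj (by omega) (monotone_update_of_mem_raiseSet hx ht))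

/-- The product of the gaps, those below the particles `k, k + 1, ...` being enlarged by `1`. -/
noncomputable def gapProd {d : ℕ} (k : ℕ) (y : Fin d → ℝ) : ℝ :=
  ∏ i : Fin d, ∏ j ∈ Finset.Ioi i, (y j - y i + if k ≤ (j : ℕ) then 1 else 0)

lemma gapProd_nonneg {d : ℕ} (k : ℕ) {y : Fin d → ℝ} (hy : Monotone y) : 0 ≤ gapProd k y :=
  Finset.prod_nonneg fun i _ => Finset.prod_nonneg fun j hj =>
    add_nonneg (sub_nonneg.2 (hy (Finset.mem_Ioi.1 hj).le)) (by split_ifs <;> norm_num)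

/-- `x` arises from `y` by moving the particle `i` by an amount in `[i, i + 1/2]`, for `i ≥ j`. These
displacements are at least `1/2` further apart for distinct particles, so they preserve the order and
open the gaps. -/
def IsShifted {d : ℕ} (j : ℕ) (y x : Fin d → ℝ) : Prop :=
  (∀ i : Fin d, (i : ℕ) < j → x i = y i) ∧
    ∀ i : Fin d, j ≤ i → y i + i ≤ x i ∧ x i ≤ y i + i + 1 / 2

lemma IsShifted.monotone {d j : ℕ} {y x : Fin d → ℝ} (hy : Monotone y) (h : IsShifted j y x) :
    Monotone x := by
  intro a b hab
  have hyab := hy hab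
  rcases eq_or_lt_of_le hab with rfl | hlt
  · exact le_rfl
  have hab' : ((a : ℕ) : ℝ) + 1 ≤ (b : ℕ) := by exact_mod_cast Fin.lt_def.1 hlt
  have ha0 : (0 : ℝ) ≤ ((a : ℕ) : ℝ) := Nat.cast_nonneg _
  have hlt' := Fin.lt_def.1 hlt
  rcases Nat.lt_or_ge a j with ha | ha <;> rcases Nat.lt_or_ge b j with hb | hb
  · rw [h.1 a ha, h.1 b hb]; exact hyab
  · rw [h.1 a ha]; linarith [(h.2 b hb).1]
  · omega
  · linarith [(h.2 b hb).1, (h.2 a ha).2]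

/-- Passing to the next round uses that the shift moves particle `j` by at least `1/2` more than
the particles below it and, for `j = k`, by at least `1`. -/
lemma gapProd_le_of_isShifted {d k : ℕ} (hk : 1 ≤ k) {y x : Fin d → ℝ} (hy : Monotone y)
    (h : IsShifted k y x) : gapProd k y ≤ gapProd (k + 1) x := by
  refine Finset.prod_le_prod (fun i _ => Finset.prod_nonneg fun j hj =>
    add_nonneg (sub_nonneg.2 (hy (Finset.mem_Ioi.1 hj).le)) (by split_ifs <;> norm_num)) fun i _ =>
    Finset.prod_le_prod (fun j hj =>
      add_nonneg (sub_nonneg.2 (hy (Finset.mem_Ioi.1 hj).le)) (by split_ifs <;> norm_num))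
      fun j hj => ?_
  have hij := Fin.lt_def.1 (Finset.mem_Ioi.1 hj)
  have hij' : ((i : ℕ) : ℝ) + 1 ≤ (j : ℕ) := by exact_mod_cast hij
  have hk' : (1 : ℝ) ≤ (k : ℝ) := by exact_mod_cast hk
  have hj0 : (0 : ℝ) ≤ ((j : ℕ) : ℝ) := Nat.cast_nonneg _
  rcases Nat.lt_trichotomy (j : ℕ) k with hjk | hjk | hjk
  · rw [if_neg (by omega), if_neg (by omega), h.1 i (by omega), h.1 j (by omega)]
  · rw [if_pos (by omega), if_neg (by omega), h.1 i (by omega)]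
    have h1 := (h.2 j (by omega)).1
    have h2 : ((j : ℕ) : ℝ) = k := by exact_mod_cast hjk
    linarith
  · rw [if_pos (by omega), if_pos (by omega)]
    have h1 := (h.2 j (by omega)).1
    rcases Nat.lt_or_ge i k with hik | hik
    · rw [h.1 i hik]; linarith
    · linarith [(h.2 i hik).2]

/-- The lower bound is propagated along the rounds by restricting the displacement of particle `j` to
`[j, j + 1/2]`; the particles above it have been displaced by at least `j + 1`, so the order is
preserved. -/
lemma exists_gapProd_le_levelDet {d k j : ℕ} (hk : 1 ≤ k) (hkj : k ≤ j) (hj : j ≤ d) :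
    ∃ c : ℝ, 0 < c ∧ ∀ y : Fin d → ℝ, Monotone y → ∀ x, IsShifted j y x →
      c * gapProd k y ≤ levelDet (roundLevel k j) x := by
  have hkd : k ≤ d := hkj.trans hj
  induction hkd using Nat.decreasingInduction generalizing j with
  | self =>
    obtain rfl : j = d := le_antisymm hj hkj
    refine ⟨1, one_pos, fun y hy x hx => ?_⟩
    have h1 : (roundLevel j j : Fin j → ℕ) = fun _ => 0 := by
      funext i
      have := i.2
      simp only [roundLevel]
      split_ifs <;> omega
    have hxy : x = y := funext fun i => hx.1 i i.2
    rw [h1, levelDet_zero, one_mul, hxy, gapProd, vandermonde]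
    refine le_of_eq (Finset.prod_congr rfl fun a _ => Finset.prod_congr rfl fun b _ => ?_)
    rw [if_neg (by have := b.2; omega), add_zero]
  | of_succ k hk' ih =>
    induction j, hkj using Nat.le_induction with
    | base =>
      obtain ⟨c, hc, hle⟩ := ih (by omega) hk' le_rfl
      refine ⟨c, hc, fun y hy x hx => ?_⟩
      rw [roundLevel_start]
      refine le_trans ?_ (hle x (hx.monotone hy) x ⟨fun _ _ => rfl, fun i hi => ?_⟩)
      · exact mul_le_mul_of_nonneg_left (gapProd_le_of_isShifted hk hy hx) hc.le
      · have := i.2; omega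
    | succ j hkj ihj =>
      obtain ⟨c, hc, hle⟩ := ihj (by omega)
      set J : Fin d := ⟨j, hj⟩ with hJ
      refine ⟨c * (Real.exp (-((j : ℝ) + 1 / 2)) * (1 / 2)), by positivity, fun y hy x hx => ?_⟩
      have hxm := hx.monotone hy
      have hraise := levelDet_raise (roundLevel k j) hxm J (roundLevel_next (J := J) hkj)
      have hlev := roundLevel_succ (J := J) hkj
      have hxJ : x J = y J := hx.1 J (by simp [hJ])
      have hI : Set.Ioc (j : ℝ) (j + 1 / 2) ⊆ raiseSet x J := by
        intro t ht
        have hj0 : (0 : ℝ) ≤ (j : ℝ) := Nat.cast_nonneg _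
        refine ⟨by linarith [ht.1], fun J' hJ' => ?_⟩
        have hJ'' : (J' : ℕ) = j + 1 := hJ'
        have h1 := (hx.2 J' (by omega)).1
        have h2 : y J ≤ y J' := hy (by rw [Fin.le_def, hJ'']; simp [hJ])
        rw [hJ''] at h1
        push_cast at h1
        linarith [ht.2]
      have hgap := gapProd_nonneg k hy
      change _ ≤ levelDet (roundLevel k (J + 1)) x
      rw [hlev, hraise.2]
      calc c * (Real.exp (-((j : ℝ) + 1 / 2)) * (1 / 2)) * gapProd k y
          = ∫ t in Set.Ioc (j : ℝ) (j + 1 / 2),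
              Real.exp (-((j : ℝ) + 1 / 2)) * (c * gapProd k y) := by
            rw [setIntegral_const, measureReal_def, Real.volume_Ioc,
              ENNReal.toReal_ofReal (by norm_num), smul_eq_mul]
            ring
        _ ≤ ∫ t in Set.Ioc (j : ℝ) (j + 1 / 2),
              Real.exp (-t) * levelDet (roundLevel k j) (Function.update x J (x J + t)) := by
            refine setIntegral_mono_on (integrableOn_const (by simp)) (hraise.1.mono_set hI)
              measurableSet_Ioc fun t ht => ?_
            refine mul_le_mul (Real.exp_le_exp.2 (by linarith [ht.2])) ?_
              (by positivity) (Real.exp_pos _).le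
            refine hle y hy _ ⟨fun i hi => ?_, fun i hi => ?_⟩
            · have hiJ : i ≠ J := by rintro rfl; simp [hJ] at hi
              rw [Function.update_of_ne hiJ]
              exact hx.1 i (by omega)
            · by_cases hiJ : i = J
              · subst hiJ
                rw [Function.update_self, hxJ]
                exact ⟨by linarith [ht.1], by linarith [ht.2]⟩
              · have : (i : ℕ) ≠ j := fun h => hiJ (Fin.ext h)
                rw [Function.update_of_ne hiJ]
                exact hx.2 i (by omega)
        _ ≤ _ := setIntegral_mono_set hraise.1 (by
            filter_upwards [ae_restrict_mem (measurableSet_raiseSet x J)] with t ht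
            exact mul_nonneg (Real.exp_pos _).le
              (levelDet_nonneg hkj (by omega) (monotone_update_of_mem_raiseSet hxm ht)))
            hI.eventuallyLE

/-- The harmonic function is comparable from below with the product of all `1 + x_j - x_i`. -/
theorem exists_gapProd_le_h {d : ℕ} (hd : 0 < d) :
    ∃ c : ℝ, 0 < c ∧ ∀ x : Fin d → ℝ, Monotone x → c * gapProd 1 x ≤ h x := by
  obtain ⟨c, hc, hle⟩ := exists_gapProd_le_levelDet (d := d) le_rfl hd le_rfl
  refine ⟨c, hc, fun x hx => ?_⟩
  have h1 := hle x hx x ⟨fun _ _ => rfl, fun i hi => by have := i.2; omega⟩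
  rw [h_eq_levelDet]
  convert h1 using 2
  funext i
  have := i.2
  simp only [roundLevel]
  split_ifs <;> omega

/-! ### Reflections and translations of the products over pairs -/

/-- Products over pairs are invariant under reversal of the order of the indices. -/
lemma prod_pairs_rev {d : ℕ} (f : Fin d → Fin d → ℝ) :
    ∏ i : Fin d, ∏ j ∈ Finset.Ioi i, f j.rev i.rev = ∏ i : Fin d, ∏ j ∈ Finset.Ioi i, f i j := by
  have h1 : ∏ i : Fin d, ∏ j ∈ Finset.Ioi i, f j.rev i.rev =
      ∏ i : Fin d, ∏ j ∈ Finset.Iio i, f j i := by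
    rw [← Equiv.prod_comp Fin.revPerm]
    refine Finset.prod_congr rfl fun i _ => ?_
    refine Finset.prod_nbij' Fin.rev Fin.rev ?_ ?_ ?_ ?_ ?_
    · intro j hj
      simp only [Fin.revPerm_apply, Finset.mem_Ioi, Finset.mem_Iio] at *
      rw [← Fin.rev_lt_rev, Fin.rev_rev]
      simpa using hj
    · intro j hj
      simp only [Fin.revPerm_apply, Finset.mem_Ioi, Finset.mem_Iio] at *
      rwa [Fin.rev_lt_rev]
    · simp
    · simp
    · simp
  rw [h1]
  exact Finset.prod_comm' (by simp)

lemma vandermonde_neg_rev {d : ℕ} (v : Fin d → ℝ) :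
    vandermonde (fun j => -v (Fin.rev j)) = vandermonde v := by
  rw [vandermonde, vandermonde, ← prod_pairs_rev fun i j => v j - v i]
  refine Finset.prod_congr rfl fun i _ => Finset.prod_congr rfl fun j _ => ?_
  ring

lemma vandermonde_add_const {d : ℕ} (v : Fin d → ℝ) (c : ℝ) :
    vandermonde (fun j => v j + c) = vandermonde v := by
  refine Finset.prod_congr rfl fun i _ => Finset.prod_congr rfl fun j _ => ?_
  ring

lemma vandermonde_pos {d : ℕ} {x : Fin d → ℝ} (hx : StrictMono x) : 0 < vandermonde x :=
  Finset.prod_pos fun _ _ => Finset.prod_pos fun _ hj => sub_pos.2 (hx (Finset.mem_Ioi.1 hj))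

lemma gapProd_one_eq {d : ℕ} (y : Fin d → ℝ) :
    gapProd 1 y = ∏ i : Fin d, ∏ j ∈ Finset.Ioi i, (y j - y i + 1) := by
  refine Finset.prod_congr rfl fun i _ => Finset.prod_congr rfl fun j hj => ?_
  have := Fin.lt_def.1 (Finset.mem_Ioi.1 hj)
  rw [if_pos (by omega)]

lemma gapProd_one_neg_rev {d : ℕ} (y : Fin d → ℝ) :
    gapProd 1 (fun j => -y (Fin.rev j)) = gapProd 1 y := by
  rw [gapProd_one_eq, gapProd_one_eq, ← prod_pairs_rev fun i j => y j - y i + 1]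
  refine Finset.prod_congr rfl fun i _ => Finset.prod_congr rfl fun j _ => ?_
  ring

lemma one_le_gapProd_one {d : ℕ} {y : Fin d → ℝ} (hy : Monotone y) : 1 ≤ gapProd 1 y := by
  rw [gapProd_one_eq]
  refine Finset.one_le_prod fun i _ => Finset.one_le_prod fun j hj => ?_
  linarith [hy (Finset.mem_Ioi.1 hj).le]

lemma chi_pos (d : ℕ) : 0 < chi d := by
  unfold chi
  have : 0 < ∏ j ∈ Finset.Icc 1 (d - 1), (Nat.factorial j : ℝ) :=
    Finset.prod_pos fun j _ => by positivity
  positivity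

/-- The exponential factor is distributed over the rows and columns of the determinant. -/
lemma exp_mul_det_eq {d : ℕ} (x z : Fin d → ℝ) (k : Fin d → Fin d → ℕ) :
    Real.exp (-∑ j, (z j - x j)) * (Matrix.of fun i j => truncPow (k i j) (z j - x i)).det =
      (Matrix.of fun i j => gammaDens (k i j) (z j - x i)).det := by
  have h1 : Real.exp (-∑ j, (z j - x j)) = (∏ i, Real.exp (x i)) * ∏ j, Real.exp (-z j) := by
    rw [← Real.exp_sum, ← Real.exp_sum, ← Real.exp_add, Finset.sum_sub_distrib,
      Finset.sum_neg_distrib]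
    congr 1; ring
  rw [h1, mul_assoc, ← Matrix.det_mul_row, ← Matrix.det_mul_column]
  congr 1
  ext i j
  simp only [Matrix.of_apply, gammaDens]
  rw [← mul_assoc, ← Real.exp_add]
  congr 2; ring

lemma densRho_eq_det {d : ℕ} (n : ℕ) (x z : Fin d → ℝ) :
    densRho n x z = (Matrix.of fun i j => gammaDens n (z j - x i)).det :=
  exp_mul_det_eq x z fun _ _ => n

lemma densTau_eq_det {d : ℕ} (n : ℕ) (x z : Fin d → ℝ) :
    densTau n x z = (Matrix.of fun i j : Fin d => gammaDens (n + i - j) (z j - x i)).det :=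
  exp_mul_det_eq x z fun i j => n + i - j

/-! ### The density in the chamber as an average -/

/-- The joint law of the independent vectors `η` and `η'`, whose components have the laws
`etaLaw j` and `etaLaw (d - 1 - j)`. -/
noncomputable def etaPairLaw (d : ℕ) : Measure ((Fin d → ℝ) × (Fin d → ℝ)) :=
  (Measure.pi fun j : Fin d => etaLaw j).prod (Measure.pi fun j : Fin d => etaLaw (Fin.rev j))

instance isProbabilityMeasure_etaPairLaw (d : ℕ) : IsProbabilityMeasure (etaPairLaw d) := by
  unfold etaPairLaw; infer_instance

/-- A crude bound, from the Leibniz formula and `gammaDens ≤ 1`. -/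
lemma abs_det_gammaDens_le {d : ℕ} (m : ℕ) (u : Fin d → Fin d → ℝ) :
    |(Matrix.of fun i j => gammaDens m (u i j)).det| ≤ (d.factorial : ℝ) := by
  have := Matrix.det_le (A := Matrix.of fun i j => gammaDens m (u i j))
    (abv := AbsoluteValue.abs) (x := 1) fun i j => by
      simp only [Matrix.of_apply, AbsoluteValue.abs_apply]
      rw [abs_of_nonneg (gammaDens_nonneg _ _)]
      exact gammaDens_le_one _ _
  simpa using this

lemma integrable_det_gammaDens {d : ℕ} (m : ℕ) (x z : Fin d → ℝ) :
    Integrable (fun p : (Fin d → ℝ) × (Fin d → ℝ) =>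
      (Matrix.of fun i j => gammaDens m (z j - p.2 j - (x i + p.1 i))).det) (etaPairLaw d) :=
  Integrable.of_bound (measurable_det fun i j => by fun_prop).aestronglyMeasurable _
    (ae_of_all _ fun p => abs_det_gammaDens_le m fun i j => z j - p.2 j - (x i + p.1 i))

/-- The density of the walk killed on leaving the chamber is an average of the antisymmetric
determinant of constant order. -/
lemma densTau_eq_integral {d m : ℕ} (hm : 1 ≤ m) (x z : Fin d → ℝ) :
    densTau (m + (d - 1)) x z = ∫ p, (Matrix.of fun i j =>
      gammaDens m (z j - p.2 j - (x i + p.1 i))).det ∂(etaPairLaw d) := by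
  rw [etaPairLaw, integral_prod_symm _ (integrable_det_gammaDens m x z)]
  have h1 : ∀ y : Fin d → ℝ, ∫ w, (Matrix.of fun i j : Fin d =>
      gammaDens m (z j - y j - (x i + w i))).det ∂(Measure.pi fun j : Fin d => etaLaw j) =
      (Matrix.of fun j i : Fin d => gammaDens (m + i) (z j - x i - y j)).det := by
    intro y
    have h := (integral_det_pi (fun i : Fin d => etaLaw i)
      (fun i w j => gammaDens m (z j - y j - x i - w))
      fun i j => integrable_gammaDens_sub _ _ _).2
    simp only [integral_gammaDens_sub_etaLaw hm] at h
    simp only [← sub_sub]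
    rw [h, ← Matrix.det_transpose]
    congr 1
    ext j i
    simp only [Matrix.transpose_apply, Matrix.of_apply]
    congr 1; ring
  simp only [h1]
  rw [(integral_det_pi (fun j : Fin d => etaLaw (Fin.rev j))
      (fun j y i => gammaDens (m + i) (z j - x i - y))
      fun i j => integrable_gammaDens_sub _ _ _).2, densTau_eq_det, ← Matrix.det_transpose]
  congr 1
  ext j i
  simp only [Matrix.transpose_apply, Matrix.of_apply]
  rw [integral_gammaDens_sub_etaLaw (by omega), Fin.val_rev]
  congr 1
  have := i.2
  have := j.2
  omega

lemma integral_pi_etaLaw_rev {d : ℕ} (F : (Fin d → ℝ) → ℝ) :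
    ∫ y, F y ∂(Measure.pi fun j : Fin d => etaLaw (Fin.rev j)) =
      ∫ y, F (fun j => y (Fin.rev j)) ∂(Measure.pi fun j : Fin d => etaLaw j) := by
  have h := measurePreserving_piCongrLeft (fun j : Fin d => etaLaw (Fin.rev j)) Fin.revPerm
  rw [← h.integral_comp' F]
  simp only [Fin.revPerm_apply, Fin.rev_rev]
  refine integral_congr_ae (ae_of_all _ fun y => ?_)
  have h1 : MeasurableEquiv.piCongrLeft (fun _ : Fin d => ℝ) Fin.revPerm y =
      fun j => y (Fin.rev j) := by
    funext j
    have h2 := Equiv.piCongrLeft_apply_apply (fun _ : Fin d => ℝ) Fin.revPerm y (Fin.rev j)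
    rwa [Fin.revPerm_apply, Fin.rev_rev] at h2
  exact congrArg F h1

/-- The function `hHat` as a mean over `η`, whose components now have reversed shapes. -/
lemma hHat_eq_integral {d : ℕ} (z : Fin d → ℝ) :
    hHat z = ∫ y, vandermonde (fun j => z j - y j)
      ∂(Measure.pi fun j : Fin d => etaLaw (Fin.rev j)) := by
  rw [integral_pi_etaLaw_rev, hHat, h]
  refine integral_congr_ae (ae_of_all _ fun y => ?_)
  simp only
  rw [← vandermonde_neg_rev]
  congr 1
  funext j
  simp only [Pi.add_apply, Fin.rev_rev]
  ring

/-! ### Uniform asymptotics -/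

/-- A weight dominating all polynomial expressions in `η`. -/
noncomputable def etaWeight {d : ℕ} (y : Fin d → ℝ) : ℝ := ∏ i, (1 + |y i|)

lemma one_le_etaWeight {d : ℕ} (y : Fin d → ℝ) : 1 ≤ etaWeight y :=
  Finset.one_le_prod fun i _ => by linarith [abs_nonneg (y i)]

lemma one_add_abs_le_etaWeight {d : ℕ} (y : Fin d → ℝ) (i : Fin d) : 1 + |y i| ≤ etaWeight y := by
  rw [etaWeight, ← Finset.mul_prod_erase _ _ (Finset.mem_univ i)]
  refine le_mul_of_one_le_right (by positivity) (Finset.one_le_prod fun j _ => ?_)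
  linarith [abs_nonneg (y j)]

lemma abs_vandermonde_add_le {d : ℕ} {x : Fin d → ℝ} (hx : Monotone x) (y : Fin d → ℝ) :
    |vandermonde (fun j => x j + y j)| ≤ gapProd 1 x * etaWeight y ^ (2 * (d * d)) := by
  have hS := one_le_etaWeight y
  rw [vandermonde, gapProd_one_eq, Finset.abs_prod]
  have h1 : ∀ i : Fin d, |∏ j ∈ Finset.Ioi i, (x j + y j - (x i + y i))| ≤
      (∏ j ∈ Finset.Ioi i, (x j - x i + 1)) * etaWeight y ^ (2 * d) := by
    intro i
    rw [Finset.abs_prod]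
    calc ∏ j ∈ Finset.Ioi i, |x j + y j - (x i + y i)|
        ≤ ∏ j ∈ Finset.Ioi i, ((x j - x i + 1) * etaWeight y ^ 2) := by
          refine Finset.prod_le_prod (fun j _ => abs_nonneg _) fun j hj => ?_
          have hij : 0 ≤ x j - x i := sub_nonneg.2 (hx (Finset.mem_Ioi.1 hj).le)
          have hi := one_add_abs_le_etaWeight y i
          have hj := one_add_abs_le_etaWeight y j
          have h2 : |x j + y j - (x i + y i)| ≤ (x j - x i) + (|y i| + |y j|) := by
            rw [abs_le]
            constructor <;>
              linarith [neg_abs_le (y i), neg_abs_le (y j), le_abs_self (y i), le_abs_self (y j)]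
          have h3 : 1 + (|y i| + |y j|) ≤ etaWeight y ^ 2 := by
            nlinarith [abs_nonneg (y i), abs_nonneg (y j)]
          nlinarith [abs_nonneg (y i), abs_nonneg (y j)]
      _ = (∏ j ∈ Finset.Ioi i, (x j - x i + 1)) * (etaWeight y ^ 2) ^ (Finset.Ioi i).card := by
          rw [Finset.prod_mul_distrib, Finset.prod_const]
      _ ≤ (∏ j ∈ Finset.Ioi i, (x j - x i + 1)) * etaWeight y ^ (2 * d) := by
          refine mul_le_mul_of_nonneg_left ?_ (Finset.prod_nonneg fun j hj => ?_)
          · rw [← pow_mul]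
            refine pow_le_pow_right₀ hS (Nat.mul_le_mul_left 2 ?_)
            exact (Finset.card_le_univ _).trans_eq (Fintype.card_fin d)
          · linarith [hx (Finset.mem_Ioi.1 hj).le]
  calc ∏ i : Fin d, |∏ j ∈ Finset.Ioi i, (x j + y j - (x i + y i))|
      ≤ ∏ i : Fin d, ((∏ j ∈ Finset.Ioi i, (x j - x i + 1)) * etaWeight y ^ (2 * d)) :=
        Finset.prod_le_prod (fun i _ => abs_nonneg _) fun i _ => h1 i
    _ = _ := by
        rw [Finset.prod_mul_distrib, Finset.prod_const, Finset.card_univ, Fintype.card_fin,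
          ← pow_mul]
        congr 2; ring

lemma integrable_etaWeight_pow {d : ℕ} (K : ℕ) (k : Fin d → ℕ) :
    Integrable (fun y => etaWeight y ^ K) (Measure.pi fun j : Fin d => etaLaw (k j)) := by
  simp only [etaWeight, ← Finset.prod_pow]
  exact Integrable.fintype_prod (f := fun _ y => (1 + |y|) ^ K) fun i =>
    integrable_one_add_abs_pow_etaLaw K (k i)

/-- Uniform local asymptotics of the Gamma determinant for nodes of smaller order than `√m`. -/
lemma eventually_abs_det_gammaDens_sub_le (d : ℕ) {b : ℕ → ℝ}
    (hb : Tendsto (fun m : ℕ => b m / √(m : ℝ)) atTop (𝓝 0)) {ε : ℝ} (hε : 0 < ε) :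
    ∀ᶠ m : ℕ in atTop, ∀ u v : Fin d → ℝ, (∀ i, |u i| ≤ b m) → (∀ j, |v j| ≤ b m) →
      |√(m : ℝ) ^ (d * d) * (Matrix.of fun i j => gammaDens m (m + v j - u i)).det -
        chi d * vandermonde u * vandermonde v| ≤ ε * |vandermonde u * vandermonde v| := by
  -- Uniformity in the nodes is convergence along a filter on triples of `m` and admissible nodes.
  set l : Filter (ℕ × (Fin d → ℝ) × (Fin d → ℝ)) := comap Prod.fst atTop ⊓
    𝓟 {p | (∀ i, |p.2.1 i| ≤ b p.1) ∧ ∀ j, |p.2.2 j| ≤ b p.1} with hl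
  have hn : Tendsto (fun p : ℕ × (Fin d → ℝ) × (Fin d → ℝ) => p.1) l atTop :=
    tendsto_comap.mono_left inf_le_left
  have hmem : ∀ᶠ p in l, (∀ i, |p.2.1 i| ≤ b p.1) ∧ ∀ j, |p.2.2 j| ≤ b p.1 :=
    mem_inf_of_right (mem_principal_self _)
  have hu : ∀ i, Tendsto (fun p : ℕ × (Fin d → ℝ) × (Fin d → ℝ) => p.2.1 i / √(p.1 : ℝ)) l
      (𝓝 0) := by
    intro i
    refine squeeze_zero_norm' ?_ (hb.comp hn)
    filter_upwards [hmem] with p hp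
    rw [norm_div, Real.norm_eq_abs, Real.norm_of_nonneg (Real.sqrt_nonneg _)]
    exact div_le_div_of_nonneg_right (hp.1 i) (Real.sqrt_nonneg _)
  have hv : ∀ i, Tendsto (fun p : ℕ × (Fin d → ℝ) × (Fin d → ℝ) => p.2.2 i / √(p.1 : ℝ)) l
      (𝓝 0) := by
    intro i
    refine squeeze_zero_norm' ?_ (hb.comp hn)
    filter_upwards [hmem] with p hp
    rw [norm_div, Real.norm_eq_abs, Real.norm_of_nonneg (Real.sqrt_nonneg _)]
    exact div_le_div_of_nonneg_right (hp.2 i) (Real.sqrt_nonneg _)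
  obtain ⟨R, hR, hdet⟩ := exists_tendsto_det_gammaDens hn hu hv
  have hχ := chi_pos d
  have hev : ∀ᶠ p in l, |√(p.1 : ℝ) ^ (d * d) *
      (Matrix.of fun i j => gammaDens p.1 (p.1 + p.2.2 j - p.2.1 i)).det -
        chi d * vandermonde p.2.1 * vandermonde p.2.2| ≤
          ε * |vandermonde p.2.1 * vandermonde p.2.2| := by
    have hR1 : ∀ᶠ p in l, |R p - 1| ≤ ε / chi d := by
      have h1 := (hR.sub_const 1).abs
      rw [sub_self, abs_zero] at h1
      exact h1.eventually_le_const (by positivity)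
    filter_upwards [hdet, hR1, hn.eventually_ge_atTop 1] with p h1 h2 h3
    have hs : 0 < √(p.1 : ℝ) := Real.sqrt_pos.2 (by exact_mod_cast h3)
    have h4 : √(p.1 : ℝ) ^ (d * d) * (√(p.1 : ℝ))⁻¹ ^ (d * d) = 1 := by
      rw [← mul_pow, mul_inv_cancel₀ hs.ne', one_pow]
    have h5 : √(p.1 : ℝ) ^ (d * d) *
        (Matrix.of fun i j => gammaDens p.1 (p.1 + p.2.2 j - p.2.1 i)).det -
        chi d * vandermonde p.2.1 * vandermonde p.2.2 =
        chi d * (R p - 1) * (vandermonde p.2.1 * vandermonde p.2.2) := by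
      rw [h1]
      linear_combination (chi d * vandermonde p.2.1 * vandermonde p.2.2 * R p) * h4
    rw [h5, abs_mul, abs_mul, abs_of_pos hχ]
    refine mul_le_mul_of_nonneg_right ?_ (abs_nonneg _)
    rwa [le_div_iff₀' hχ] at h2
  rw [hl, eventually_inf_principal, eventually_comap] at hev
  filter_upwards [hev] with m hm u v hu hv
  exact hm (m, u, v) rfl ⟨hu, hv⟩

lemma etaWeight_neg {d : ℕ} (y : Fin d → ℝ) : etaWeight (fun j => -y j) = etaWeight y := by
  simp [etaWeight]

lemma abs_vandermonde_mul_le {d : ℕ} {x z : Fin d → ℝ} (hx : Monotone x) (hz : Monotone z)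
    (p : (Fin d → ℝ) × (Fin d → ℝ)) :
    |vandermonde (fun i => x i + p.1 i) * vandermonde (fun j => z j - p.2 j)| ≤
      gapProd 1 x * gapProd 1 z * (etaWeight p.1 * etaWeight p.2) ^ (2 * (d * d)) := by
  have h1 := abs_vandermonde_add_le hx p.1
  have h2 := abs_vandermonde_add_le hz (fun j => -p.2 j)
  rw [etaWeight_neg] at h2
  simp only [← sub_eq_add_neg] at h2
  rw [abs_mul, mul_pow, mul_mul_mul_comm]
  exact mul_le_mul h1 h2 (abs_nonneg _) ((abs_nonneg _).trans h1)

/-- The integrand of `densTau_eq_integral` is uniformly close to a product of two Vandermonde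
products. For small `η`, `η'` this is the uniform asymptotics of the Gamma determinant; for large
`η`, `η'` the left-hand side is bounded crudely and absorbed by one more power of the weight. -/
lemma eventually_abs_shifted_det_sub_le (d : ℕ) {A : ℕ → ℝ}
    (hA : Tendsto (fun m : ℕ => A m / √(m : ℝ)) atTop (𝓝 0)) (s : ℝ) {ε : ℝ} (hε : 0 < ε) :
    ∀ᶠ m : ℕ in atTop, ∀ (c : ℝ) (x z : Fin d → ℝ), Monotone x → Monotone z →
      (∀ i, |x i - c| ≤ A m) → (∀ j, |z j - c| ≤ A m) → ∀ p : (Fin d → ℝ) × (Fin d → ℝ),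
      |√(m : ℝ) ^ (d * d) * (Matrix.of fun i j =>
          gammaDens m (m + s + z j - p.2 j - (x i + p.1 i))).det -
        chi d * (vandermonde (fun i => x i + p.1 i) * vandermonde (fun j => z j - p.2 j))| ≤
        ε * (gapProd 1 x * gapProd 1 z) *
          (etaWeight p.1 * etaWeight p.2) ^ (2 * (d * d) + 1) := by
  have hr : Tendsto (fun m : ℕ => √√(m : ℝ)) atTop atTop :=
    Real.tendsto_sqrt_atTop.comp (tendsto_sqrt_natCast tendsto_id)
  have hb : Tendsto (fun m : ℕ => (A m + √√(m : ℝ) + |s|) / √(m : ℝ)) atTop (𝓝 0) := by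
    have h1 : Tendsto (fun m : ℕ => √√(m : ℝ) / √(m : ℝ)) atTop (𝓝 0) := by
      simp only [Real.sqrt_div_self]
      exact tendsto_inv_atTop_zero.comp hr |>.congr fun m => by simp
    have h2 : Tendsto (fun m : ℕ => |s| / √(m : ℝ)) atTop (𝓝 0) :=
      (tendsto_sqrt_natCast tendsto_id).const_div_atTop _
    simpa [add_div] using (hA.add h1).add h2
  have hχ := chi_pos d
  filter_upwards [eventually_abs_det_gammaDens_sub_le d hb hε,
    hr.eventually_ge_atTop ((d.factorial + chi d) / ε)] with m hm hrm c x z hx hz hxA hzA p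
  have hS := one_le_etaWeight p.1
  have hS' := one_le_etaWeight p.2
  have hW : 1 ≤ etaWeight p.1 * etaWeight p.2 := one_le_mul_of_one_le_of_one_le hS hS'
  have hg : 1 ≤ gapProd 1 x * gapProd 1 z :=
    one_le_mul_of_one_le_of_one_le (one_le_gapProd_one hx) (one_le_gapProd_one hz)
  have hV := abs_vandermonde_mul_le hx hz p
  have hSW : etaWeight p.1 ≤ etaWeight p.1 * etaWeight p.2 :=
    le_mul_of_one_le_right (by linarith) hS'
  have hSW' : etaWeight p.2 ≤ etaWeight p.1 * etaWeight p.2 :=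
    le_mul_of_one_le_left (by linarith) hS
  set W := etaWeight p.1 * etaWeight p.2
  set g := gapProd 1 x * gapProd 1 z
  set V := vandermonde (fun i => x i + p.1 i) * vandermonde (fun j => z j - p.2 j)
  -- The threshold `√√m` is of smaller order than `√m`, as the local asymptotics require, and yet a
  -- power of it absorbs the normalization `√m ^ (d * d)`.
  rcases le_or_gt W √√(m : ℝ) with hWr | hWr
  · have h1 := hm (fun i => x i + p.1 i + -c) (fun j => z j - p.2 j + (s - c)) ?_ ?_
    · rw [vandermonde_add_const (fun i => x i + p.1 i) (-c),
        vandermonde_add_const (fun j => z j - p.2 j) (s - c), mul_assoc (chi d)] at h1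
      have h2 : ∀ i j, (m : ℝ) + (z j - p.2 j + (s - c)) - (x i + p.1 i + -c) =
          m + s + z j - p.2 j - (x i + p.1 i) := fun i j => by ring
      simp only [h2] at h1
      refine h1.trans ?_
      rw [mul_assoc]
      refine mul_le_mul_of_nonneg_left (hV.trans ?_) hε.le
      exact mul_le_mul_of_nonneg_left (pow_le_pow_right₀ hW (by omega)) (by linarith)
    · intro i
      have h3 := one_add_abs_le_etaWeight p.1 i
      have h4 := hxA i
      rw [abs_le] at h4 ⊢
      constructor <;> linarith [neg_abs_le (p.1 i), le_abs_self (p.1 i), abs_nonneg s]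
    · intro j
      have h3 := one_add_abs_le_etaWeight p.2 j
      have h4 := hzA j
      rw [abs_le] at h4 ⊢
      constructor <;>
        linarith [neg_abs_le (p.2 j), le_abs_self (p.2 j), neg_abs_le s, le_abs_self s]
  · have h1 : √(m : ℝ) ^ (d * d) ≤ W ^ (2 * (d * d)) := by
      rw [pow_mul W 2 (d * d)]
      refine pow_le_pow_left₀ (Real.sqrt_nonneg _) ?_ (d * d)
      rw [← Real.sq_sqrt (Real.sqrt_nonneg (m : ℝ))]
      exact pow_le_pow_left₀ (Real.sqrt_nonneg _) hWr.le 2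
    have h2 := abs_det_gammaDens_le m fun i j : Fin d =>
      (m : ℝ) + s + z j - p.2 j - (x i + p.1 i)
    set D := (Matrix.of fun i j : Fin d => gammaDens m (m + s + z j - p.2 j - (x i + p.1 i))).det
    have hWK : 0 ≤ W ^ (2 * (d * d)) := by positivity
    have h3 : |√(m : ℝ) ^ (d * d) * D| ≤ g * W ^ (2 * (d * d)) * d.factorial := by
      rw [abs_mul, abs_of_nonneg (by positivity : 0 ≤ √(m : ℝ) ^ (d * d))]
      exact mul_le_mul (h1.trans (le_mul_of_one_le_left hWK hg)) h2 (abs_nonneg _)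
        (by positivity)
    have h4 : |chi d * V| ≤ chi d * (g * W ^ (2 * (d * d))) := by
      rw [abs_mul, abs_of_pos hχ]
      exact mul_le_mul_of_nonneg_left hV hχ.le
    have h5 : d.factorial + chi d ≤ ε * W := by
      rw [div_le_iff₀' hε] at hrm
      exact hrm.trans (mul_le_mul_of_nonneg_left hWr.le hε.le)
    calc |√(m : ℝ) ^ (d * d) * D - chi d * V|
        ≤ g * W ^ (2 * (d * d)) * d.factorial + chi d * (g * W ^ (2 * (d * d))) :=
          (abs_sub _ _).trans (add_le_add h3 h4)
      _ = (d.factorial + chi d) * (g * W ^ (2 * (d * d))) := by ring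
      _ ≤ ε * W * (g * W ^ (2 * (d * d))) :=
          mul_le_mul_of_nonneg_right h5 (by positivity)
      _ = _ := by ring

lemma measurable_vandermonde {d : ℕ} : Measurable (vandermonde : (Fin d → ℝ) → ℝ) := by
  unfold vandermonde
  fun_prop

lemma integrable_etaWeight_mul_pow (d K : ℕ) :
    Integrable (fun p => (etaWeight p.1 * etaWeight p.2) ^ K) (etaPairLaw d) := by
  simp only [mul_pow]
  exact (integrable_etaWeight_pow K fun j : Fin d => (j : ℕ)).mul_prod
    (integrable_etaWeight_pow K fun j : Fin d => (Fin.rev j : ℕ))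

lemma integrable_vandermonde_mul {d : ℕ} {x z : Fin d → ℝ} (hx : Monotone x) (hz : Monotone z) :
    Integrable (fun p => vandermonde (fun i => x i + p.1 i) * vandermonde (fun j => z j - p.2 j))
      (etaPairLaw d) := by
  refine ((integrable_etaWeight_mul_pow d (2 * (d * d))).const_mul
    (gapProd 1 x * gapProd 1 z)).mono' ?_ (ae_of_all _ fun p => abs_vandermonde_mul_le hx hz p)
  refine Measurable.aestronglyMeasurable (Measurable.mul ?_ ?_)
  · exact measurable_vandermonde.comp (by fun_prop)
  · exact measurable_vandermonde.comp (by fun_prop)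

lemma integral_vandermonde_mul {d : ℕ} (x z : Fin d → ℝ) :
    ∫ p, vandermonde (fun i => x i + p.1 i) * vandermonde (fun j => z j - p.2 j) ∂(etaPairLaw d) =
      h x * hHat z := by
  rw [hHat_eq_integral, h]
  exact integral_prod_mul (fun y : Fin d → ℝ => vandermonde fun i => x i + y i)
    fun y : Fin d → ℝ => vandermonde fun j => z j - y j

/-- A weighted bound on the integrand of `densTau_eq_integral` integrates to a bound on the
density. -/
lemma abs_densTau_sub_le {d m K : ℕ} (hm : 1 ≤ m) {x z : Fin d → ℝ} (hx : Monotone x)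
    (hz : Monotone z) {s q r δ : ℝ}
    (hδ : ∀ p : (Fin d → ℝ) × (Fin d → ℝ),
      |q * (Matrix.of fun i j => gammaDens m (s + z j - p.2 j - (x i + p.1 i))).det -
        r * (vandermonde (fun i => x i + p.1 i) * vandermonde (fun j => z j - p.2 j))| ≤
        δ * (etaWeight p.1 * etaWeight p.2) ^ K) :
    |q * densTau (m + (d - 1)) x (fun j => s + z j) - r * (h x * hHat z)| ≤
      δ * ∫ p, (etaWeight p.1 * etaWeight p.2) ^ K ∂(etaPairLaw d) := by
  have h1 := ((integrable_det_gammaDens m x fun j => s + z j).const_mul q)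
  have h2 := (integrable_vandermonde_mul hx hz).const_mul r
  rw [densTau_eq_integral hm, ← integral_vandermonde_mul, ← integral_const_mul,
    ← integral_const_mul, ← integral_const_mul, ← integral_sub h1 h2, ← Real.norm_eq_abs]
  refine norm_integral_le_of_norm_le ((integrable_etaWeight_mul_pow d K).const_mul δ)
    (ae_of_all _ fun p => ?_)
  rw [Real.norm_eq_abs]
  exact hδ p

/-- Uniform local asymptotics of the density of the walk killed on leaving the chamber, with the
error measured against `h x * hHat z`. -/
lemma eventually_abs_densTau_sub_le {d : ℕ} (hd : 0 < d) {A : ℕ → ℝ}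
    (hA : Tendsto (fun m : ℕ => A m / √(m : ℝ)) atTop (𝓝 0)) (s : ℝ) {ε : ℝ} (hε : 0 < ε) :
    ∀ᶠ m : ℕ in atTop, ∀ (c : ℝ) (x z : Fin d → ℝ), Monotone x → Monotone z →
      (∀ i, |x i - c| ≤ A m) → (∀ j, |z j - c| ≤ A m) →
      0 < h x * hHat z ∧
      |√(m : ℝ) ^ (d * d) * densTau (m + (d - 1)) x (fun j => m + s + z j) -
        chi d * (h x * hHat z)| ≤ ε * (h x * hHat z) := by
  obtain ⟨c₀, hc₀, hc⟩ := exists_gapProd_le_h hd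
  obtain ⟨C, hC⟩ : ∃ C, C =
      ∫ p, (etaWeight p.1 * etaWeight p.2) ^ (2 * (d * d) + 1) ∂(etaPairLaw d) := ⟨_, rfl⟩
  have hC0 : 0 ≤ C := by
    rw [hC]
    refine integral_nonneg fun p => ?_
    have h1 := one_le_etaWeight p.1
    have h2 := one_le_etaWeight p.2
    exact pow_nonneg (mul_nonneg (by linarith) (by linarith)) _
  obtain ⟨δ, hδ_eq⟩ : ∃ δ, δ = ε * c₀ ^ 2 / (C + 1) := ⟨_, rfl⟩
  have hδ : 0 < δ := by rw [hδ_eq]; positivity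
  filter_upwards [eventually_abs_shifted_det_sub_le d hA s hδ, eventually_ge_atTop 1]
    with m hm hm1 c x z hx hz hxA hzA
  have hgx := one_le_gapProd_one hx
  have hgz := one_le_gapProd_one hz
  have hhx : c₀ * gapProd 1 x ≤ h x := hc x hx
  have hhz : c₀ * gapProd 1 z ≤ hHat z := by
    rw [← gapProd_one_neg_rev]
    exact hc _ fun i j hij => neg_le_neg (hz (Fin.rev_le_rev.2 hij))
  have hgg : c₀ ^ 2 * (gapProd 1 x * gapProd 1 z) ≤ h x * hHat z := by
    calc c₀ ^ 2 * (gapProd 1 x * gapProd 1 z) = (c₀ * gapProd 1 x) * (c₀ * gapProd 1 z) := by ring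
      _ ≤ _ := mul_le_mul hhx hhz (by positivity) (le_trans (by positivity) hhx)
  refine ⟨lt_of_lt_of_le (by positivity) hgg, ?_⟩
  have h1 := abs_densTau_sub_le hm1 hx hz (hm c x z hx hz hxA hzA)
  rw [← hC] at h1
  refine h1.trans ?_
  calc δ * (gapProd 1 x * gapProd 1 z) * C
      ≤ δ * (gapProd 1 x * gapProd 1 z) * (C + 1) :=
        mul_le_mul_of_nonneg_left (by linarith) (by positivity)
    _ = ε * (c₀ ^ 2 * (gapProd 1 x * gapProd 1 z)) := by
        rw [hδ_eq]; field_simp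
    _ ≤ _ := mul_le_mul_of_nonneg_left hgg hε.le

lemma normalization_eq (d n : ℕ) :
    (n : ℝ) ^ (-((d : ℝ) * ((d : ℝ) - 1) / 2) - (d : ℝ) / 2) = (√(n : ℝ) ^ (d * d))⁻¹ := by
  have hn : (0 : ℝ) ≤ n := n.cast_nonneg
  rw [← Real.rpow_natCast, Real.sqrt_eq_rpow, ← Real.rpow_mul hn, ← Real.rpow_neg hn]
  congr 1
  push_cast
  ring

lemma tendsto_shift_div_sqrt {a : ℕ → ℝ} (ha : a =o[atTop] fun n : ℕ => √(n : ℝ)) (k : ℕ) :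
    Tendsto (fun m : ℕ => 2 * |a (m + k)| / √(m : ℝ)) atTop (𝓝 0) := by
  refine IsLittleO.tendsto_div_nhds_zero (IsLittleO.const_mul_left (IsLittleO.abs_left ?_) 2)
  refine (ha.comp_tendsto (tendsto_add_atTop_nat k)).trans_isBigO ?_
  refine IsBigO.of_bound (√(1 + k)) ?_
  filter_upwards [eventually_ge_atTop 1] with m hm
  have hm1 : (1 : ℝ) ≤ m := by exact_mod_cast hm
  have hk : (0 : ℝ) ≤ k := k.cast_nonneg
  simp only [Function.comp_apply, Real.norm_of_nonneg (Real.sqrt_nonneg _)]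
  rw [← Real.sqrt_mul (by positivity)]
  refine Real.sqrt_le_sqrt ?_
  push_cast
  nlinarith

/-- The shift of time by `d - 1` does not affect the normalization in the limit. -/
lemma tendsto_sqrt_add_div_sqrt (k N : ℕ) :
    Tendsto (fun m : ℕ => (√((m + k : ℕ) : ℝ) / √(m : ℝ)) ^ N) atTop (𝓝 1) := by
  have h1 : Tendsto (fun m : ℕ => 1 + (k : ℝ) / m) atTop (𝓝 1) := by
    simpa using (tendsto_const_div_atTop_nhds_zero_nat (k : ℝ)).const_add 1
  have h2 : Tendsto (fun m : ℕ => √(1 + (k : ℝ) / m) ^ N) atTop (𝓝 1) := by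
    simpa using ((Real.continuous_sqrt.tendsto 1).comp h1).pow N
  refine h2.congr' ?_
  filter_upwards [eventually_ge_atTop 1] with m hm
  have hm0 : (0 : ℝ) < m := by exact_mod_cast hm
  rw [← Real.sqrt_div (by positivity)]
  congr 2
  push_cast
  field_simp

/-- The bounds on the widths and on the distance of the first coordinates place both points near
`x 0`. -/
lemma abs_sub_le_of_monotone {d : ℕ} (hd : 0 < d) {x z : Fin d → ℝ} (hx : Monotone x)
    (hz : Monotone z) {b : ℝ}
    (h1 : x ⟨d - 1, Nat.sub_lt hd one_pos⟩ - x ⟨0, hd⟩ ≤ b)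
    (h2 : z ⟨d - 1, Nat.sub_lt hd one_pos⟩ - z ⟨0, hd⟩ ≤ b)
    (h3 : |z ⟨0, hd⟩ - x ⟨0, hd⟩| ≤ b) :
    (∀ i, |x i - x ⟨0, hd⟩| ≤ 2 * |b|) ∧ ∀ j, |z j - x ⟨0, hd⟩| ≤ 2 * |b| := by
  have hb := le_abs_self b
  have hlo : ∀ i : Fin d, (⟨0, hd⟩ : Fin d) ≤ i := fun i => Nat.zero_le _
  have hhi : ∀ i : Fin d, i ≤ ⟨d - 1, Nat.sub_lt hd one_pos⟩ := fun i => by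
    rw [Fin.le_def]; have := i.2; simp only; omega
  rw [abs_le] at h3
  refine ⟨fun i => ?_, fun j => ?_⟩
  · have := hx (hlo i)
    have := hx (hhi i)
    rw [abs_le]; constructor <;> linarith
  · have := hz (hlo j)
    have := hz (hhi j)
    rw [abs_le]; constructor <;> linarith

/-! ### The relative errors -/

lemma eventually_abs_densRho_div_sub_one_lt {d : ℕ} (hd : 0 < d) {a : ℕ → ℝ}
    (ha : a =o[atTop] fun n : ℕ => √(n : ℝ)) {ε : ℝ} (hε : 0 < ε) :
    ∀ᶠ n : ℕ in atTop, ∀ x ∈ weylChamber d, ∀ z ∈ weylChamber d,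
      x ⟨d - 1, Nat.sub_lt hd one_pos⟩ - x ⟨0, hd⟩ ≤ a n →
      z ⟨d - 1, Nat.sub_lt hd one_pos⟩ - z ⟨0, hd⟩ ≤ a n →
      |z ⟨0, hd⟩ - x ⟨0, hd⟩| ≤ a n →
      |densRho n x (fun j => (n : ℝ) + z j) / (chi d * vandermonde x * vandermonde z *
        (n : ℝ) ^ (-((d : ℝ) * ((d : ℝ) - 1) / 2) - (d : ℝ) / 2)) - 1| < ε := by
  have hχ := chi_pos d
  have hδ : 0 < ε / 2 * chi d := by positivity
  filter_upwards [eventually_abs_det_gammaDens_sub_le d (tendsto_shift_div_sqrt ha 0) hδ,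
    eventually_ge_atTop 1] with n hn hn1 x hx z hz h1 h2 h3
  obtain ⟨hu, hv⟩ := abs_sub_le_of_monotone hd hx.monotone hz.monotone h1 h2 h3
  have hn := hn (fun i => x i + -x ⟨0, hd⟩) (fun j => z j + -x ⟨0, hd⟩) hu hv
  rw [vandermonde_add_const, vandermonde_add_const] at hn
  have h4 : ∀ i j, (n : ℝ) + (z j + -x ⟨0, hd⟩) - (x i + -x ⟨0, hd⟩) = n + z j - x i :=
    fun i j => by ring
  simp only [h4] at hn
  rw [← densRho_eq_det n x fun j => (n : ℝ) + z j] at hn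
  have hs : 0 < √(n : ℝ) ^ (d * d) := pow_pos (Real.sqrt_pos.2 (by exact_mod_cast hn1)) _
  have hV : 0 < vandermonde x * vandermonde z := mul_pos (vandermonde_pos hx) (vandermonde_pos hz)
  rw [abs_of_pos hV] at hn
  have hB : 0 < chi d * vandermonde x * vandermonde z := by rw [mul_assoc]; positivity
  have h5 : densRho n x (fun j => (n : ℝ) + z j) / (chi d * vandermonde x * vandermonde z *
      (√(n : ℝ) ^ (d * d))⁻¹) - 1 =
      (√(n : ℝ) ^ (d * d) * densRho n x (fun j => (n : ℝ) + z j) -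
        chi d * vandermonde x * vandermonde z) / (chi d * vandermonde x * vandermonde z) := by
    have := (vandermonde_pos hx).ne'
    have := (vandermonde_pos hz).ne'
    field_simp
  rw [normalization_eq, h5, abs_div, abs_of_pos hB, div_lt_iff₀ hB]
  refine hn.trans_lt ?_
  nlinarith

lemma eventually_abs_densTau_div_sub_one_lt {d : ℕ} (hd : 0 < d) {a : ℕ → ℝ}
    (ha : a =o[atTop] fun n : ℕ => √(n : ℝ)) {ε : ℝ} (hε : 0 < ε) :
    ∀ᶠ n : ℕ in atTop, ∀ x ∈ weylChamber d, ∀ z ∈ weylChamber d,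
      x ⟨d - 1, Nat.sub_lt hd one_pos⟩ - x ⟨0, hd⟩ ≤ a n →
      z ⟨d - 1, Nat.sub_lt hd one_pos⟩ - z ⟨0, hd⟩ ≤ a n →
      |z ⟨0, hd⟩ - x ⟨0, hd⟩| ≤ a n →
      |densTau n x (fun j => (n : ℝ) + z j) / (chi d * h x * hHat z *
        (n : ℝ) ^ (-((d : ℝ) * ((d : ℝ) - 1) / 2) - (d : ℝ) / 2)) - 1| < ε := by
  have hχ := chi_pos d
  -- The asymptotics are those of order `m = n - (d - 1)`; the factor `κ` converts `√m` to `√n`.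
  have hδ : 0 < ε / 4 * chi d := by positivity
  have hκ := tendsto_sqrt_add_div_sqrt (d - 1) (d * d)
  have hκ' : ∀ᶠ m : ℕ in atTop, |(√((m + (d - 1) : ℕ) : ℝ) / √(m : ℝ)) ^ (d * d) - 1| < ε / 4 := by
    have h1 := (hκ.sub_const 1).abs
    rw [sub_self, abs_zero] at h1
    exact h1.eventually_lt_const (by positivity)
  rw [← map_add_atTop_eq_nat (d - 1), eventually_map]
  filter_upwards [eventually_abs_densTau_sub_le hd (tendsto_shift_div_sqrt ha (d - 1))
    ((d - 1 : ℕ) : ℝ) hδ, hκ', hκ.eventually_le_const one_lt_two,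
    eventually_ge_atTop 1] with m hm hκ1 hκ2 hm1 x hx z hz h1 h2 h3
  obtain ⟨hu, hv⟩ := abs_sub_le_of_monotone hd hx.monotone hz.monotone h1 h2 h3
  obtain ⟨hH, hm⟩ := hm _ x z hx.monotone hz.monotone hu hv
  have hcast : ((m + (d - 1) : ℕ) : ℝ) = m + ((d - 1 : ℕ) : ℝ) := by push_cast; ring
  rw [normalization_eq]
  simp only [hcast] at hκ1 hκ2 ⊢
  set T := densTau (m + (d - 1)) x (fun j => (m : ℝ) + ((d - 1 : ℕ) : ℝ) + z j)
  set H := h x * hHat z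
  have hs : 0 < √(m : ℝ) := Real.sqrt_pos.2 (by exact_mod_cast hm1)
  have hs' : 0 < √((m : ℝ) + ((d - 1 : ℕ) : ℝ)) := Real.sqrt_pos.2 (by positivity)
  set κ := (√((m : ℝ) + ((d - 1 : ℕ) : ℝ)) / √(m : ℝ)) ^ (d * d) with hκdef
  have hκ0 : 0 ≤ κ := by positivity
  have hB : 0 < chi d * H := by positivity
  have h6 : |(√(m : ℝ) ^ (d * d) * T - chi d * H) / (chi d * H)| ≤ ε / 4 := by
    rw [abs_div, abs_of_pos hB, div_le_iff₀ hB]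
    linarith
  have h5 : T / (chi d * h x * hHat z * (√((m : ℝ) + ((d - 1 : ℕ) : ℝ)) ^ (d * d))⁻¹) - 1 =
      κ * ((√(m : ℝ) ^ (d * d) * T - chi d * H) / (chi d * H)) + (κ - 1) := by
    rw [mul_assoc (chi d), hκdef, div_pow]
    change T / (chi d * H * _) - 1 = _
    field_simp
    ring
  rw [h5]
  refine (abs_add_le _ _).trans_lt ?_
  rw [abs_mul, abs_of_nonneg hκ0]
  nlinarith [abs_nonneg ((√(m : ℝ) ^ (d * d) * T - chi d * H) / (chi d * H))]

end OrderedWalk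

theorem mainTheorem5 {d : ℕ} (hd : 0 < d) {Ω : Type*} [MeasurableSpace Ω]
    (P : Measure Ω) [IsProbabilityMeasure P] (X : ℕ → Fin d → Ω → ℝ)
    (hmeas : ∀ i j, Measurable (X i j))
    (hexp : ∀ i j, P.map (X i j) = expMeasure 1)
    (hindep : iIndepFun (fun p : ℕ × Fin d => X p.1 p.2) P) :
    (∃ Gt, OrderedWalk.IsKilledDensity P X (OrderedWalk.rho X) Gt) ∧
    (∃ G, OrderedWalk.IsKilledDensity P X (OrderedWalk.tau X) G) ∧
    ∀ Gt G : ℕ → (Fin d → ℝ) → (Fin d → ℝ) → ℝ,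
      OrderedWalk.IsKilledDensity P X (OrderedWalk.rho X) Gt →
      OrderedWalk.IsKilledDensity P X (OrderedWalk.tau X) G →
      ∀ a : ℕ → ℝ, (a =o[atTop] fun n : ℕ => √(n : ℝ)) →
      ∀ ε : ℝ, 0 < ε → ∀ᶠ n : ℕ in atTop,
      ∀ x ∈ OrderedWalk.weylChamber d, ∀ z ∈ OrderedWalk.weylChamber d,
        x ⟨d - 1, Nat.sub_lt hd one_pos⟩ - x ⟨0, hd⟩ ≤ a n →
        z ⟨d - 1, Nat.sub_lt hd one_pos⟩ - z ⟨0, hd⟩ ≤ a n →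
        |z ⟨0, hd⟩ - x ⟨0, hd⟩| ≤ a n →
        |Gt n x (fun j => (n : ℝ) + z j) /
            (OrderedWalk.chi d * OrderedWalk.vandermonde x * OrderedWalk.vandermonde z *
              (n : ℝ) ^ (-((d : ℝ) * ((d : ℝ) - 1) / 2) - (d : ℝ) / 2)) - 1| < ε ∧
        |G n x (fun j => (n : ℝ) + z j) /
            (OrderedWalk.chi d * OrderedWalk.h x * OrderedWalk.hHat z *
              (n : ℝ) ^ (-((d : ℝ) * ((d : ℝ) - 1) / 2) - (d : ℝ) / 2)) - 1| < ε := by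
  -- The interlacing walk is treated for dimensions of the form `D + 1`.
  have hRho : OrderedWalk.IsKilledDensity P X (OrderedWalk.rho X) OrderedWalk.densRho := by
    obtain ⟨D, rfl⟩ := Nat.exists_eq_succ_of_ne_zero hd.ne'
    exact OrderedWalk.isKilledDensity_densRho hmeas hexp hindep
  have hTau : OrderedWalk.IsKilledDensity P X (OrderedWalk.tau X) OrderedWalk.densTau :=
    OrderedWalk.isKilledDensity_densTau hmeas hexp hindep
  refine ⟨⟨_, hRho⟩, ⟨_, hTau⟩, fun Gt G hGt hG a ha ε hε => ?_⟩
  filter_upwards [OrderedWalk.eventually_abs_densRho_div_sub_one_lt hd ha hε,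
    OrderedWalk.eventually_abs_densTau_div_sub_one_lt hd ha hε, eventually_ge_atTop 2]
    with n h1 h2 hn x hx z hz hxa hza hxz
  have hnz : (fun j => (n : ℝ) + z j) ∈ OrderedWalk.weylChamber d :=
    fun i j hij => add_lt_add_right (hz hij) _
  rw [hGt.eqOn hRho hn hx hnz, hG.eqOn hTau hn hx hnz]
  exact ⟨h1 x hx z hz hxa hza hxz, h2 x hx z hz hxa hza hxz⟩
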